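/- Let $M$ be a closed smooth manifold of dimension $n$, oriented by a volume form $\nu$. Let $\operatorname{Prob}(M)$ be the set of smooth $n$-forms $\mu>0$ with $\int_M\mu=1$, let $T_\mu\operatorname{Prob}(M)=\{a\in\Omega^n(M):\int_M a=0\}$, and fix $\mu\in\operatorname{Prob}(M)$. Let $\operatorname{Diff}(M)$ be the group of orientation preserving diffeomorphisms, put $\alpha(\varphi)=\varphi^*\mu/\mu$, and let $$c(\varphi_1,\dots,\varphi_{n+1})=\int_M \log\alpha(\tilde\varphi_1)\, d\log\alpha(\tilde\varphi_2)\wedge\cdots\wedge d\log\alpha(\tilde\varphi_{n+1}),\qquad \tilde\varphi_i=\varphi_1\varphi_2\cdots\varphi_i,$$ be the Bott–Thurston cochain, where the product is read either as $\varphi_1\circ\cdots\circ\varphi_i$ or as $\varphi_i\circ\cdots\circ\varphi_1$ (everything below holds for both conventions). Then: 1. $$\omega(a_1,\dots,a_{n+1})=\int_M \frac{a_1}{\mu}\,d\frac{a_2}{\mu}\wedge\cdots\wedge d\frac{a_{n+1}}{\mu}$$ is an alternating $(n+1)$-linear form on $T_\mu\operatorname{Prob}(M)$. 2. It is the mixed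 partial derivative of $c$: if $t\mapsto\varphi_i^{t}$ ($t\in\mathbb R$, $i=1,\dots,n+1$) are smooth curves in $\operatorname{Diff}(M)$ with $\varphi_i^0=\mathrm{id}$ and $\frac{d}{dt}\big|_{t=0}(\varphi_i^t)^*\mu=a_i\in T_\mu\operatorname{Prob}(M)$, then $(t_1,\dots,t_{n+1})\mapsto c(\varphi_1^{t_1},\dots,\varphi_{n+1}^{t_{n+1}})$ is smooth and $$\left.\frac{\partial^{n+1}}{\partial t_1\cdots\partial t_{n+1}}\right|_{t=0}c(\varphi_1^{t_1},\dots,\varphi_{n+1}^{t_{n+1}})=\omega(a_1,\dots,a_{n+1}).$$ If $M$ is connected, every $a\in T_\mu\operatorname{Prob}(M)$ is $\frac{d}{dt}\big|_{t=0}(\varphi^t)^*\mu$ for some such curve. 3. $\omega$ is an $(n+1)$-cocycle in Lie algebra cohomology: the map $u\mapsto L_u\mu=\operatorname{div}_\mu(u)\,\mu$ is linear from $\operatorname{Vect}(M)$ to $T_\mu\operatorname{Prob}(M)$, it is the derivative at the identity of $\varphi\mapsto\varphi^*\mu$ (a curve $\varphi^t$ as above with velocity $u$ at $t=0$ satisfies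 $\frac{d}{dt}\big|_{t=0}(\varphi^t)^*\mu=L_u\mu$), and the cochain $(u_1,\dots,u_{n+1})\mapsto\omega(L_{u_1}\mu,\dots,L_{u_{n+1}}\mu)$ on the Lie algebra $\operatorname{Vect}(M)$ is closed for the Chevalley–Eilenberg differential with trivial coefficients $\mathbb R$. 4. On $M=S^1=\mathbb R/2\pi\mathbb Z$ with $\mu$ a positive multiple $r\,dx$ of $dx$ (in particular $r=\frac1{2\pi}$, for which $\mu\in\operatorname{Prob}(S^1)$), $\omega$ is the Gelfand–Fuchs $2$-cocycle: for all smooth vector fields $f\partial_x$, $g\partial_x$ on $S^1$, $$\omega(L_{f\partial_x}\mu,L_{g\partial_x}\mu)=\int_0^{2\pi} f'(x)\,g''(x)\,dx .$$ -/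

import Mathlib

open scoped Manifold ContDiff

noncomputable section

namespace BottThurston

/-! ### Differential forms of top degree on a manifold of dimension `n` -/

section Forms

variable {n : ℕ} {M : Type*} [TopologicalSpace M] [ChartedSpace (EuclideanSpace ℝ (Fin n)) M]

variable (n M) in
/-- A (not necessarily smooth) field of alternating `n`-forms on the `n`-manifold `M`. -/
abbrev FormField : Type _ := ∀ x : M, TangentSpace (𝓡 n) x [⋀^Fin n]→L[ℝ] ℝ

/-- The standard basis of the tangent space at `x`, identified with `ℝⁿ` by the preferred chart
at `x`. -/
def stdBasis (x : M) (i : Fin n) : TangentSpace (𝓡 n) x :=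
  (EuclideanSpace.single i (1 : ℝ) : EuclideanSpace ℝ (Fin n))

/-- The coefficient `h` of `η = h dy₁ ∧ ⋯ ∧ dyₙ` in the chart around `c`, as a function on the
range of the chart. -/
def chartCoeff (c : M) (η : FormField n M) (y : EuclideanSpace ℝ (Fin n)) : ℝ :=
  η ((extChartAt (𝓡 n) c).symm y) fun i =>
    mfderiv (𝓡 n) (𝓡 n) (extChartAt (𝓡 n) c).symm y (EuclideanSpace.single i (1 : ℝ))

/-- The space `Ωⁿ(M)` of smooth `n`-forms: those whose coefficient is smooth in each chart. -/
def smoothForms (n : ℕ) (M : Type*) [TopologicalSpace M]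
    [ChartedSpace (EuclideanSpace ℝ (Fin n)) M] : Submodule ℝ (FormField n M) where
  carrier := {η | ∀ c : M, ContDiffOn ℝ ∞ (chartCoeff c η) (extChartAt (𝓡 n) c).target}
  add_mem' := fun ha hb c => (ha c).add (hb c)
  zero_mem' := fun _ => contDiffOn_const
  smul_mem' := fun _ _ ha c => contDiffOn_const.mul (ha c)

lemma contDiffOn_chartCoeff {η : FormField n M} (hη : η ∈ smoothForms n M) (c : M) :
    ContDiffOn ℝ ∞ (chartCoeff c η) (extChartAt (𝓡 n) c).target := hη c

variable (n M) in
/-- A volume form: a smooth nowhere vanishing `n`-form. It orients `M`. -/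
structure VolumeForm where
  toForm : FormField n M
  smooth : toForm ∈ smoothForms n M
  ne_zero : ∀ x, toForm x ≠ 0

/-- The quotient `a / μ` of two `n`-forms, i.e. the function `h` with `a = h μ`
(`μ` nowhere zero). -/
def ratio (a μ : FormField n M) (x : M) : ℝ := a x (stdBasis x) / μ x (stdBasis x)

/-- The pullback `φ^* η`. -/
def pullback (φ : M → M) (η : FormField n M) : FormField n M := fun x =>
  (η (φ x)).compContinuousLinearMap (mfderiv (𝓡 n) (𝓡 n) φ x)

/-- The wedge product `ℓ₁ ∧ ⋯ ∧ ℓₙ` of `n` covectors; its value on `v₁, …, vₙ` is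
`∑_σ sign(σ) ∏ᵢ ℓᵢ(v_{σ i})`, the determinant of `(ℓᵢ(vⱼ))`. -/
def wedge {V : Type*} [AddCommGroup V] [Module ℝ V] [TopologicalSpace V]
    (ℓ : Fin n → V →L[ℝ] ℝ) : V [⋀^Fin n]→L[ℝ] ℝ :=
  ContinuousMultilinearMap.alternatization
    ((ContinuousMultilinearMap.mkPiAlgebraFin ℝ n ℝ).compContinuousLinearMap ℓ)

/-- The `n`-form `f₀ df₁ ∧ ⋯ ∧ dfₙ`. -/
def wedgeForm (f : Fin (n + 1) → M → ℝ) : FormField n M := fun x =>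
  f 0 x • wedge fun i : Fin n => (mfderiv (𝓡 n) 𝓘(ℝ, ℝ) (f i.succ) x :
    TangentSpace (𝓡 n) x →L[ℝ] ℝ)

end Forms

/-! ### Integration over a closed manifold oriented by a volume form -/

section Integral

variable {n : ℕ} {M : Type*} [TopologicalSpace M] [ChartedSpace (EuclideanSpace ℝ (Fin n)) M]
  [IsManifold (𝓡 n) ∞ M] [T2Space M] [CompactSpace M]

variable (n M) in
/-- A smooth partition of unity on `M` subordinate to the charts. -/
def partition : SmoothPartitionOfUnity M (𝓡 n) M Set.univ :=
  (SmoothPartitionOfUnity.exists_isSubordinate_chartAt_source (𝓡 n) M).choose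

lemma partition_subordinate :
    (partition n M).IsSubordinate fun x => (chartAt (EuclideanSpace ℝ (Fin n)) x).source :=
  (SmoothPartitionOfUnity.exists_isSubordinate_chartAt_source (𝓡 n) M).choose_spec

/-- The contribution of one chart to the integral: `∫ ρ_c η` in the coordinates of the chart
around `c`, the sign accounting for a chart that does not preserve the orientation. -/
def chartIntegrand (ν : VolumeForm n M) (c : M) (η : FormField n M)
    (y : EuclideanSpace ℝ (Fin n)) : ℝ :=
  Real.sign (chartCoeff c ν.toForm y) *
    (partition n M c ((extChartAt (𝓡 n) c).symm y) * chartCoeff c η y)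

/-- The integral `∫_M η`, with `M` oriented by the volume form `ν`. -/
def VolumeForm.integral (ν : VolumeForm n M) (η : FormField n M) : ℝ :=
  ∑ᶠ c : M, ∫ y in (extChartAt (𝓡 n) c).target, chartIntegrand ν c η y

lemma integrableOn_chartIntegrand (ν : VolumeForm n M) (c : M) {η : FormField n M}
    (hη : η ∈ smoothForms n M) :
    MeasureTheory.IntegrableOn (chartIntegrand ν c η) (extChartAt (𝓡 n) c).target := by
  have hto : IsOpen (extChartAt (𝓡 n) c).target := isOpen_extChartAt_target c
  have hsub : tsupport (partition n M c) ⊆ (extChartAt (𝓡 n) c).source := by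
    rw [extChartAt_source]; exact partition_subordinate c
  have hcts : ContinuousOn (fun y => partition n M c ((extChartAt (𝓡 n) c).symm y) *
      chartCoeff c η y) (extChartAt (𝓡 n) c).target :=
    ((partition n M c).contMDiff.continuous.comp_continuousOn (continuousOn_extChartAt_symm c)).mul
      (contDiffOn_chartCoeff hη c).continuousOn
  have hK : IsCompact ((extChartAt (𝓡 n) c) '' tsupport (partition n M c)) :=
    (isClosed_tsupport _).isCompact.image_of_continuousOn
      ((continuousOn_extChartAt c).mono hsub)
  have hKt : (extChartAt (𝓡 n) c) '' tsupport (partition n M c) ⊆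
      (extChartAt (𝓡 n) c).target := by
    rintro _ ⟨x, hx, rfl⟩
    exact (extChartAt (𝓡 n) c).map_source (hsub hx)
  have h1 : MeasureTheory.IntegrableOn (fun y => partition n M c ((extChartAt (𝓡 n) c).symm y) *
      chartCoeff c η y) (extChartAt (𝓡 n) c).target := by
    refine MeasureTheory.IntegrableOn.of_forall_sdiff_eq_zero
      ((hcts.mono hKt).integrableOn_compact hK) hto.measurableSet ?_
    rintro y ⟨hy, hyK⟩
    have : partition n M c ((extChartAt (𝓡 n) c).symm y) = 0 := by
      by_contra hne
      exact hyK ⟨_, subset_tsupport _ hne, (extChartAt (𝓡 n) c).right_inv hy⟩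
    rw [this, zero_mul]
  refine MeasureTheory.Integrable.bdd_mul (c := 1) h1 ?_ ?_
  · have hm : Measurable Real.sign :=
      Measurable.ite measurableSet_Iio measurable_const
        (Measurable.ite measurableSet_Ioi measurable_const measurable_const)
    have := ((contDiffOn_chartCoeff ν.smooth c).continuousOn.aemeasurable (μ := MeasureTheory.volume) hto.measurableSet)
    exact (hm.comp_aemeasurable this).aestronglyMeasurable
  · refine Filter.Eventually.of_forall fun y => ?_
    rcases Real.sign_apply_eq (chartCoeff c ν.toForm y) with h | h | h <;> simp [h]

lemma support_chartIntegral_finite (ν : VolumeForm n M) (η : FormField n M) :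
    (Function.support fun c : M =>
      ∫ y in (extChartAt (𝓡 n) c).target, chartIntegrand ν c η y).Finite := by
  refine ((partition n M).locallyFinite.finite_nonempty_of_compact).subset ?_
  intro c hc
  by_contra hne
  rw [Set.mem_ofPred_eq, Set.not_nonempty_iff_eq_empty, Function.support_eq_empty_iff] at hne
  exact hc (by simp [chartIntegrand, hne])

lemma VolumeForm.integral_add (ν : VolumeForm n M) {a b : FormField n M}
    (ha : a ∈ smoothForms n M) (hb : b ∈ smoothForms n M) :
    ν.integral (a + b) = ν.integral a + ν.integral b := by
  unfold VolumeForm.integral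
  rw [← finsum_add_distrib (support_chartIntegral_finite ν a) (support_chartIntegral_finite ν b)]
  refine finsum_congr fun c => ?_
  rw [← MeasureTheory.integral_add (integrableOn_chartIntegrand ν c ha)
    (integrableOn_chartIntegrand ν c hb)]
  congr 1
  funext y
  have : chartCoeff c (a + b) y = chartCoeff c a y + chartCoeff c b y := rfl
  simp only [chartIntegrand, this]
  ring

lemma VolumeForm.integral_smul (ν : VolumeForm n M) (r : ℝ) (a : FormField n M) :
    ν.integral (r • a) = r * ν.integral a := by
  unfold VolumeForm.integral
  rw [← smul_eq_mul, smul_finsum' r (support_chartIntegral_finite ν a)]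
  refine finsum_congr fun c => ?_
  rw [← MeasureTheory.integral_smul]
  congr 1
  funext y
  have : chartCoeff c (r • a) y = r * chartCoeff c a y := rfl
  simp only [chartIntegrand, this, smul_eq_mul]
  ring

/-- `Prob(M)`: the positive `n`-forms of total integral one. -/
def Prob (ν : VolumeForm n M) : Set (FormField n M) :=
  {μ | μ ∈ smoothForms n M ∧ (∀ x, 0 < ratio μ ν.toForm x) ∧ ν.integral μ = 1}

/-- The tangent space of `Prob(M)` at any of its points: the smooth `n`-forms of
integral zero. -/
def TangentProb (ν : VolumeForm n M) : Submodule ℝ (FormField n M) where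
  carrier := {a | a ∈ smoothForms n M ∧ ν.integral a = 0}
  add_mem' := fun ha hb => ⟨add_mem ha.1 hb.1, by
    rw [ν.integral_add ha.1 hb.1, ha.2, hb.2, add_zero]⟩
  zero_mem' := ⟨zero_mem _, by simpa using ν.integral_smul 0 0⟩
  smul_mem' := fun r a ha => ⟨Submodule.smul_mem _ r ha.1, by
    rw [ν.integral_smul, ha.2, mul_zero]⟩

/-- `∫_M (a₁/μ) d(a₂/μ) ∧ ⋯ ∧ d(aₙ₊₁/μ)`. -/
def omegaForm (ν : VolumeForm n M) (μ : FormField n M) (a : Fin (n + 1) → FormField n M) : ℝ :=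
  ν.integral (wedgeForm fun i => ratio (a i) μ)

/-! ### Diffeomorphisms and the Bott–Thurston cocycle -/

/-- `Diff(M)`: the orientation preserving smooth diffeomorphisms of `M`. -/
def Diff (ν : VolumeForm n M) : Type _ :=
  {φ : M ≃ₘ^∞⟮𝓡 n, 𝓡 n⟯ M // ∀ x, 0 < ratio (pullback φ ν.toForm) ν.toForm x}

/-- `log α(φ)`, where `α(φ) = φ^* μ / μ` is the Jacobian of `φ` with respect to `μ`. -/
def logJac (μ : FormField n M) (φ : M → M) (x : M) : ℝ := Real.log (ratio (pullback φ μ) μ x)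

/-- The products `φ₁ ∘ φ₂ ∘ ⋯ ∘ φᵢ` (indices starting at `0`). -/
def partialProduct {k : ℕ} (φ : Fin k → M → M) (i : Fin k) : M → M :=
  ((List.ofFn φ).take (i + 1)).foldr (fun f g => f ∘ g) id

/-- The products `φᵢ ∘ ⋯ ∘ φ₂ ∘ φ₁`, i.e. `φ₁ φ₂ ⋯ φᵢ` in the opposite convention for the
product, in which the left factor is applied first. -/
def partialProductRev {k : ℕ} (φ : Fin k → M → M) (i : Fin k) : M → M :=
  ((List.ofFn φ).take (i + 1)).foldl (fun g f => f ∘ g) id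

/-- The Bott–Thurston cocycle
`c(φ₁, …, φₙ₊₁) = ∫_M log α(ψ₁) d log α(ψ₂) ∧ ⋯ ∧ d log α(ψₙ₊₁)`, `ψᵢ = φ₁ ∘ ⋯ ∘ φᵢ`. -/
def bottThurston (ν : VolumeForm n M) (μ : FormField n M) (φ : Fin (n + 1) → Diff ν) : ℝ :=
  ν.integral (wedgeForm fun i => logJac μ (partialProduct (fun j => ⇑(φ j).1) i))

/-- The Bott–Thurston cocycle for the opposite convention: `ψᵢ = φᵢ ∘ ⋯ ∘ φ₁`. -/
def bottThurstonRev (ν : VolumeForm n M) (μ : FormField n M) (φ : Fin (n + 1) → Diff ν) : ℝ :=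
  ν.integral (wedgeForm fun i => logJac μ (partialProductRev (fun j => ⇑(φ j).1) i))

/-- A smooth curve in `Diff(M)` through the identity at time `0`. -/
structure DiffCurve (ν : VolumeForm n M) where
  toFun : ℝ → Diff ν
  smooth : ContMDiff (𝓘(ℝ, ℝ).prod (𝓡 n)) (𝓡 n) ∞ fun p : ℝ × M => (toFun p.1).1 p.2
  map_zero : ∀ x, (toFun 0).1 x = x

/-- The `n`-form `a` is the tangent at `t = 0` of the curve `t ↦ (φ^t)^* μ`. -/
def IsTangent {ν : VolumeForm n M} (μ : FormField n M) (φ : DiffCurve ν) (a : FormField n M) :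
    Prop :=
  ∀ (x : M) (v : Fin n → TangentSpace (𝓡 n) x),
    HasDerivAt (fun t : ℝ => pullback (φ.toFun t).1 μ x v) (a x v) 0

end Integral

/-! ### The Lie algebra of vector fields -/

section VectorFields

variable {n : ℕ} {M : Type*} [TopologicalSpace M] [ChartedSpace (EuclideanSpace ℝ (Fin n)) M]
  [IsManifold (𝓡 n) ∞ M]

variable (n M) in
/-- `Vect(M)`: the smooth vector fields on `M`. -/
abbrev Vect : Type _ :=
  Cₛ^∞⟮𝓡 n; EuclideanSpace ℝ (Fin n), (TangentSpace (𝓡 n) : M → Type _)⟯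

lemma isManifold_minSmoothness (k : ℕ) : IsManifold (𝓡 n) (minSmoothness ℝ k) M := by
  rw [minSmoothness_of_isRCLikeNormedField]
  infer_instance

/-- The Lie bracket of vector fields. -/
instance : Bracket (Vect n M) (Vect n M) where
  bracket u v := ⟨VectorField.mlieBracket (𝓡 n) u v, by
    have : IsManifold (𝓡 n) (minSmoothness ℝ 2) M := isManifold_minSmoothness 2
    have : IsManifold (𝓡 n) (((⊤ : ℕ∞) : ℕ∞ω) + 1) M := ‹IsManifold (𝓡 n) ∞ M›
    exact ContDiff.mlieBracket_vectorField (m := ⊤) (n := ⊤) u.contMDiff v.contMDiff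
      (by rw [minSmoothness_of_isRCLikeNormedField]; exact le_rfl)⟩

lemma bracket_coe (u v : Vect n M) :
    (⇑⁅u, v⁆ : ∀ x : M, TangentSpace (𝓡 n) x) = VectorField.mlieBracket (𝓡 n) u v := rfl

lemma Vect.mdiffAt (u : Vect n M) (x : M) :
    MDifferentiableAt (𝓡 n) (𝓡 n).tangent
      (fun y => (⟨y, u y⟩ : TangentBundle (𝓡 n) M)) x := u.mdifferentiableAt

lemma Vect.contMDiff_minSmoothness (u : Vect n M) :
    ContMDiff (𝓡 n) (𝓡 n).tangent (minSmoothness ℝ 2)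
      (fun y => (⟨y, u y⟩ : TangentBundle (𝓡 n) M)) := by
  rw [minSmoothness_of_isRCLikeNormedField]
  exact u.contMDiff.of_le ENat.LEInfty.out

instance : LieRing (Vect n M) where
  add_lie u v w := by
    ext x
    exact VectorField.mlieBracket_add_left (u.mdiffAt x) (v.mdiffAt x)
  lie_add u v w := by
    ext x
    exact VectorField.mlieBracket_add_right (v.mdiffAt x) (w.mdiffAt x)
  lie_self u := by
    ext x
    rw [bracket_coe, VectorField.mlieBracket_self]
    rfl
  leibniz_lie u v w := by
    ext x
    have : IsManifold (𝓡 n) (minSmoothness ℝ 3) M := isManifold_minSmoothness 3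
    exact VectorField.leibniz_identity_mlieBracket_apply (u.contMDiff_minSmoothness x)
      (v.contMDiff_minSmoothness x) (w.contMDiff_minSmoothness x)

instance : LieAlgebra ℝ (Vect n M) where
  lie_smul r u v := by
    ext x
    exact VectorField.mlieBracket_const_smul_right (v.mdiffAt x)

/-- The Chevalley–Eilenberg differential, for trivial coefficients, of an alternating
`(k+1)`-cochain on a Lie algebra:
`(dw)(u₀, …, uₖ₊₁) = ∑_{i<j} (-1)^{i+j} w([uᵢ, uⱼ], u₀, …, ûᵢ, …, ûⱼ, …, uₖ₊₁)`. -/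
def lieDifferential {L : Type*} [LieRing L] [LieAlgebra ℝ L] {k : ℕ}
    (w : L [⋀^Fin (k + 1)]→ₗ[ℝ] ℝ) (u : Fin (k + 2) → L) : ℝ :=
  ∑ j : Fin (k + 2), ∑ i : Fin (k + 1), if i.castSucc < j then
    (-1) ^ ((i : ℕ) + (j : ℕ)) *
      w (Fin.cons ⁅u i.castSucc, u j⁆ (i.removeNth (j.removeNth u)))
  else 0

/-- The components of a vector field in the chart around `c`. -/
def chartField (c : M) (u : Vect n M) (y : EuclideanSpace ℝ (Fin n)) :
    EuclideanSpace ℝ (Fin n) :=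
  mfderiv (𝓡 n) (𝓡 n) (extChartAt (𝓡 n) c) ((extChartAt (𝓡 n) c).symm y)
    (u ((extChartAt (𝓡 n) c).symm y))

/-- The divergence of `u` with respect to `μ`: in the chart around `x`, where
`μ = ρ dy₁ ∧ ⋯ ∧ dyₙ`, it is `ρ⁻¹ ∑ᵢ ∂ᵢ(ρ uᵢ)`. -/
def divergence (μ : FormField n M) (u : Vect n M) (x : M) : ℝ :=
  (chartCoeff x μ (extChartAt (𝓡 n) x x))⁻¹ *
    ∑ i : Fin n, fderiv ℝ (fun y => chartCoeff x μ y * chartField x u y i)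
      (extChartAt (𝓡 n) x x) (EuclideanSpace.single i (1 : ℝ))

/-- The Lie derivative `L_u μ = div_μ(u) μ` of a positive `n`-form. -/
def lieDerivative (μ : FormField n M) (u : Vect n M) : FormField n M := fun x =>
  divergence μ u x • μ x

/-- `u` is the velocity at time `0` of the curve `φ` in `Diff(M)`. -/
def IsVelocity [T2Space M] [CompactSpace M] {ν : VolumeForm n M} (φ : DiffCurve ν)
    (u : Vect n M) : Prop :=
  ∀ x : M, (mfderiv 𝓘(ℝ, ℝ) (𝓡 n) (fun t : ℝ => (φ.toFun t).1 x) 0 (1 : ℝ) :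
    EuclideanSpace ℝ (Fin n)) = u x

/-- The unit vector field `∂ₓ` on the circle, at the point of angle `x`. -/
def circlePartial (x : ℝ) : TangentSpace (𝓡 1) (Circle.exp x) :=
  mfderiv 𝓘(ℝ, ℝ) (𝓡 1) Circle.exp x (1 : ℝ)

end VectorFields

end BottThurston

end

open BottThurston

open scoped Manifold ContDiff

noncomputable section

namespace BottThurston

open Set Filter Topology MeasureTheory

/-! ### Alternating forms of top degree on Euclidean space -/

section Linear

variable {n : ℕ}

/-! Dividing by `μ` turns forms of top degree into functions, and all four claims become statements
about `∫ f₀ df₁ ∧ ⋯ ∧ dfₙ`, whose integrand in a chart is `f₀` times the determinant of the partial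
derivatives. The integral is defined with a partition of unity; `VolumeForm.integral_eq_setIntegral`
shows that it can be computed in any single parametrization that covers enough of the manifold.

Alternation. Two equal arguments among the last `n` give a determinant with two equal rows. If the
argument outside the differentials equals one inside, then `f df = d(f²/2)`, and the integral
vanishes by Stokes' theorem (`wedgeIntegral_eq_zero_of_eq_one`). Stokes is reduced by a partition of
unity to Euclidean space, where integration by parts and the symmetry of second derivatives make the
terms of the determinant cancel in pairs.

Mixed derivative. Let `ψᵢ` be the `i`-th partial product. The function `log α(ψᵢ)` vanishes at time
zero and depends only on the times `t₁, …, tᵢ` (`IsTriangularFamily`). The integrand is a sum of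
products of `n + 1` such factors. Differentiating in the last time can only hit the last factor in a
way that survives at zero, then the next time only the next factor, and so on; the result is the
product of the first derivatives (`iteratedFDeriv_prod_mul`). With all times but `tᵢ` equal to zero,
`ψᵢ` is `φᵢ`, so the `i`-th first derivative is `aᵢ/μ`. The order of the factors inside `ψᵢ` plays
no role, which is why both conventions work.

Curves with a prescribed tangent. The functions `f` for which `fμ` is tangent to some curve form a
vector space: compose curves, rescale time. It contains the divergences of coordinate fields with
compact support in a chart, since `id + s(t) w` is a diffeomorphism when `s(t) w` has a small
Lipschitz constant. By the Poincaré lemma with compact support it contains all functions of integral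
zero supported near a given point. Modulo this space the class of a local bump of integral one is
locally constant in its centre, hence constant if `M` is connected, and a partition of unity
finishes (`mem_tangentFunctions`).

Cocycle. The identity `div [u, v] = u(div v) - v(div u)` (`divergence_lie`) turns the
Chevalley–Eilenberg differential into the integral of a form that is already zero pointwise. For
each `j` the terms in which `u_j` differentiates a function are the contraction with `u_j` of an
`(n+1)`-form, and such a form vanishes in dimension `n` (`sum_wedge_eq_zero`). The divergence itself
is identified, chart by chart, as the derivative of the Jacobian along a curve, which also proves
that it does not depend on the chart.

Circle. The covering `x ↦ exp(ix)` on `(0, 2π)` misses one point, the divergence of `f ∂ₓ` for `r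
dx` is `f'`, and the formula follows. -/

lemma det_eq_matrix_det (A : EuclideanSpace ℝ (Fin n) →L[ℝ] EuclideanSpace ℝ (Fin n)) :
    A.det = Matrix.det (Matrix.of fun i j => A (EuclideanSpace.single j 1) i) := by
  rw [ContinuousLinearMap.det, ← LinearMap.det_toMatrix (EuclideanSpace.basisFun (Fin n) ℝ).toBasis]
  congr 1

/-- Forms of top degree are a line spanned by the determinant; every proportionality between
`n`-forms below comes from here. -/
lemma alternating_eq_det (f : EuclideanSpace ℝ (Fin n) [⋀^Fin n]→L[ℝ] ℝ)
    (v : Fin n → EuclideanSpace ℝ (Fin n)) :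
    f v = f (fun i => EuclideanSpace.single i 1) *
      (EuclideanSpace.basisFun (Fin n) ℝ).toBasis.det v := by
  have h := AlternatingMap.eq_smul_basis_det (EuclideanSpace.basisFun (Fin n) ℝ).toBasis
    f.toAlternatingMap
  have h2 := congrArg (fun g => g v) h
  have h3 : (fun i : Fin n => EuclideanSpace.single i (1 : ℝ)) =
    ⇑(EuclideanSpace.basisFun (Fin n) ℝ) := by ext1 i; simp
  rw [h3]
  simpa using! h2

lemma alternating_map (f : EuclideanSpace ℝ (Fin n) [⋀^Fin n]→L[ℝ] ℝ)
    (A : EuclideanSpace ℝ (Fin n) →L[ℝ] EuclideanSpace ℝ (Fin n)) :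
    f (fun i => A (EuclideanSpace.single i 1)) =
      A.det * f (fun i => EuclideanSpace.single i 1) := by
  rw [alternating_eq_det, mul_comm]
  congr 1
  have := Module.Basis.det_comp_basis (EuclideanSpace.basisFun (Fin n) ℝ).toBasis
    (EuclideanSpace.basisFun (Fin n) ℝ).toBasis A.toLinearMap
  simpa [Function.comp_def] using! this

/-- Proportionality of two forms of top degree in cross-multiplied form, so that neither has to be
nonzero and no vector family has to be a basis. -/
lemma alternating_cross (f g : EuclideanSpace ℝ (Fin n) [⋀^Fin n]→L[ℝ] ℝ)
    (v w : Fin n → EuclideanSpace ℝ (Fin n)) : f v * g w = f w * g v := by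
  rw [alternating_eq_det f v, alternating_eq_det f w, alternating_eq_det g v,
    alternating_eq_det g w]
  ring

lemma wedge_apply {V : Type*} [AddCommGroup V] [Module ℝ V] [TopologicalSpace V]
    (ℓ : Fin n → V →L[ℝ] ℝ) (v : Fin n → V) :
    wedge ℓ v = Matrix.det (Matrix.of fun i j => ℓ i (v j)) := by
  -- The alternatization permutes the vectors and not the covectors, so the expansion to match is
  -- that of the transpose.
  rw [← Matrix.det_transpose, Matrix.det_apply, wedge,
    ContinuousMultilinearMap.alternatization_apply_apply]
  simp [List.prod_ofFn]

end Linear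

/-! ### Forms, ratios and pullbacks in local coordinates -/

section Coordinates

variable {n : ℕ} {M : Type*} [TopologicalSpace M] [ChartedSpace (EuclideanSpace ℝ (Fin n)) M]

/-- The coefficient of the pullback of `η` along a parametrization `ψ`. -/
def formCoeff (ψ : EuclideanSpace ℝ (Fin n) → M) (η : FormField n M)
    (z : EuclideanSpace ℝ (Fin n)) : ℝ :=
  η (ψ z) fun i => mfderiv (𝓡 n) (𝓡 n) ψ z (EuclideanSpace.single i (1 : ℝ))

lemma chartCoeff_eq_formCoeff (c : M) (η : FormField n M) :
    chartCoeff c η = formCoeff (extChartAt (𝓡 n) c).symm η := rfl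

lemma form_cross (η μ : FormField n M) (x : M) (v w : Fin n → TangentSpace (𝓡 n) x) :
    η x v * μ x w = η x w * μ x v := alternating_cross (n := n) (η x) (μ x) v w

lemma form_stdBasis_ne_zero {μ : FormField n M} {x : M} (h : μ x ≠ 0) : μ x (stdBasis x) ≠ 0 := by
  intro h0
  apply h
  ext v
  have : μ x v = _ := alternating_eq_det (n := n) (μ x) v
  rw [this]
  change μ x (stdBasis x) * _ = 0
  rw [h0, zero_mul]

/-- `ratio` is computed on the standard basis of one chart; by proportionality it is the same on
every family of vectors, so it is a genuine quotient of forms. -/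
lemma ratio_mul {μ : FormField n M} {x : M} (h : μ x ≠ 0) (η : FormField n M)
    (v : Fin n → TangentSpace (𝓡 n) x) : η x v = ratio η μ x * μ x v := by
  rw [ratio, div_mul_eq_mul_div, eq_div_iff (form_stdBasis_ne_zero h)]
  exact form_cross η μ x v _

lemma ratio_smul_form {μ : FormField n M} (h : ∀ x, μ x ≠ 0) (η : FormField n M) :
    (fun x => ratio η μ x • μ x) = η := by
  funext x
  ext v
  exact (ratio_mul (h x) η v).symm

lemma ratio_eq_of_smul {μ η : FormField n M} {x : M} (h : μ x ≠ 0) {r : ℝ}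
    (hr : η x = r • μ x) : ratio η μ x = r := by
  rw [ratio, hr]
  exact mul_div_cancel_right₀ r (form_stdBasis_ne_zero h)

lemma ratio_smul_self {μ : FormField n M} (h : ∀ x, μ x ≠ 0) (f : M → ℝ) (x : M) :
    ratio (fun x => f x • μ x) μ x = f x := ratio_eq_of_smul (h x) rfl

lemma formCoeff_eq_ratio {μ : FormField n M} (h : ∀ x, μ x ≠ 0)
    (ψ : EuclideanSpace ℝ (Fin n) → M) (η : FormField n M) (z : EuclideanSpace ℝ (Fin n)) :
    formCoeff ψ η z = ratio η μ (ψ z) * formCoeff ψ μ z := ratio_mul (h _) η _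

/-- Two parametrizations that agree near a point have the same coefficients there. -/
lemma formCoeff_congr {ψ φ : EuclideanSpace ℝ (Fin n) → M} {z : EuclideanSpace ℝ (Fin n)}
    (h : ψ =ᶠ[𝓝 z] φ) (η : FormField n M) : formCoeff ψ η z = formCoeff φ η z := by
  unfold formCoeff
  rw [h.mfderiv_eq, h.eq_of_nhds]

/-- The chain rule and the determinant rule for top forms: reparametrizing multiplies the
coefficient by the Jacobian determinant. -/
lemma formCoeff_comp {ψ : EuclideanSpace ℝ (Fin n) → M}
    {T : EuclideanSpace ℝ (Fin n) → EuclideanSpace ℝ (Fin n)} {z : EuclideanSpace ℝ (Fin n)}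
    (hψ : MDifferentiableAt (𝓡 n) (𝓡 n) ψ (T z)) (hT : DifferentiableAt ℝ T z)
    (η : FormField n M) :
    formCoeff (ψ ∘ T) η z = (fderiv ℝ T z).det * formCoeff ψ η (T z) := by
  unfold formCoeff
  have h1 : mfderiv (𝓡 n) (𝓡 n) (ψ ∘ T) z = (mfderiv (𝓡 n) (𝓡 n) ψ (T z)).comp
      (mfderiv (𝓡 n) (𝓡 n) T z) := mfderiv_comp z hψ hT.mdifferentiableAt
  rw [h1, mfderiv_eq_fderiv]
  exact alternating_map (n := n)
    ((η (ψ (T z))).compContinuousLinearMap (mfderiv (𝓡 n) (𝓡 n) ψ (T z))) (fderiv ℝ T z)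

lemma formCoeff_pullback {ψ : EuclideanSpace ℝ (Fin n) → M} {φ : M → M}
    {z : EuclideanSpace ℝ (Fin n)} (hψ : MDifferentiableAt (𝓡 n) (𝓡 n) ψ z)
    (hφ : MDifferentiableAt (𝓡 n) (𝓡 n) φ (ψ z)) (η : FormField n M) :
    formCoeff ψ (pullback φ η) z = formCoeff (φ ∘ ψ) η z := by
  unfold formCoeff pullback
  rw [mfderiv_comp z hφ hψ]
  rfl

lemma pullback_comp {φ ψ : M → M} {x : M} (hψ : MDifferentiableAt (𝓡 n) (𝓡 n) ψ x)
    (hφ : MDifferentiableAt (𝓡 n) (𝓡 n) φ (ψ x)) (η : FormField n M) :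
    pullback (φ ∘ ψ) η x = pullback ψ (pullback φ η) x := by
  unfold pullback
  rw [mfderiv_comp x hφ hψ]
  rfl

lemma pullback_id (η : FormField n M) (x : M) : pullback id η x = η x := by
  unfold pullback
  rw [mfderiv_id]
  rfl

/-- The chain rule in the form `α(φ ∘ ψ) = (α(φ) ∘ ψ) α(ψ)`. It serves for the positivity of
Jacobians of products and for the derivative of a composition of curves. -/
lemma ratio_pullback_comp {μ : FormField n M} (hμ : ∀ x, μ x ≠ 0) {φ ψ : M → M} {x : M}
    (hψ : MDifferentiableAt (𝓡 n) (𝓡 n) ψ x) (hφ : MDifferentiableAt (𝓡 n) (𝓡 n) φ (ψ x)) :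
    ratio (pullback (φ ∘ ψ) μ) μ x =
      ratio (pullback φ μ) μ (ψ x) * ratio (pullback ψ μ) μ x := by
  refine ratio_eq_of_smul (hμ x) ?_
  rw [pullback_comp hψ hφ]
  ext v
  change pullback φ μ (ψ x) _ = _
  rw [ratio_mul (hμ (ψ x)) (pullback φ μ)]
  change _ * pullback ψ μ x v = (_ * _) * _
  rw [ratio_mul (hμ x) (pullback ψ μ), mul_assoc]
  rfl

lemma formCoeff_wedgeForm {f : Fin (n + 1) → M → ℝ} {ψ : EuclideanSpace ℝ (Fin n) → M}
    {z : EuclideanSpace ℝ (Fin n)} (hψ : MDifferentiableAt (𝓡 n) (𝓡 n) ψ z)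
    (hf : ∀ i, MDifferentiableAt (𝓡 n) 𝓘(ℝ, ℝ) (f i) (ψ z)) :
    formCoeff ψ (wedgeForm f) z = f 0 (ψ z) * Matrix.det (Matrix.of fun i j : Fin n =>
      fderiv ℝ (f i.succ ∘ ψ) z (EuclideanSpace.single j 1)) := by
  unfold formCoeff wedgeForm
  refine congrArg (f 0 (ψ z) * ·) ((wedge_apply _ _).trans ?_)
  congr 2
  ext i j
  rw [← mfderiv_eq_fderiv, mfderiv_comp z (hf i.succ) hψ]
  rfl

variable [IsManifold (𝓡 n) ∞ M]

lemma mdifferentiableAt_extChartAt_symm {c : M} {y : EuclideanSpace ℝ (Fin n)}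
    (hy : y ∈ (extChartAt (𝓡 n) c).target) :
    MDifferentiableAt (𝓡 n) (𝓡 n) (extChartAt (𝓡 n) c).symm y :=
  ((contMDiffOn_extChartAt_symm (n := ∞) c).contMDiffAt
    ((isOpen_extChartAt_target c).mem_nhds hy)).mdifferentiableAt (by simp)

lemma mdifferentiableAt_extChartAt' {c x : M} (hx : x ∈ (extChartAt (𝓡 n) c).source) :
    MDifferentiableAt (𝓡 n) (𝓡 n) (extChartAt (𝓡 n) c) x :=
  (contMDiffAt_extChartAt' (n := ∞) (by simpa using hx)).mdifferentiableAt (by simp)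

/-- The coefficient of a form in a chart is the coefficient at the point, up to a nonzero factor. -/
lemma exists_chartCoeff_eq_mul {c : M} {y : EuclideanSpace ℝ (Fin n)}
    (hy : y ∈ (extChartAt (𝓡 n) c).target) :
    ∃ d : ℝ, d ≠ 0 ∧ ∀ η : FormField n M, chartCoeff c η y =
      d * η ((extChartAt (𝓡 n) c).symm y) (stdBasis _) := by
  have hinv : (mfderiv (𝓡 n) (𝓡 n) (extChartAt (𝓡 n) c).symm y).IsInvertible := by
    simpa [mfderivWithin_univ] using isInvertible_mfderivWithin_extChartAt_symm hy
  have key : ∀ B : EuclideanSpace ℝ (Fin n) →L[ℝ] EuclideanSpace ℝ (Fin n), B.IsInvertible →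
      B.det ≠ 0 := by
    rintro _ ⟨A, rfl⟩
    exact (LinearEquiv.isUnit_det' A.toLinearEquiv).ne_zero
  exact ⟨_, key _ hinv, fun η => alternating_map (n := n) (η ((extChartAt (𝓡 n) c).symm y))
    (mfderiv (𝓡 n) (𝓡 n) (extChartAt (𝓡 n) c).symm y)⟩

lemma chartCoeff_ne_zero {μ : FormField n M} (h : ∀ x, μ x ≠ 0) {c : M}
    {y : EuclideanSpace ℝ (Fin n)} (hy : y ∈ (extChartAt (𝓡 n) c).target) :
    chartCoeff c μ y ≠ 0 := by
  obtain ⟨d, hd, h1⟩ := exists_chartCoeff_eq_mul hy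
  rw [h1]
  exact mul_ne_zero hd (form_stdBasis_ne_zero (h _))

/-- Forms with the same coefficients in the charts are equal. -/
lemma form_ext {η ζ : FormField n M} (h : ∀ c : M, ∀ y ∈ (extChartAt (𝓡 n) c).target,
    chartCoeff c η y = chartCoeff c ζ y) : η = ζ := by
  funext x
  obtain ⟨d, hd, h1⟩ := exists_chartCoeff_eq_mul (mem_extChartAt_target (I := 𝓡 n) x)
  have hx := h x _ (mem_extChartAt_target x)
  rw [h1, h1] at hx
  have hx2 := mul_left_cancel₀ hd hx
  rw [extChartAt_to_inv] at hx2
  ext v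
  have h2 : ∀ η : FormField n M, η x v = _ := fun η => alternating_eq_det (n := n) (η x) v
  rw [h2, h2]
  exact congrArg (· * _) hx2

lemma ratio_eq_chartCoeff {μ : FormField n M} (h : ∀ x, μ x ≠ 0) {c : M}
    (η : FormField n M) {y : EuclideanSpace ℝ (Fin n)} (hy : y ∈ (extChartAt (𝓡 n) c).target) :
    ratio η μ ((extChartAt (𝓡 n) c).symm y) = chartCoeff c η y / chartCoeff c μ y := by
  rw [eq_div_iff (chartCoeff_ne_zero h hy)]
  exact (formCoeff_eq_ratio h _ η y).symm

/-- Near `z` the map `ψ` is the inverse chart composed with the coordinate expression of `ψ`, so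
`formCoeff_comp` applies. This is the transition formula behind every change of variables below. -/
lemma formCoeff_eq_det_mul {ψ : EuclideanSpace ℝ (Fin n) → M} {z : EuclideanSpace ℝ (Fin n)}
    (hψ : MDifferentiableAt (𝓡 n) (𝓡 n) ψ z) {c : M} (hc : ψ z ∈ (extChartAt (𝓡 n) c).source)
    (η : FormField n M) :
    formCoeff ψ η z = (fderiv ℝ (extChartAt (𝓡 n) c ∘ ψ) z).det *
      chartCoeff c η (extChartAt (𝓡 n) c (ψ z)) := by
  have hT : DifferentiableAt ℝ (extChartAt (𝓡 n) c ∘ ψ) z :=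
    ((mdifferentiableAt_extChartAt' hc).comp z hψ).differentiableAt
  have h := formCoeff_comp (ψ := (extChartAt (𝓡 n) c).symm) (T := extChartAt (𝓡 n) c ∘ ψ)
    (z := z) (mdifferentiableAt_extChartAt_symm ((extChartAt (𝓡 n) c).map_source hc)) hT η
  rw [chartCoeff_eq_formCoeff, ← Function.comp_apply (f := extChartAt (𝓡 n) c) (g := ψ), ← h]
  refine formCoeff_congr ?_ η
  filter_upwards [hψ.continuousAt.preimage_mem_nhds
    ((isOpen_extChartAt_source c).mem_nhds hc)] with w hw
  exact ((extChartAt (𝓡 n) c).left_inv hw).symm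

/-! ### Smooth functions -/

lemma contMDiff_iff_charts {f : M → ℝ} :
    ContMDiff (𝓡 n) 𝓘(ℝ, ℝ) ∞ f ↔
      ∀ c : M, ContDiffOn ℝ ∞ (f ∘ (extChartAt (𝓡 n) c).symm) (extChartAt (𝓡 n) c).target := by
  constructor
  · intro hf c
    exact (hf.comp_contMDiffOn (contMDiffOn_extChartAt_symm c)).contDiffOn
  · intro hf x
    have h1 : ContMDiffAt (𝓡 n) 𝓘(ℝ, ℝ) ∞ (f ∘ (extChartAt (𝓡 n) x).symm)
        (extChartAt (𝓡 n) x x) :=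
      ((hf x).contDiffAt ((isOpen_extChartAt_target x).mem_nhds
        (mem_extChartAt_target x))).contMDiffAt
    have h2 := h1.comp x (contMDiffAt_extChartAt (n := ∞))
    refine h2.congr_of_eventuallyEq ?_
    filter_upwards [extChartAt_source_mem_nhds (I := 𝓡 n) x] with y hy
    rw [Function.comp_apply, Function.comp_apply, (extChartAt (𝓡 n) x).left_inv hy]

lemma smul_mem_smoothForms {f : M → ℝ} (hf : ContMDiff (𝓡 n) 𝓘(ℝ, ℝ) ∞ f) {η : FormField n M}
    (hη : η ∈ smoothForms n M) : (fun x => f x • η x) ∈ smoothForms n M := fun c =>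
  (contMDiff_iff_charts.1 hf c).mul (hη c)

lemma contMDiff_ratio {μ : FormField n M} (h : ∀ x, μ x ≠ 0) (hμ : μ ∈ smoothForms n M)
    {η : FormField n M} (hη : η ∈ smoothForms n M) :
    ContMDiff (𝓡 n) 𝓘(ℝ, ℝ) ∞ (ratio η μ) :=
  contMDiff_iff_charts.2 fun c => ((hη c).div (hμ c) fun _ hy => chartCoeff_ne_zero h hy).congr
    fun _ hy => ratio_eq_chartCoeff h η hy

lemma chartCoeff_wedgeForm {f : Fin (n + 1) → M → ℝ}
    (hf : ∀ i, ContMDiff (𝓡 n) 𝓘(ℝ, ℝ) ∞ (f i)) {c : M} {y : EuclideanSpace ℝ (Fin n)}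
    (hy : y ∈ (extChartAt (𝓡 n) c).target) :
    chartCoeff c (wedgeForm f) y = f 0 ((extChartAt (𝓡 n) c).symm y) *
      Matrix.det (Matrix.of fun i j : Fin n =>
        fderiv ℝ (f i.succ ∘ (extChartAt (𝓡 n) c).symm) y (EuclideanSpace.single j 1)) :=
  formCoeff_wedgeForm (mdifferentiableAt_extChartAt_symm hy)
    fun i => (hf i).mdifferentiableAt (by simp)

lemma contDiffOn_matrix_det {F : Type*} [NormedAddCommGroup F] [NormedSpace ℝ F] {k : ℕ}
    {A : F → Matrix (Fin k) (Fin k) ℝ} {s : Set F} (h : ∀ i j, ContDiffOn ℝ ∞ (fun x => A x i j) s) :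
    ContDiffOn ℝ ∞ (fun x => (A x).det) s := by
  simp only [Matrix.det_apply']
  exact ContDiffOn.sum fun σ _ => contDiffOn_const.mul (contDiffOn_prod fun i _ => h _ _)

lemma wedgeForm_mem_smoothForms {f : Fin (n + 1) → M → ℝ}
    (hf : ∀ i, ContMDiff (𝓡 n) 𝓘(ℝ, ℝ) ∞ (f i)) : wedgeForm f ∈ smoothForms n M := by
  intro c
  refine ContDiffOn.congr ?_ fun y hy => chartCoeff_wedgeForm hf hy
  refine (contMDiff_iff_charts.1 (hf 0) c).mul (contDiffOn_matrix_det fun i j => ?_)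
  exact ((contMDiff_iff_charts.1 (hf i.succ) c).fderiv_of_isOpen
    (isOpen_extChartAt_target c) (by simp)).clm_apply contDiffOn_const

end Coordinates

/-! ### The integral in an arbitrary parametrization -/

section ChangeOfVariables

/-- A change of coordinates multiplies both the coefficient `a` of the orienting form and the
coefficient `b` of the integrand by the same determinant `d`. The two signs of `d` combine into the
absolute value required by the change of variables formula. -/
lemma abs_mul_sign_mul (d a b : ℝ) : |d| * (Real.sign a * b) = Real.sign (d * a) * (d * b) := by
  rcases lt_trichotomy d 0 with hd | rfl | hd
  · rcases lt_trichotomy a 0 with ha | rfl | ha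
    · rw [abs_of_neg hd, Real.sign_of_neg ha, Real.sign_of_pos (mul_pos_of_neg_of_neg hd ha)]; ring
    · simp
    · rw [abs_of_neg hd, Real.sign_of_pos ha, Real.sign_of_neg (mul_neg_of_neg_of_pos hd ha)]; ring
  · simp
  · rcases lt_trichotomy a 0 with ha | rfl | ha
    · rw [abs_of_pos hd, Real.sign_of_neg ha, Real.sign_of_neg (mul_neg_of_pos_of_neg hd ha)]; ring
    · simp
    · rw [abs_of_pos hd, Real.sign_of_pos ha, Real.sign_of_pos (mul_pos hd ha)]; ring

variable {n : ℕ} {M : Type*} [TopologicalSpace M] [ChartedSpace (EuclideanSpace ℝ (Fin n)) M]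
  [IsManifold (𝓡 n) ∞ M] [T2Space M] [CompactSpace M]

lemma partition_eq_zero {c x : M} (hx : x ∉ (extChartAt (𝓡 n) c).source) :
    partition n M c x = 0 := by
  by_contra h
  exact hx (by rw [extChartAt_source]; exact partition_subordinate c (subset_tsupport _ h))

/-- The integral of an `n`-form computed in a parametrization `ψ` of `M` that covers, up to a
null set, the points where the form does not vanish. -/
lemma VolumeForm.integral_eq_setIntegral (ν : VolumeForm n M) {η : FormField n M}
    (hη : η ∈ smoothForms n M) {ψ : EuclideanSpace ℝ (Fin n) → M}
    {V : Set (EuclideanSpace ℝ (Fin n))} (hV : IsOpen V)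
    (hψ : ∀ z ∈ V, MDifferentiableAt (𝓡 n) (𝓡 n) ψ z) (hinj : InjOn ψ V)
    (hout : ∀ c : M, ∀ᵐ y, y ∈ (extChartAt (𝓡 n) c).target →
      (extChartAt (𝓡 n) c).symm y ∉ ψ '' V → chartCoeff c η y = 0) :
    ν.integral η = ∫ z in V, Real.sign (formCoeff ψ ν.toForm z) * formCoeff ψ η z := by
  set F : M → EuclideanSpace ℝ (Fin n) → ℝ := fun c z =>
    partition n M c (ψ z) * (Real.sign (formCoeff ψ ν.toForm z) * formCoeff ψ η z) with hF
  have hψc : ContinuousOn ψ V := fun z hz => (hψ z hz).continuousAt.continuousWithinAt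
  have main : ∀ c : M, IntegrableOn (F c) V ∧
      ∫ y in (extChartAt (𝓡 n) c).target, chartIntegrand ν c η y = ∫ z in V, F c z := by
    intro c
    set W : Set (EuclideanSpace ℝ (Fin n)) := V ∩ ψ ⁻¹' (extChartAt (𝓡 n) c).source with hW
    have hWo : IsOpen W := hψc.isOpen_inter_preimage hV (isOpen_extChartAt_source c)
    set T := extChartAt (𝓡 n) c ∘ ψ with hT
    have hTd : ∀ z ∈ W, HasFDerivWithinAt T (fderiv ℝ T z) W z := fun z hz =>
      ((mdifferentiableAt_extChartAt' hz.2).comp z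
        (hψ z hz.1)).differentiableAt.hasFDerivAt.hasFDerivWithinAt
    have hTi : InjOn T W := fun z hz w hw h =>
      hinj hz.1 hw.1 ((extChartAt (𝓡 n) c).injOn hz.2 hw.2 h)
    have hTsub : T '' W ⊆ (extChartAt (𝓡 n) c).target := by
      rintro _ ⟨z, hz, rfl⟩
      exact (extChartAt (𝓡 n) c).map_source hz.2
    have hTm : MeasurableSet (T '' W) :=
      measurable_image_of_fderivWithin hWo.measurableSet hTd hTi
    have hmem : ∀ y ∈ (extChartAt (𝓡 n) c).target, (extChartAt (𝓡 n) c).symm y ∈ ψ '' V →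
        y ∈ T '' W := by
      rintro y hy ⟨z, hz, hzy⟩
      refine ⟨z, ⟨hz, ?_⟩, ?_⟩
      · rw [mem_preimage, hzy]; exact (extChartAt (𝓡 n) c).map_target hy
      · rw [hT, Function.comp_apply, hzy, (extChartAt (𝓡 n) c).right_inv hy]
    -- The part of the chart not covered by `ψ` contributes nothing: there the coefficient of `η`
    -- vanishes almost everywhere by `hout`.
    have h1 : ∫ y in (extChartAt (𝓡 n) c).target, chartIntegrand ν c η y =
        ∫ y in T '' W, chartIntegrand ν c η y := by
      refine setIntegral_eq_of_subset_of_ae_sdiff_eq_zero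
        (isOpen_extChartAt_target c).measurableSet.nullMeasurableSet hTsub ?_
      filter_upwards [hout c] with y hy hyd
      rw [chartIntegrand, hy hyd.1 fun h => hyd.2 (hmem y hyd.1 h)]
      simp
    have hpt : ∀ z ∈ W, |(fderiv ℝ T z).det| • chartIntegrand ν c η (T z) = F c z := by
      intro z hz
      have e1 := formCoeff_eq_det_mul (hψ z hz.1) hz.2 η
      have e2 := formCoeff_eq_det_mul (hψ z hz.1) hz.2 ν.toForm
      have e3 : (extChartAt (𝓡 n) c).symm (T z) = ψ z := (extChartAt (𝓡 n) c).left_inv hz.2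
      rw [hF]
      simp only
      rw [e1, e2, chartIntegrand, e3, smul_eq_mul, ← abs_mul_sign_mul]
      simp only [hT, Function.comp_apply]
      ring
    have hVW : ∀ z ∈ V \ W, F c z = 0 := by
      rintro z ⟨hz, hzW⟩
      rw [hF]
      simp only
      rw [partition_eq_zero fun h => hzW ⟨hz, h⟩, zero_mul]
    have h2 : IntegrableOn (F c) W :=
      ((integrableOn_image_iff_integrableOn_abs_det_fderiv_smul volume hWo.measurableSet hTd hTi
        (chartIntegrand ν c η)).1 ((integrableOn_chartIntegrand ν c hη).mono_set hTsub)).congr_fun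
        hpt hWo.measurableSet
    refine ⟨h2.of_forall_sdiff_eq_zero hV.measurableSet hVW, ?_⟩
    rw [h1, integral_image_eq_integral_abs_det_fderiv_smul volume hWo.measurableSet hTd hTi,
      setIntegral_congr_fun hWo.measurableSet hpt]
    exact (setIntegral_eq_of_subset_of_forall_sdiff_eq_zero hV.measurableSet inter_subset_left
      hVW).symm
  have hfin := (partition n M).locallyFinite.finite_nonempty_of_compact
  have hsum : ∀ x : M, ∑ c ∈ hfin.toFinset, partition n M c x = 1 := by
    intro x
    rw [← (partition n M).sum_eq_one (mem_univ x)]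
    refine (finsum_eq_sum_of_support_subset _ fun c hc => ?_).symm
    simp only [Finite.coe_toFinset, mem_ofPred_eq]
    exact ⟨x, hc⟩
  -- All charts have now been moved to the same domain `V`, where the members of the partition of
  -- unity add up to one.
  unfold VolumeForm.integral
  rw [finsum_congr fun c => (main c).2, finsum_eq_sum_of_support_subset (s := hfin.toFinset),
    ← integral_finsetSum _ fun c _ => (main c).1]
  · refine integral_congr_ae (Eventually.of_forall fun z => ?_)
    simp only [hF]
    rw [← Finset.sum_mul, hsum, one_mul]
  · intro c hc
    simp only [Finite.coe_toFinset, mem_ofPred_eq]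
    by_contra hne
    rw [Set.not_nonempty_iff_eq_empty, Function.support_eq_empty_iff] at hne
    exact hc (by simp [hF, hne])

/-- The integral of an `n`-form that vanishes outside the domain of a chart. -/
lemma VolumeForm.integral_eq_of_chart (ν : VolumeForm n M) {η : FormField n M}
    (hη : η ∈ smoothForms n M) (c : M)
    (hout : ∀ x ∉ (extChartAt (𝓡 n) c).source, η x = 0) :
    ν.integral η = ∫ y in (extChartAt (𝓡 n) c).target,
      Real.sign (chartCoeff c ν.toForm y) * chartCoeff c η y := by
  refine ν.integral_eq_setIntegral hη (isOpen_extChartAt_target c)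
    (fun z hz => mdifferentiableAt_extChartAt_symm hz) (extChartAt (𝓡 n) c).symm.injOn
    fun c' => Eventually.of_forall fun y _ hy => ?_
  have : (extChartAt (𝓡 n) c').symm y ∉ (extChartAt (𝓡 n) c).source := by
    rwa [← (extChartAt (𝓡 n) c).symm_image_target_eq_source]
  rw [chartCoeff, hout _ this]
  rfl

end ChangeOfVariables

/-! ### Iterated directional derivatives of products -/

section Directional

variable {V : Type*} [NormedAddCommGroup V] [NormedSpace ℝ V]

lemma contDiff_fderiv_apply {f : V → ℝ} (hf : ContDiff ℝ ∞ f) (v : V) :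
    ContDiff ℝ ∞ fun x => fderiv ℝ f x v :=
  (hf.fderiv_right (by simp)).clm_apply contDiff_const

lemma fderiv_fderiv_comm {f : V → ℝ} {x : V} (hf : ContDiffAt ℝ ∞ f x) (v w : V) :
    fderiv ℝ (fun y => fderiv ℝ f y v) x w = fderiv ℝ (fun y => fderiv ℝ f y w) x v := by
  have hd : DifferentiableAt ℝ (fderiv ℝ f) x :=
    (hf.fderiv_right (m := 1) (by norm_num; exact ENat.LEInfty.out)).differentiableAt (by simp)
  rw [fderiv_clm_apply hd (by fun_prop), fderiv_clm_apply hd (by fun_prop)]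
  have hs : IsSymmSndFDerivAt ℝ f x := hf.isSymmSndFDerivAt (by simpa using ENat.LEInfty.out)
  simpa using hs w v

lemma hasCompactSupport_fderiv_apply {f : V → ℝ} (hf : HasCompactSupport f) (v : V) :
    HasCompactSupport fun x => fderiv ℝ f x v :=
  hf.fderiv_apply ℝ v

/-- The last direction is differentiated first. This order is what the triangular dependence of the
factors needs, since only the last factor involves the last variable. -/
lemma iteratedFDeriv_succ_apply_fderiv {f : V → ℝ} (hf : ContDiff ℝ ∞ f) (k : ℕ) (x : V)
    (v : Fin (k + 1) → V) :
    iteratedFDeriv ℝ (k + 1) f x v =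
      iteratedFDeriv ℝ k (fun y => fderiv ℝ f y (v (Fin.last k))) x (Fin.init v) := by
  rw [iteratedFDeriv_succ_apply_right]
  exact (iteratedFDeriv_clm_apply_const_apply (n := ∞) (hf.fderiv_right (by simp))
    ENat.LEInfty.out).symm

/-- A mixed derivative at a common zero of functions, the `i`-th of which does not depend on the
variables of index greater than `i`. -/
lemma iteratedFDeriv_prod_mul {k : ℕ} {p : Fin k → V → ℝ} (hp : ∀ i, ContDiff ℝ ∞ (p i))
    {v : Fin k → V} (h0 : ∀ i, p i 0 = 0) (hdep : ∀ i j, i < j → ∀ x, fderiv ℝ (p i) x (v j) = 0)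
    {g : V → ℝ} (hg : ContDiff ℝ ∞ g) :
    iteratedFDeriv ℝ k (fun x => (∏ i, p i x) * g x) 0 v =
      (∏ i, fderiv ℝ (p i) 0 (v i)) * g 0 := by
  induction k generalizing g with
  | zero => simp
  | succ k ih =>
    have hq : ∀ x, HasFDerivAt (fun x => ∏ i : Fin k, p i.castSucc x)
        (∑ i : Fin k, (∏ j ∈ Finset.univ.erase i, p j.castSucc x) •
          fderiv ℝ (p i.castSucc) x) x := fun x =>
      HasFDerivAt.finsetProd (u := Finset.univ) fun i _ =>
        ((hp i.castSucc).differentiable (by simp)).differentiableAt.hasFDerivAt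
    have hl : ∀ x, HasFDerivAt (p (Fin.last k)) (fderiv ℝ (p (Fin.last k)) x) x := fun x =>
      ((hp (Fin.last k)).differentiable (by simp)).differentiableAt.hasFDerivAt
    have hgd : ∀ x, HasFDerivAt g (fderiv ℝ g x) x := fun x =>
      (hg.differentiable (by simp)).differentiableAt.hasFDerivAt
    -- The earlier factors are constant in the last direction, so they remain as they are and the
    -- induction continues with a new `g`. Its second summand carries the factor `p (Fin.last k)`
    -- and dies at the origin.
    have key : (fun x => fderiv ℝ (fun x => (∏ i, p i x) * g x) x (v (Fin.last k))) = fun x =>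
        (∏ i : Fin k, p i.castSucc x) * (fderiv ℝ (p (Fin.last k)) x (v (Fin.last k)) * g x +
          p (Fin.last k) x * fderiv ℝ g x (v (Fin.last k))) := by
      funext x
      have e : (fun x => (∏ i, p i x) * g x) =
          fun x => ((∏ i : Fin k, p i.castSucc x) * p (Fin.last k) x) * g x := by
        funext x; rw [Fin.prod_univ_castSucc]
      rw [e, (((hq x).fun_mul (hl x)).fun_mul (hgd x)).fderiv]
      have hz : ∑ i : Fin k, (∏ j ∈ Finset.univ.erase i, p j.castSucc x) *
          fderiv ℝ (p i.castSucc) x (v (Fin.last k)) = 0 :=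
        Finset.sum_eq_zero fun i _ => by rw [hdep _ _ (Fin.castSucc_lt_last i) x, mul_zero]
      simp [hz]
      ring
    rw [iteratedFDeriv_succ_apply_fderiv, key, ih (fun i => hp i.castSucc)]
    · rw [Fin.prod_univ_castSucc, h0]
      simp only [Fin.init]
      ring
    · exact fun i => h0 _
    · exact fun i j hij x => hdep _ _ (by simpa using hij) x
    · exact ((contDiff_fderiv_apply (hp _) _).mul hg).add ((hp _).mul (contDiff_fderiv_apply hg _))
    · exact (contDiff_prod fun i _ => hp i).mul hg

end Directional

/-! ### Stokes' theorem in Euclidean space -/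

section Stokes

variable {n : ℕ}

/-- Integration by parts against the constant function one. -/
lemma integral_fderiv_apply_eq_zero {f : EuclideanSpace ℝ (Fin n) → ℝ} (hf : ContDiff ℝ ∞ f)
    (hs : HasCompactSupport f) (v : EuclideanSpace ℝ (Fin n)) : ∫ x, fderiv ℝ f x v = 0 := by
  have h := integral_mul_fderiv_eq_neg_fderiv_mul_of_integrable (μ := volume)
    (f := fun _ : EuclideanSpace ℝ (Fin n) => (1 : ℝ)) (g := f) (v := v)
    (by simp)
    (by
      simp only [one_mul]
      exact (contDiff_fderiv_apply hf v).continuous.integrable_of_hasCompactSupport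
        (hasCompactSupport_fderiv_apply hs v))
    (by
      simp only [one_mul]
      exact hf.continuous.integrable_of_hasCompactSupport hs)
    (fun _ _ => by fun_prop) (fun _ _ => (hf.differentiable (by simp)).differentiableAt)
  simpa using h

/-- Stokes' theorem for `∫ dh₁ ∧ ⋯ ∧ dhₙ` in Euclidean space, one of the functions having compact
support. -/
lemma integral_det_fderiv_eq_zero {h : Fin n → EuclideanSpace ℝ (Fin n) → ℝ}
    (hh : ∀ i, ContDiff ℝ ∞ (h i)) (i₀ : Fin n) (hs : HasCompactSupport (h i₀)) :
    ∫ x, Matrix.det (Matrix.of fun i j => fderiv ℝ (h i) x (EuclideanSpace.single j 1)) = 0 := by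
  classical
  set d : Fin n → Fin n → EuclideanSpace ℝ (Fin n) → ℝ := fun i j x =>
    fderiv ℝ (h i) x (EuclideanSpace.single j 1) with hd
  have hdc : ∀ i j, ContDiff ℝ ∞ (d i j) := fun i j => contDiff_fderiv_apply (hh i) _
  have hds : ∀ j, HasCompactSupport (d i₀ j) := fun j => hasCompactSupport_fderiv_apply hs _
  have hdd : ∀ i j x, HasFDerivAt (d i j) (fderiv ℝ (d i j) x) x := fun i j x =>
    ((hdc i j).differentiable (by simp)).differentiableAt.hasFDerivAt
  set R : Equiv.Perm (Fin n) → EuclideanSpace ℝ (Fin n) → ℝ := fun σ x =>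
    ∏ i ∈ Finset.univ.erase i₀, d i (σ i) x with hR
  have hRc : ∀ σ, ContDiff ℝ ∞ (R σ) := fun σ => contDiff_prod fun i _ => hdc _ _
  set S : Equiv.Perm (Fin n) → Fin n → EuclideanSpace ℝ (Fin n) → ℝ := fun σ j x =>
    h i₀ x * ((∏ i ∈ (Finset.univ.erase i₀).erase j, d i (σ i) x) *
      fderiv ℝ (d j (σ j)) x (EuclideanSpace.single (σ i₀) 1)) with hS
  have hSi : ∀ σ j, Integrable (S σ j) := fun σ j =>
    ((hh i₀).mul ((contDiff_prod fun i _ => hdc _ _).mul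
      (contDiff_fderiv_apply (hdc _ _) _))).continuous.integrable_of_hasCompactSupport hs.mul_right
  -- For each permutation the derivative is moved away from `h i₀`, whose compact support removes
  -- the boundary term. It falls on one other factor `j` at a time and creates a second derivative
  -- of `h j`.
  have hparts : ∀ σ : Equiv.Perm (Fin n), ∫ x, ∏ i, d i (σ i) x =
      - ∑ j ∈ Finset.univ.erase i₀, ∫ x, S σ j x := by
    intro σ
    have e1 : ∀ x, ∏ i, d i (σ i) x =
        fderiv ℝ (h i₀) x (EuclideanSpace.single (σ i₀) 1) * R σ x := fun x =>
      (Finset.mul_prod_erase _ _ (Finset.mem_univ i₀)).symm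
    have e2 : ∀ x, h i₀ x * fderiv ℝ (R σ) x (EuclideanSpace.single (σ i₀) 1) =
        ∑ j ∈ Finset.univ.erase i₀, S σ j x := by
      intro x
      rw [(HasFDerivAt.finsetProd fun i _ => hdd i (σ i) x).fderiv]
      simp [hS, Finset.mul_sum, mul_sub]
    have hp := integral_mul_fderiv_eq_neg_fderiv_mul_of_integrable (μ := volume)
      (f := h i₀) (g := R σ) (v := EuclideanSpace.single (σ i₀) 1)
      (((hdc i₀ (σ i₀)).mul (hRc σ)).continuous.integrable_of_hasCompactSupport
        (hds _).mul_right)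
      (((hh i₀).mul (contDiff_fderiv_apply (hRc σ) _)).continuous.integrable_of_hasCompactSupport
        hs.mul_right)
      (((hh i₀).mul (hRc σ)).continuous.integrable_of_hasCompactSupport hs.mul_right)
      (fun _ _ => ((hh i₀).differentiable (by simp)).differentiableAt)
      (fun _ _ => ((hRc σ).differentiable (by simp)).differentiableAt)
    simp_rw [e1]
    rw [← neg_eq_iff_eq_neg, ← hp]
    simp_rw [e2]
    exact integral_finsetSum _ fun j _ => hSi σ j
  have hdet : ∀ x, Matrix.det (Matrix.of fun i j => d i j x) =
      ∑ σ : Equiv.Perm (Fin n), ((Equiv.Perm.sign σ : ℤ) : ℝ) * ∏ i, d i (σ i) x := by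
    intro x
    rw [← Matrix.det_transpose, Matrix.det_apply']
    rfl
  change ∫ x, Matrix.det (Matrix.of fun i j => d i j x) = 0
  simp_rw [hdet]
  rw [integral_finsetSum _ fun σ _ => ?_]
  swap
  · refine Integrable.const_mul ?_ _
    refine (contDiff_prod fun i _ => hdc i (σ i)).continuous.integrable_of_hasCompactSupport ?_
    have : (fun x => ∏ i, d i (σ i) x) = fun x => d i₀ (σ i₀) x * R σ x :=
      funext fun x => (Finset.mul_prod_erase _ _ (Finset.mem_univ i₀)).symm
    rw [this]
    exact (hds _).mul_right
  simp_rw [integral_const_mul, hparts, mul_neg, Finset.sum_neg_distrib, Finset.mul_sum]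
  rw [Finset.sum_comm, neg_eq_zero]
  refine Finset.sum_eq_zero fun j hj => ?_
  have hj' : j ≠ i₀ := Finset.ne_of_mem_erase hj
  -- Composing `σ` with the transposition of `i₀` and `j` exchanges the two directions of that
  -- second derivative and leaves the term unchanged, while the sign of the permutation flips. The
  -- signed sum therefore equals its own opposite.
  have hsw : ∀ σ : Equiv.Perm (Fin n), S (σ * Equiv.swap i₀ j) j = S σ j := by
    intro σ
    funext x
    simp only [hS, Equiv.Perm.mul_apply, Equiv.swap_apply_left, Equiv.swap_apply_right]
    rw [show fderiv ℝ (d j (σ i₀)) x (EuclideanSpace.single (σ j) 1) =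
      fderiv ℝ (d j (σ j)) x (EuclideanSpace.single (σ i₀) 1) from
      fderiv_fderiv_comm (hh j).contDiffAt _ _]
    congr 2
    refine Finset.prod_congr rfl fun i hi => ?_
    rw [Equiv.swap_apply_of_ne_of_ne]
    · exact Finset.ne_of_mem_erase (Finset.mem_of_mem_erase hi)
    · exact Finset.ne_of_mem_erase hi
  have hre := Equiv.sum_comp (Equiv.mulRight (Equiv.swap i₀ j))
    (fun σ : Equiv.Perm (Fin n) => ((Equiv.Perm.sign σ : ℤ) : ℝ) * ∫ x, S σ j x)
  simp only [Equiv.coe_mulRight, hsw, Equiv.Perm.sign_mul, Equiv.Perm.sign_swap hj'.symm] at hre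
  simp only [mul_neg, mul_one, Units.val_neg, Int.cast_neg, neg_mul, Finset.sum_neg_distrib] at hre
  linarith

end Stokes

/-! ### Differentiation under the integral sign -/

section Parametric

variable {P : Type*} [NormedAddCommGroup P] [NormedSpace ℝ P]
  {G : Type*} [NormedAddCommGroup G] [NormedSpace ℝ G]
  [MeasurableSpace G] [BorelSpace G] {m : Measure G}

omit [NormedSpace ℝ G] [BorelSpace G] in
-- A parametric integral is the value at zero of a convolution with a reflected family, so the
-- smoothness theorems for convolutions with parameters apply to it.
lemma convolution_lsmul_zero (w : G → ℝ) (F : G → ℝ) :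
    (convolution w (fun u => F (-u)) (ContinuousLinearMap.lsmul ℝ ℝ) m) 0 =
      ∫ t, w t * F t ∂m := by
  simp [convolution]

/-- The weight `w` need only be locally integrable. This allows the constant one and the indicator
of a half line alike. -/
lemma contDiffOn_integral_param {w : G → ℝ} (hw : LocallyIntegrable w m) {s : Set P}
    (hs : IsOpen s) {K : Set G} (hK : IsCompact K) {F : P → G → ℝ}
    (h0 : ∀ p ∈ s, ∀ x ∉ K, F p x = 0)
    (hF : ContDiffOn ℝ ∞ (fun q : P × G => F q.1 q.2) (s ×ˢ univ)) :
    ContDiffOn ℝ ∞ (fun p => ∫ x, w x * F p x ∂m) s := by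
  have h := contDiffOn_convolution_right_with_param_comp (μ := m) (n := ⊤)
    (ContinuousLinearMap.lsmul ℝ ℝ : ℝ →L[ℝ] ℝ →L[ℝ] ℝ) (s := s) (v := fun _ : P => (0 : G))
    contDiffOn_const (f := w) (g := fun p u => F p (-u)) (k := -K) hs hK.neg
    (fun p x hp hx => h0 p hp _ (by simpa using hx)) hw
    (hF.comp (t := s ×ˢ univ) (f := fun q : P × G => (q.1, -q.2)) (by fun_prop)
      fun q hq => by simpa using hq)
  exact h.congr fun p _ => (convolution_lsmul_zero w (F p)).symm

lemma fderiv_integral_param {w : G → ℝ} (hw : LocallyIntegrable w m)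
    {K : Set G} (hK : IsCompact K) {F : P → G → ℝ} (h0 : ∀ p, ∀ x ∉ K, F p x = 0)
    (hF : ContDiff ℝ ∞ (fun q : P × G => F q.1 q.2)) (p v : P) :
    fderiv ℝ (fun p => ∫ x, w x * F p x ∂m) p v =
      ∫ x, w x * fderiv ℝ (fun p => F p x) p v ∂m := by
  set g : P → G → ℝ := fun p u => F p (-u) with hg
  have hgc : ContDiff ℝ ∞ (Function.uncurry g) :=
    hF.comp (f := fun q : P × G => (q.1, -q.2)) (by fun_prop)
  have hg0 : ∀ p x, x ∉ -K → g p x = 0 := fun p x hx => h0 p _ (by simpa using hx)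
  have h := hasFDerivAt_convolution_right_with_param (μ := m)
    (ContinuousLinearMap.lsmul ℝ ℝ : ℝ →L[ℝ] ℝ →L[ℝ] ℝ) (s := univ) (f := w) (g := g) (k := -K)
    isOpen_univ hK.neg (fun p x _ hx => hg0 p x hx) hw
    (hgc.of_le (by simp)).contDiffOn (p, 0) (mem_univ _)
  have h2 := h.comp p (f := fun p : P => (p, (0 : G)))
    ((hasFDerivAt_id p).prodMk (hasFDerivAt_const (0 : G) p))
  have e : ((fun q : P × G => (convolution w (g q.1) (ContinuousLinearMap.lsmul ℝ ℝ) m) q.2) ∘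
      fun p : P => (p, (0 : G))) = fun p => ∫ x, w x * F p x ∂m := by
    funext p
    exact convolution_lsmul_zero w (F p)
  rw [e] at h2
  rw [h2.fderiv]
  simp only [ContinuousLinearMap.comp_apply, ContinuousLinearMap.prod_apply,
    ContinuousLinearMap.id_apply, zero_apply]
  -- Off the fixed compact set the family vanishes on a whole neighbourhood of `(p, x)`, so its
  -- derivative has compact support in `x` and the convolution may be evaluated on a vector.
  have hfd : ∀ x, x ∉ -K → fderiv ℝ (Function.uncurry g) (p, x) = 0 := by
    intro x hx
    refine (hasFDerivAt_zero_of_eventually_const 0 ?_).fderiv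
    have : Prod.snd ⁻¹' (-K)ᶜ ∈ 𝓝 (p, x) :=
      continuous_snd.continuousAt.preimage_mem_nhds (hK.neg.isClosed.isOpen_compl.mem_nhds hx)
    filter_upwards [this] with q hq
    exact hg0 _ _ hq
  have e2 : (convolution w (fun x => fderiv ℝ (Function.uncurry g) (p, x))
      ((ContinuousLinearMap.lsmul ℝ ℝ : ℝ →L[ℝ] ℝ →L[ℝ] ℝ).precompR (P × G)) m) 0 (v, 0) = _ :=
    convolution_precompR_apply _ hw (HasCompactSupport.intro hK.neg hfd)
      ((hgc.continuous_fderiv (by simp)).comp (by fun_prop)) 0 (v, 0)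
  refine e2.trans ?_
  refine integral_congr_ae (Eventually.of_forall fun x => ?_)
  simp only [zero_sub, ContinuousLinearMap.lsmul_apply, smul_eq_mul]
  congr 1
  have h3 : HasFDerivAt (fun p => F p x) _ p :=
    ((hgc.differentiable (by simp)) (p, -x)).hasFDerivAt.comp p
      (f := fun p : P => (p, -x)) ((hasFDerivAt_id p).prodMk (hasFDerivAt_const (-x) p)) |>.congr_of_eventuallyEq
      (Eventually.of_forall fun p => by simp [hg])
  rw [h3.fderiv]
  rfl

/-- A mixed derivative of a parametric integral. -/
lemma iteratedFDeriv_integral_param {w : G → ℝ} (hw : LocallyIntegrable w m)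
    {K : Set G} (hK : IsCompact K) (k : ℕ) {F : P → G → ℝ} (h0 : ∀ p, ∀ x ∉ K, F p x = 0)
    (hF : ContDiff ℝ ∞ (fun q : P × G => F q.1 q.2)) (p : P) (v : Fin k → P) :
    iteratedFDeriv ℝ k (fun p => ∫ x, w x * F p x ∂m) p v =
      ∫ x, w x * iteratedFDeriv ℝ k (fun p => F p x) p v ∂m := by
  induction k generalizing F with
  | zero => simp
  | succ k ih =>
    have hFx : ∀ x, ContDiff ℝ ∞ fun p => F p x := fun x =>
      hF.comp (f := fun p : P => (p, x)) (by fun_prop)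
    have hI : ContDiff ℝ ∞ (fun p => ∫ x, w x * F p x ∂m) := contDiffOn_univ.1 <|
      contDiffOn_integral_param hw isOpen_univ hK (fun p _ => h0 p) hF.contDiffOn
    rw [iteratedFDeriv_succ_apply_fderiv hI]
    simp_rw [iteratedFDeriv_succ_apply_fderiv (hFx _), fderiv_integral_param hw hK h0 hF]
    refine ih (F := fun p x => fderiv ℝ (fun p => F p x) p (v (Fin.last k))) ?_ ?_ _
    · intro p x hx
      have : (fun p => F p x) = fun _ => 0 := funext fun p => h0 p x hx
      simp [this]
    · have : (fun q : P × G => fderiv ℝ (fun p => F p q.2) q.1 (v (Fin.last k))) =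
          fun q => fderiv ℝ (fun q : P × G => F q.1 q.2) q (v (Fin.last k), 0) := by
        funext q
        have h3 := (hF.differentiable (by simp) q).hasFDerivAt.comp q.1
          (f := fun p : P => (p, q.2)) ((hasFDerivAt_id q.1).prodMk (hasFDerivAt_const q.2 q.1))
        have h4 : HasFDerivAt (fun p => F p q.2) _ q.1 := h3
        rw [h4.fderiv]
        rfl
      rw [this]
      exact contDiff_fderiv_apply hF _

end Parametric

/-! ### The Poincaré lemma for compactly supported top forms -/

section Box

variable {n : ℕ}

/-- The closed box with centre `a` and half side `r`. -/
def closedBox (a : EuclideanSpace ℝ (Fin n)) (r : ℝ) : Set (EuclideanSpace ℝ (Fin n)) :=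
  {x | ∀ j, |x j - a j| ≤ r}

lemma isCompact_closedBox (a : EuclideanSpace ℝ (Fin n)) (r : ℝ) : IsCompact (closedBox a r) := by
  have h : closedBox a r = (EuclideanSpace.equiv (Fin n) ℝ).toHomeomorph ⁻¹'
      (Set.pi univ fun j => Icc (a j - r) (a j + r)) := by
    ext x
    simp only [closedBox, mem_ofPred_eq, mem_preimage, Set.mem_pi, mem_univ, true_implies, mem_Icc,
      abs_le]
    refine forall_congr' fun j => ?_
    change _ ↔ a j - r ≤ x j ∧ x j ≤ a j + r
    constructor <;> rintro ⟨h1, h2⟩ <;> constructor <;> linarith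
  rw [h]
  exact (Homeomorph.isCompact_preimage _).2 (isCompact_univ_pi fun j => isCompact_Icc)

/-- The smooth functions on `ℝⁿ` supported in a closed box. -/
structure BoxSupported (a : EuclideanSpace ℝ (Fin n)) (r : ℝ)
    (g : EuclideanSpace ℝ (Fin n) → ℝ) : Prop where
  smooth : ContDiff ℝ ∞ g
  eq_zero : ∀ x j, r < |x j - a j| → g x = 0

namespace BoxSupported

variable {a : EuclideanSpace ℝ (Fin n)} {r : ℝ} {g h : EuclideanSpace ℝ (Fin n) → ℝ}

lemma eq_zero_of_notMem (hg : BoxSupported a r g) {x : EuclideanSpace ℝ (Fin n)}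
    (hx : x ∉ closedBox a r) : g x = 0 := by
  simp only [closedBox, mem_ofPred_eq, not_forall, not_le] at hx
  obtain ⟨j, hj⟩ := hx
  exact hg.eq_zero x j hj

lemma hasCompactSupport (hg : BoxSupported a r g) : HasCompactSupport g :=
  HasCompactSupport.intro (isCompact_closedBox a r) fun _ hx => hg.eq_zero_of_notMem hx

lemma add (hg : BoxSupported a r g) (hh : BoxSupported a r h) :
    BoxSupported a r fun x => g x + h x :=
  ⟨hg.smooth.add hh.smooth, fun x j hj => by rw [hg.eq_zero x j hj, hh.eq_zero x j hj, add_zero]⟩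

lemma sub (hg : BoxSupported a r g) (hh : BoxSupported a r h) :
    BoxSupported a r fun x => g x - h x :=
  ⟨hg.smooth.sub hh.smooth, fun x j hj => by rw [hg.eq_zero x j hj, hh.eq_zero x j hj, sub_zero]⟩

lemma zero : BoxSupported a r fun _ => 0 := ⟨contDiff_const, fun _ _ _ => rfl⟩

/-- Smoothness is local, and while `x i` stays bounded the relevant `s` lie in one fixed compact
interval. On such a set of `x` the integrand thus has a common compact support in `s`. -/
lemma contDiff_lineIntegral (hg : BoxSupported a r g) {w : ℝ → ℝ}
    (hw : LocallyIntegrable w volume) (i : Fin n) :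
    ContDiff ℝ ∞ fun x => ∫ s, w s * g (x - s • EuclideanSpace.single i 1) := by
  rw [contDiff_iff_contDiffAt]
  intro x₀
  have hs : IsOpen {x : EuclideanSpace ℝ (Fin n) | |x i| < |x₀ i| + 1} :=
    isOpen_lt (by fun_prop) continuous_const
  refine (contDiffOn_integral_param hw hs (isCompact_Icc (a := -(|x₀ i| + 1 + |a i| + r))
    (b := |x₀ i| + 1 + |a i| + r)) ?_ ?_).contDiffAt (hs.mem_nhds (by simp))
  · intro x hx s hs
    refine hg.eq_zero _ i ?_
    rw [mem_Icc, ← abs_le, not_le] at hs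
    simp only [PiLp.sub_apply, PiLp.smul_apply, PiLp.single_apply, if_true, smul_eq_mul, mul_one]
    have h1 : |s| ≤ |x i - s - a i| + |x i| + |a i| := by
      have := abs_sub_abs_le_abs_sub s (x i - a i)
      have h2 := abs_sub (x i) (a i)
      rw [show s - (x i - a i) = -(x i - s - a i) by ring, abs_neg] at this
      linarith
    have hx' : |x i| < |x₀ i| + 1 := hx
    linarith
  · exact (hg.smooth.comp (by fun_prop)).contDiffOn

lemma continuous_line (hg : BoxSupported a r g) (x : EuclideanSpace ℝ (Fin n)) (i : Fin n) :
    Continuous fun s : ℝ => g (x + s • EuclideanSpace.single i 1) :=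
  hg.smooth.continuous.comp (by fun_prop)

lemma integrable_line (hg : BoxSupported a r g) (x : EuclideanSpace ℝ (Fin n)) (i : Fin n) :
    Integrable fun s : ℝ => g (x + s • EuclideanSpace.single i 1) := by
  refine (hg.continuous_line x i).integrable_of_hasCompactSupport
    (HasCompactSupport.intro (isCompact_Icc (a := a i - r - x i) (b := a i + r - x i)) ?_)
  intro s hs
  refine hg.eq_zero _ i ?_
  simp only [PiLp.add_apply, PiLp.smul_apply, PiLp.single_apply, if_true, smul_eq_mul, mul_one]
  by_contra hle
  rw [not_lt, abs_le] at hle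
  exact hs ⟨by linarith, by linarith⟩

end BoxSupported

/-- The integral of `g` along the line through `x` in the direction of the `i`-th axis. -/
def lineAverage (i : Fin n) (g : EuclideanSpace ℝ (Fin n) → ℝ) (x : EuclideanSpace ℝ (Fin n)) : ℝ :=
  ∫ s : ℝ, g (x - s • EuclideanSpace.single i 1)

/-- The integral of `g` along the half line that ends at `x`, in the direction of the `i`-th
axis. -/
def halfLineIntegral (i : Fin n) (g : EuclideanSpace ℝ (Fin n) → ℝ)
    (x : EuclideanSpace ℝ (Fin n)) : ℝ :=
  ∫ s : ℝ, (Ici (0 : ℝ)).indicator 1 s * g (x - s • EuclideanSpace.single i 1)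

lemma lineAverage_add_smul (i : Fin n) (g : EuclideanSpace ℝ (Fin n) → ℝ)
    (x : EuclideanSpace ℝ (Fin n)) (t : ℝ) :
    lineAverage i g (x + t • EuclideanSpace.single i 1) = lineAverage i g x := by
  unfold lineAverage
  rw [← integral_sub_right_eq_self (fun s => g (x - s • EuclideanSpace.single i 1)) t]
  congr 1
  funext s
  congr 1
  rw [sub_smul]
  abel

lemma lineAverage_eq_add (i : Fin n) (g : EuclideanSpace ℝ (Fin n) → ℝ)
    (x : EuclideanSpace ℝ (Fin n)) :
    lineAverage i g x = ∫ s : ℝ, g (x + s • EuclideanSpace.single i 1) := by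
  unfold lineAverage
  rw [← integral_neg_eq_self]
  simp

/-- Substituting `u = t - s` displays the half line integral as a primitive in `t`, to which the
fundamental theorem of calculus applies. -/
lemma halfLineIntegral_add_smul (i : Fin n) (g : EuclideanSpace ℝ (Fin n) → ℝ)
    (x : EuclideanSpace ℝ (Fin n)) (t : ℝ) :
    halfLineIntegral i g (x + t • EuclideanSpace.single i 1) =
      ∫ u in Iic t, g (x + u • EuclideanSpace.single i 1) := by
  unfold halfLineIntegral
  rw [← integral_indicator measurableSet_Iic, ← integral_sub_left_eq_self
    ((Iic t).indicator fun u => g (x + u • EuclideanSpace.single i 1)) volume t]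
  congr 1
  funext s
  by_cases hs : 0 ≤ s
  · rw [indicator_of_mem (mem_Ici.2 hs), indicator_of_mem (by simpa using hs), sub_smul]
    simp only [Pi.one_apply, one_mul]
    congr 1
    abel
  · rw [indicator_of_notMem (by simpa using hs), indicator_of_notMem (by simpa using hs), zero_mul]

namespace BoxSupported

variable {a : EuclideanSpace ℝ (Fin n)} {r : ℝ} {g h : EuclideanSpace ℝ (Fin n) → ℝ}

lemma contDiff_lineAverage (hg : BoxSupported a r g) (i : Fin n) :
    ContDiff ℝ ∞ (lineAverage i g) := by
  simpa [lineAverage, Function.comp_def] using!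
    hg.contDiff_lineIntegral (w := fun _ => 1) (locallyIntegrable_const 1) i

lemma contDiff_halfLineIntegral (hg : BoxSupported a r g) (i : Fin n) :
    ContDiff ℝ ∞ (halfLineIntegral i g) :=
  hg.contDiff_lineIntegral ((locallyIntegrable_const (1 : ℝ)).indicator measurableSet_Ici) i

lemma fderiv_halfLineIntegral (hg : BoxSupported a r g) (i : Fin n)
    (x : EuclideanSpace ℝ (Fin n)) :
    fderiv ℝ (halfLineIntegral i g) x (EuclideanSpace.single i 1) = g x := by
  have h1 : HasDerivAt (fun t : ℝ => halfLineIntegral i g (x + t • EuclideanSpace.single i 1))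
      (fderiv ℝ (halfLineIntegral i g) x (EuclideanSpace.single i 1)) 0 := by
    have hd : HasFDerivAt (halfLineIntegral i g) (fderiv ℝ (halfLineIntegral i g) x)
        (x + (0 : ℝ) • EuclideanSpace.single i 1) := by
      rw [zero_smul, add_zero]
      exact ((hg.contDiff_halfLineIntegral i).differentiable (by simp) x).hasFDerivAt
    have hl : HasDerivAt (fun t : ℝ => x + t • (EuclideanSpace.single i 1 :
        EuclideanSpace ℝ (Fin n))) (EuclideanSpace.single i 1) 0 := by
      simpa using! ((hasDerivAt_id (0 : ℝ)).smul_const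
        (EuclideanSpace.single i 1 : EuclideanSpace ℝ (Fin n))).const_add x
    exact hd.comp_hasDerivAt (0 : ℝ) hl
  have h2 : HasDerivAt (fun t : ℝ => halfLineIntegral i g (x + t • EuclideanSpace.single i 1))
      (g x) 0 := by
    have h3 := intervalIntegral.integral_hasDerivAt_right
      (f := fun u : ℝ => g (x + u • EuclideanSpace.single i 1)) (a := 0) (b := 0)
      ((hg.continuous_line x i).intervalIntegrable _ _)
      ((hg.continuous_line x i).stronglyMeasurableAtFilter _ _)
      (hg.continuous_line x i).continuousAt
    have h4 := h3.const_add (∫ u in Iic (0 : ℝ), g (x + u • EuclideanSpace.single i 1))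
    rw [zero_smul, add_zero] at h4
    refine h4.congr_of_eventuallyEq (Eventually.of_forall fun t => ?_)
    simp only
    rw [halfLineIntegral_add_smul, ← intervalIntegral.integral_Iic_sub_Iic
      (hg.integrable_line x i).integrableOn (hg.integrable_line x i).integrableOn]
    ring
  exact h1.unique h2

end BoxSupported

/-- A function on the line, with integral one and supported in `[-r, r]`. -/
structure UnitBump (r : ℝ) where
  toFun : ℝ → ℝ
  smooth : ContDiff ℝ ∞ toFun
  eq_zero : ∀ s, r < |s| → toFun s = 0
  integral : ∫ s, toFun s = 1
  nonneg : ∀ s, 0 ≤ toFun s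
  pos : 0 < toFun 0

lemma nonempty_unitBump {r : ℝ} (hr : 0 < r) : Nonempty (UnitBump r) := by
  let f : ContDiffBump (0 : ℝ) := ⟨r / 2, r, by linarith, by linarith⟩
  refine ⟨⟨f.normed volume, f.contDiff_normed, fun s hs => ?_, f.integral_normed,
    f.nonneg_normed, ?_⟩⟩
  · rw [← Function.notMem_support, f.support_normed_eq]
    simpa [Real.dist_eq] using hs.le
  · have : (0 : ℝ) ∈ Function.support (f.normed volume) := by
      rw [f.support_normed_eq]
      exact Metric.mem_ball_self hr
    exact lt_of_le_of_ne (f.nonneg_normed 0) (Ne.symm this)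

namespace BoxSupported

variable {a : EuclideanSpace ℝ (Fin n)} {r : ℝ} {g h : EuclideanSpace ℝ (Fin n) → ℝ}

lemma lineAverage_eq_zero (hg : BoxSupported a r g) {i j : Fin n} (hij : j ≠ i)
    {x : EuclideanSpace ℝ (Fin n)} (hx : r < |x j - a j|) : lineAverage i g x = 0 := by
  unfold lineAverage
  refine (integral_congr_ae (Eventually.of_forall fun s => ?_)).trans (integral_zero' _ _)
  exact hg.eq_zero _ j (by simpa [hij] using hx)

lemma mul_lineAverage (hg : BoxSupported a r g) (θ : UnitBump r) (i : Fin n) :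
    BoxSupported a r fun x => θ.toFun (x i - a i) * lineAverage i g x := by
  refine ⟨(θ.smooth.comp (by fun_prop)).mul (hg.contDiff_lineAverage i), fun x j hj => ?_⟩
  by_cases hij : j = i
  · subst hij
    rw [θ.eq_zero _ hj, zero_mul]
  · rw [hg.lineAverage_eq_zero hij hj, mul_zero]

/-- Transversally to the axis the lines miss the box. Along the axis, before the box the half line
does not meet the support; beyond it the half line carries the full line integral, which is zero by
hypothesis. -/
lemma halfLineIntegral_of_average (hg : BoxSupported a r g) {i : Fin n}
    (h0 : ∀ x, lineAverage i g x = 0) : BoxSupported a r (halfLineIntegral i g) := by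
  refine ⟨hg.contDiff_halfLineIntegral i, fun x j hj => ?_⟩
  by_cases hij : j = i
  · subst hij
    have e := halfLineIntegral_add_smul j g x 0
    rw [zero_smul, add_zero] at e
    rw [e]
    rcases lt_abs.1 hj with hj | hj
    · refine Eq.trans ?_ (h0 x)
      rw [lineAverage_eq_add, ← integral_indicator measurableSet_Iic]
      congr 1
      funext s
      by_cases hs : s ≤ 0
      · rw [indicator_of_mem (mem_Iic.2 hs)]
      · rw [indicator_of_notMem (by simpa using hs), hg.eq_zero _ j]
        simp only [PiLp.add_apply, PiLp.smul_apply, PiLp.single_apply, if_true, smul_eq_mul,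
          mul_one]
        exact lt_abs.2 (Or.inl (by linarith))
    · refine (setIntegral_congr_fun measurableSet_Iic fun s hs => ?_).trans (integral_zero' _ _)
      refine hg.eq_zero _ j ?_
      simp only [PiLp.add_apply, PiLp.smul_apply, PiLp.single_apply, if_true, smul_eq_mul,
          mul_one]
      exact lt_abs.2 (Or.inr (by linarith [mem_Iic.1 hs]))
  · unfold halfLineIntegral
    refine (integral_congr_ae (Eventually.of_forall fun s => ?_)).trans (integral_zero' _ _)
    rw [hg.eq_zero _ j (by simpa [hij] using hj), mul_zero]
    rfl

/-- The average is constant along its own lines and `θ` has integral one, so the product with `θ`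
has the same average as `g`. -/
lemma lineAverage_sub_mul (hg : BoxSupported a r g) (θ : UnitBump r) (i : Fin n)
    (x : EuclideanSpace ℝ (Fin n)) :
    lineAverage i (fun x => g x - θ.toFun (x i - a i) * lineAverage i g x) x = 0 := by
  rw [lineAverage_eq_add, integral_sub (hg.integrable_line x i)
    ((hg.mul_lineAverage θ i).integrable_line x i)]
  simp_rw [lineAverage_add_smul]
  rw [integral_mul_const, lineAverage_eq_add]
  have : ∫ s : ℝ, θ.toFun ((x + s • (EuclideanSpace.single i 1 : EuclideanSpace ℝ (Fin n))) i
      - a i) = 1 := by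
    refine Eq.trans ?_ ((integral_add_left_eq_self θ.toFun (x i - a i)).trans θ.integral)
    congr 1
    funext s
    congr 1
    simp
    ring
  rw [this, one_mul, sub_self]

/-- One step of the decomposition: along one axis, a function with support in a box is a
derivative plus a product. -/
lemma exists_eq_fderiv_add (hg : BoxSupported a r g) (θ : UnitBump r) (i : Fin n) :
    ∃ U, BoxSupported a r U ∧ ∀ x, g x = fderiv ℝ U x (EuclideanSpace.single i 1) +
      θ.toFun (x i - a i) * lineAverage i g x := by
  have h1 := hg.sub (hg.mul_lineAverage θ i)
  refine ⟨_, h1.halfLineIntegral_of_average (hg.lineAverage_sub_mul θ i), fun x => ?_⟩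
  rw [h1.fderiv_halfLineIntegral]
  ring

/-- Axes are treated one at a time. After those in `S`, the remainder is a product of bumps in these
coordinates times a function that no longer depends on them. Only the product, not `k` itself, keeps
its support in the box. -/
lemma exists_eq_sum_fderiv_add_prod (hg : BoxSupported a r g) (θ : UnitBump r)
    (S : Finset (Fin n)) :
    ∃ (U : Fin n → EuclideanSpace ℝ (Fin n) → ℝ) (k : EuclideanSpace ℝ (Fin n) → ℝ),
      (∀ i, BoxSupported a r (U i)) ∧
      BoxSupported a r (fun x => (∏ i ∈ S, θ.toFun (x i - a i)) * k x) ∧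
      (∀ i ∈ S, ∀ x (t : ℝ), k (x + t • EuclideanSpace.single i 1) = k x) ∧
      ∀ x, g x = ∑ i, fderiv ℝ (U i) x (EuclideanSpace.single i 1) +
        (∏ i ∈ S, θ.toFun (x i - a i)) * k x := by
  classical
  induction S using Finset.induction_on with
  | empty =>
    refine ⟨fun _ _ => 0, g, fun _ => zero, by simpa using! hg, by simp, fun x => by simp⟩
  | insert i S hi ih =>
    obtain ⟨U, k, hU, hk, hinv, hsum⟩ := ih
    obtain ⟨W, hW, hWe⟩ := hk.exists_eq_fderiv_add θ i
    -- Since `i ∉ S`, the bumps already present do not vary along axis `i` and come out of the line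
    -- integral.
    have hav : ∀ x, lineAverage i (fun x => (∏ i ∈ S, θ.toFun (x i - a i)) * k x) x =
        (∏ i ∈ S, θ.toFun (x i - a i)) * lineAverage i k x := by
      intro x
      unfold lineAverage
      rw [← integral_const_mul]
      congr 1
      funext s
      refine congrArg (· * _) (Finset.prod_congr rfl fun j hj => ?_)
      have : j ≠ i := by
        rintro rfl
        exact hi hj
      simp [this]
    have hb := hk.mul_lineAverage θ i
    simp_rw [hav] at hb hWe
    refine ⟨fun j => if j = i then fun x => U i x + W x else U j, lineAverage i k, ?_, ?_, ?_, ?_⟩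
    · intro j
      by_cases hj : j = i
      · simpa [hj] using! (hU i).add hW
      · simpa [hj] using! hU j
    · simpa [Finset.prod_insert hi, mul_assoc] using! hb
    · intro j hj x t
      rcases Finset.mem_insert.1 hj with rfl | hj
      · exact lineAverage_add_smul _ _ _ _
      · unfold lineAverage
        congr 1
        funext s
        rw [← hinv j hj (x - s • EuclideanSpace.single i 1) t]
        congr 1
        abel
    · intro x
      have h1 : ∀ j, fderiv ℝ (if j = i then fun x => U i x + W x else U j) x
          (EuclideanSpace.single j 1) = fderiv ℝ (U j) x (EuclideanSpace.single j 1) +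
          if j = i then fderiv ℝ W x (EuclideanSpace.single i 1) else 0 := by
        intro j
        by_cases hj : j = i
        · subst hj
          simp only [if_true]
          rw [fderiv_fun_add ((hU j).smooth.differentiable (by simp) x)
            (hW.smooth.differentiable (by simp) x)]
          rfl
        · simp [hj]
      simp_rw [h1]
      rw [Finset.sum_add_distrib, Finset.sum_ite_eq' Finset.univ i, if_pos (Finset.mem_univ i),
        hsum x, hWe x, Finset.prod_insert hi]
      ring

/-- The Poincaré lemma for compactly supported forms of top degree. -/
theorem exists_eq_sum_fderiv (hg : BoxSupported a r g) (θ : UnitBump r) :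
    ∃ (U : Fin n → EuclideanSpace ℝ (Fin n) → ℝ) (κ : ℝ), (∀ i, BoxSupported a r (U i)) ∧
      ∀ x, g x = κ * (∏ i, θ.toFun (x i - a i)) +
        ∑ i, fderiv ℝ (U i) x (EuclideanSpace.single i 1) := by
  obtain ⟨U, k, hU, -, hinv, hsum⟩ := hg.exists_eq_sum_fderiv_add_prod θ Finset.univ
  refine ⟨U, k a, hU, fun x => ?_⟩
  -- With all axes treated, `k` is invariant in every coordinate direction. Walking from `a` to `x`
  -- axis by axis shows that it is constant.
  have hk : ∀ S : Finset (Fin n), k (a + ∑ i ∈ S, (x i - a i) •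
      (EuclideanSpace.single i 1 : EuclideanSpace ℝ (Fin n))) =
      k a := by
    classical
    intro S
    induction S using Finset.induction_on with
    | empty => simp
    | insert i S hi ih =>
      rw [Finset.sum_insert hi, add_comm ((x i - a i) • _), ← add_assoc,
        hinv i (Finset.mem_univ i), ih]
  have hx : a + ∑ i, (x i - a i) • (EuclideanSpace.single i 1 : EuclideanSpace ℝ (Fin n)) = x := by
    ext j
    simp [Finset.sum_apply, Pi.single_apply]
  have h1 := hk Finset.univ
  rw [hx] at h1
  rw [hsum x, h1]
  ring

end BoxSupported

lemma UnitBump.boxSupported_prod {r : ℝ} (θ : UnitBump r) (a : EuclideanSpace ℝ (Fin n)) :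
    BoxSupported a r fun x => ∏ i, θ.toFun (x i - a i) :=
  ⟨contDiff_prod fun i _ => θ.smooth.comp (by fun_prop), fun x j hj =>
    Finset.prod_eq_zero (Finset.mem_univ j) (θ.eq_zero _ hj)⟩

lemma UnitBump.integral_prod_pos {r : ℝ} (θ : UnitBump r) (a : EuclideanSpace ℝ (Fin n)) :
    0 < ∫ x : EuclideanSpace ℝ (Fin n), ∏ i, θ.toFun (x i - a i) := by
  have h := θ.boxSupported_prod a
  refine (h.smooth.continuous.integral_pos_of_hasCompactSupport_nonneg_nonzero
    h.hasCompactSupport (fun x => Finset.prod_nonneg fun i _ => θ.nonneg _) (x := a) ?_)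
  simp only [sub_self]
  exact (Finset.prod_pos fun i _ => θ.pos).ne'

end Box

/-! ### Cutoffs, extension by zero and the orientation sign -/

section Extension

variable {V : Type*} [NormedAddCommGroup V] [NormedSpace ℝ V]

/-- Extension by zero of a smooth function that vanishes outside a closed subset of its domain. -/
lemma contDiff_indicator {u : V → ℝ} {U K : Set V} (hU : IsOpen U) (hK : IsClosed K) (hKU : K ⊆ U)
    (hu : ContDiffOn ℝ ∞ u U) (h0 : ∀ x ∈ U, x ∉ K → u x = 0) : ContDiff ℝ ∞ (U.indicator u) := by
  rw [contDiff_iff_contDiffAt]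
  intro x
  by_cases hx : x ∈ U
  · refine (hu.contDiffAt (hU.mem_nhds hx)).congr_of_eventuallyEq ?_
    filter_upwards [hU.mem_nhds hx] with y hy
    rw [indicator_of_mem hy]
  · refine (contDiffAt_const (c := (0 : ℝ))).congr_of_eventuallyEq ?_
    filter_upwards [hK.isOpen_compl.mem_nhds fun h => hx (hKU h)] with y hy
    by_cases hyU : y ∈ U
    · rw [indicator_of_mem hyU, h0 y hyU hy]
    · rw [indicator_of_notMem hyU]

/-- The orientation sign of a chart is locally constant, so it passes through derivatives. No chart
has to be replaced by an oriented one. -/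
lemma eventually_sign_eq {X : Type*} [TopologicalSpace X] {u : X → ℝ} {x : X}
    (hu : ContinuousAt u x) (h : u x ≠ 0) : ∀ᶠ y in 𝓝 x, Real.sign (u y) = Real.sign (u x) := by
  rcases lt_or_gt_of_ne h with h | h
  · filter_upwards [hu.eventually_lt_const h] with y hy
    rw [Real.sign_of_neg hy, Real.sign_of_neg h]
  · filter_upwards [hu.eventually_const_lt h] with y hy
    rw [Real.sign_of_pos hy, Real.sign_of_pos h]

lemma contDiffOn_sign {u : V → ℝ} {U : Set V} (hU : IsOpen U) (hu : ContinuousOn u U)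
    (h : ∀ x ∈ U, u x ≠ 0) : ContDiffOn ℝ ∞ (fun x => Real.sign (u x)) U := fun x hx =>
  (contDiffAt_const.congr_of_eventuallyEq
    (eventually_sign_eq (hu.continuousAt (hU.mem_nhds hx)) (h x hx))).contDiffWithinAt

variable [FiniteDimensional ℝ V]

/-- A smooth function equal to one near a compact subset of an open set and supported in it. -/
lemma exists_cutoff {K U : Set V} (hK : IsCompact K) (hU : IsOpen U) (hKU : K ⊆ U) :
    ∃ (χ : V → ℝ) (L : Set V), ContDiff ℝ ∞ χ ∧ IsCompact L ∧ L ⊆ U ∧ (∀ x ∉ L, χ x = 0) ∧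
      ∀ x ∈ K, χ =ᶠ[𝓝 x] fun _ => 1 := by
  obtain ⟨L, hL, hKL, hLU⟩ := exists_compact_between hK hU hKU
  obtain ⟨f, h1, h0, -⟩ := exists_contMDiffMap_one_nhds_of_subset_interior 𝓘(ℝ, V) (n := ⊤)
    hK.isClosed hKL
  exact ⟨f, L, f.contMDiff.contDiff, hL, hLU, h0, fun x hx => mem_nhdsSet_iff_forall.1 h1 x hx⟩

/-- A smooth function on `V` that agrees near a compact set with one defined on an open set. -/
lemma exists_contDiff_eventuallyEq {K U : Set V} (hK : IsCompact K) (hU : IsOpen U) (hKU : K ⊆ U)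
    {u : V → ℝ} (hu : ContDiffOn ℝ ∞ u U) :
    ∃ w : V → ℝ, ContDiff ℝ ∞ w ∧ ∀ x ∈ K, w =ᶠ[𝓝 x] u := by
  obtain ⟨χ, L, hχ, hL, hLU, h0, h1⟩ := exists_cutoff hK hU hKU
  refine ⟨U.indicator fun x => χ x * u x, contDiff_indicator hU hL.isClosed hLU
    (hχ.contDiffOn.mul hu) (fun x _ hx => by rw [h0 x hx, zero_mul]), fun x hx => ?_⟩
  filter_upwards [h1 x hx, hU.mem_nhds (hKU hx)] with y hy hyU
  rw [indicator_of_mem hyU, hy, one_mul]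

end Extension

/-! ### The alternating form and Stokes' theorem on the manifold -/

section Alternating

variable {n : ℕ} {M : Type*} [TopologicalSpace M] [ChartedSpace (EuclideanSpace ℝ (Fin n)) M]
  [IsManifold (𝓡 n) ∞ M]

variable (n M) in
/-- The smooth functions on `M`. -/
def smoothFunctions : Submodule ℝ (M → ℝ) where
  carrier := {f | ContMDiff (𝓡 n) 𝓘(ℝ, ℝ) ∞ f}
  add_mem' := fun ha hb => ContMDiff.add ha hb
  zero_mem' := contMDiff_const
  smul_mem' := fun _ _ ha => contMDiff_const.mul ha

lemma smoothFunctions_contDiffOn (f : smoothFunctions n M) (c : M) :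
    ContDiffOn ℝ ∞ ((f : M → ℝ) ∘ (extChartAt (𝓡 n) c).symm) (extChartAt (𝓡 n) c).target :=
  contMDiff_iff_charts.1 f.2 c

lemma smoothFunctions_differentiableAt (f : smoothFunctions n M) {c : M}
    {y : EuclideanSpace ℝ (Fin n)} (hy : y ∈ (extChartAt (𝓡 n) c).target) :
    DifferentiableAt ℝ ((f : M → ℝ) ∘ (extChartAt (𝓡 n) c).symm) y :=
  ((smoothFunctions_contDiffOn f c).contDiffAt
    ((isOpen_extChartAt_target c).mem_nhds hy)).differentiableAt (by simp)

/-- The partial derivatives in the chart around `c`. -/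
def chartGrad (c : M) (f : M → ℝ) (y : EuclideanSpace ℝ (Fin n)) (j : Fin n) : ℝ :=
  fderiv ℝ (f ∘ (extChartAt (𝓡 n) c).symm) y (EuclideanSpace.single j 1)

lemma chartCoeff_wedgeForm_coe (f : Fin (n + 1) → smoothFunctions n M) {c : M}
    {y : EuclideanSpace ℝ (Fin n)} (hy : y ∈ (extChartAt (𝓡 n) c).target) :
    chartCoeff c (wedgeForm fun i => (f i : M → ℝ)) y =
      (f 0 : M → ℝ) ((extChartAt (𝓡 n) c).symm y) *
        Matrix.det (Matrix.of fun i => chartGrad c (f (Fin.succ i)) y) :=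
  chartCoeff_wedgeForm (fun i => (f i).2) hy

lemma chartGrad_add (f g : smoothFunctions n M) {c : M} {y : EuclideanSpace ℝ (Fin n)}
    (hy : y ∈ (extChartAt (𝓡 n) c).target) :
    chartGrad c ((f + g : smoothFunctions n M) : M → ℝ) y = chartGrad c f y + chartGrad c g y := by
  funext j
  have h := fderiv_add (smoothFunctions_differentiableAt f hy)
    (smoothFunctions_differentiableAt g hy)
  exact congrArg (fun L => L (EuclideanSpace.single j 1)) h

lemma chartGrad_smul (r : ℝ) (f : smoothFunctions n M) {c : M} {y : EuclideanSpace ℝ (Fin n)}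
    (hy : y ∈ (extChartAt (𝓡 n) c).target) :
    chartGrad c ((r • f : smoothFunctions n M) : M → ℝ) y = r • chartGrad c f y := by
  funext j
  have h := fderiv_const_smul (smoothFunctions_differentiableAt f hy) r
  exact congrArg (fun L => L (EuclideanSpace.single j 1)) h

omit [IsManifold (𝓡 n) ∞ M] in
lemma chartGrad_update [DecidableEq (Fin (n + 1))] (f : Fin (n + 1) → smoothFunctions n M)
    (k : Fin n) (g : smoothFunctions n M) (c : M) (y : EuclideanSpace ℝ (Fin n)) :
    (Matrix.of fun i => chartGrad c (Function.update f k.succ g (Fin.succ i)) y) =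
      Matrix.updateRow (Matrix.of fun i => chartGrad c (f (Fin.succ i)) y) k (chartGrad c g y) := by
  ext i j
  by_cases h : i = k
  · subst h
    simp
  · simp [h]

lemma wedgeForm_update_add [DecidableEq (Fin (n + 1))] (f : Fin (n + 1) → smoothFunctions n M)
    (i : Fin (n + 1)) (g h : smoothFunctions n M) :
    wedgeForm (fun j => (Function.update f i (g + h) j : M → ℝ)) =
      wedgeForm (fun j => (Function.update f i g j : M → ℝ)) +
      wedgeForm (fun j => (Function.update f i h j : M → ℝ)) := by
  refine form_ext fun c y hy => ?_
  change _ = chartCoeff c _ y + chartCoeff c _ y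
  rw [chartCoeff_wedgeForm_coe _ hy, chartCoeff_wedgeForm_coe _ hy, chartCoeff_wedgeForm_coe _ hy]
  cases i using Fin.cases with
  | zero => simp [add_mul]
  | succ k =>
    rw [chartGrad_update, chartGrad_update, chartGrad_update, chartGrad_add g h hy,
      Matrix.det_updateRow_add]
    simp only [Function.update_of_ne (Fin.succ_ne_zero k).symm]
    ring

lemma wedgeForm_update_smul [DecidableEq (Fin (n + 1))] (f : Fin (n + 1) → smoothFunctions n M)
    (i : Fin (n + 1)) (r : ℝ) (g : smoothFunctions n M) :
    wedgeForm (fun j => (Function.update f i (r • g) j : M → ℝ)) =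
      r • wedgeForm (fun j => (Function.update f i g j : M → ℝ)) := by
  refine form_ext fun c y hy => ?_
  change _ = r * chartCoeff c _ y
  rw [chartCoeff_wedgeForm_coe _ hy, chartCoeff_wedgeForm_coe _ hy]
  cases i using Fin.cases with
  | zero => simp [mul_assoc]
  | succ k =>
    rw [chartGrad_update, chartGrad_update, chartGrad_smul r g hy, Matrix.det_updateRow_smul]
    simp only [Function.update_of_ne (Fin.succ_ne_zero k).symm]
    ring

variable [T2Space M] [CompactSpace M]

/-- `∫ f₀ df₁ ∧ ⋯ ∧ dfₙ`, as a multilinear map. -/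
def wedgeIntegral (ν : VolumeForm n M) :
    MultilinearMap ℝ (fun _ : Fin (n + 1) => smoothFunctions n M) ℝ where
  toFun f := ν.integral (wedgeForm fun i => (f i : M → ℝ))
  map_update_add' f i g h := by
    rw [wedgeForm_update_add, ν.integral_add (wedgeForm_mem_smoothForms fun j => (_ : smoothFunctions n M).2)
      (wedgeForm_mem_smoothForms fun j => (_ : smoothFunctions n M).2)]
  map_update_smul' f i r g := by
    rw [wedgeForm_update_smul, ν.integral_smul, smul_eq_mul]

omit [IsManifold (𝓡 n) ∞ M] [T2Space M] in
lemma isCompact_image_tsupport {c : M} {f : M → ℝ}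
    (hs : tsupport f ⊆ (extChartAt (𝓡 n) c).source) :
    IsCompact (extChartAt (𝓡 n) c '' tsupport f) :=
  (isClosed_tsupport f).isCompact.image_of_continuousOn ((continuousOn_extChartAt c).mono hs)

omit [IsManifold (𝓡 n) ∞ M] [T2Space M] [CompactSpace M] in
lemma image_tsupport_subset {c : M} {f : M → ℝ}
    (hs : tsupport f ⊆ (extChartAt (𝓡 n) c).source) :
    extChartAt (𝓡 n) c '' tsupport f ⊆ (extChartAt (𝓡 n) c).target := by
  rintro _ ⟨x, hx, rfl⟩
  exact (extChartAt (𝓡 n) c).map_source (hs hx)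

omit [IsManifold (𝓡 n) ∞ M] [T2Space M] [CompactSpace M] in
lemma comp_symm_eq_zero {c : M} {f : M → ℝ} {y : EuclideanSpace ℝ (Fin n)}
    (hy : y ∈ (extChartAt (𝓡 n) c).target) (hyK : y ∉ extChartAt (𝓡 n) c '' tsupport f) :
    f ((extChartAt (𝓡 n) c).symm y) = 0 := by
  by_contra hne
  exact hyK ⟨_, subset_tsupport _ hne, (extChartAt (𝓡 n) c).right_inv hy⟩

omit [IsManifold (𝓡 n) ∞ M] [T2Space M] [CompactSpace M] in
lemma wedgeForm_eq_zero {f : Fin (n + 1) → M → ℝ} {k : Fin n} {x : M}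
    (hx : x ∉ tsupport (f k.succ)) : wedgeForm f x = 0 := by
  have h0 : f k.succ =ᶠ[𝓝 x] fun _ => 0 := notMem_tsupport_iff_eventuallyEq.1 hx
  have hd : mfderiv (𝓡 n) 𝓘(ℝ, ℝ) (f k.succ) x = 0 := by
    rw [h0.mfderiv_eq, mfderiv_const]
    rfl
  ext v
  unfold wedgeForm
  change f 0 x * wedge _ v = 0
  refine mul_eq_zero_of_right _ ((wedge_apply _ _).trans (Matrix.det_eq_zero_of_row_eq_zero k ?_))
  intro j
  simp only [Matrix.of_apply]
  rw [hd]
  rfl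

/-- Stokes for an integrand living in one chart. It is transported to Euclidean space after each
function has been replaced by a globally defined one; this changes nothing, as only a neighbourhood
of the support of the `k`-th function matters. -/
lemma wedgeIntegral_eq_zero_of_tsupport (ν : VolumeForm n M)
    (f : Fin (n + 1) → smoothFunctions n M) (h1 : ∀ x, (f 0 : M → ℝ) x = 1) (k : Fin n) (c : M)
    (hs : tsupport (f k.succ : M → ℝ) ⊆ (extChartAt (𝓡 n) c).source) :
    wedgeIntegral ν f = 0 := by
  set K := extChartAt (𝓡 n) c '' tsupport (f k.succ : M → ℝ) with hKdef
  have hK : IsCompact K := isCompact_image_tsupport hs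
  have hKU : K ⊆ (extChartAt (𝓡 n) c).target := image_tsupport_subset hs
  have hU := isOpen_extChartAt_target (I := 𝓡 n) c
  set s : EuclideanSpace ℝ (Fin n) → ℝ := fun y => Real.sign (chartCoeff c ν.toForm y) with hsdef
  have hνc := (contDiffOn_chartCoeff ν.smooth c).continuousOn
  have hν0 : ∀ y ∈ (extChartAt (𝓡 n) c).target, chartCoeff c ν.toForm y ≠ 0 :=
    fun y hy => chartCoeff_ne_zero ν.ne_zero hy
  have hsm : ContDiffOn ℝ ∞ s (extChartAt (𝓡 n) c).target := contDiffOn_sign hU hνc hν0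
  have hext := fun i : Fin n => exists_contDiff_eventuallyEq hK hU hKU
    (smoothFunctions_contDiffOn (f i.succ) c)
  choose w hw hwe using hext
  -- The orientation sign is absorbed into the compactly supported function, so that the oriented
  -- integrand becomes exactly a determinant of derivatives.
  set u : EuclideanSpace ℝ (Fin n) → ℝ :=
    (extChartAt (𝓡 n) c).target.indicator fun y =>
      s y * ((f k.succ : M → ℝ) ∘ (extChartAt (𝓡 n) c).symm) y with hu
  have huc : ContDiff ℝ ∞ u := contDiff_indicator hU hK.isClosed hKU
    (hsm.mul (smoothFunctions_contDiffOn (f k.succ) c)) fun y hy hyK => by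
      rw [Function.comp_apply, comp_symm_eq_zero hy hyK, mul_zero]
  have hu0 : ∀ y ∉ K, u y = 0 := fun y hyK => by
    by_cases hy : y ∈ (extChartAt (𝓡 n) c).target
    · rw [hu, indicator_of_mem hy, Function.comp_apply, comp_symm_eq_zero hy hyK, mul_zero]
    · rw [hu, indicator_of_notMem hy]
  have hgu : ∀ y ∈ (extChartAt (𝓡 n) c).target, ∀ j,
      fderiv ℝ u y (EuclideanSpace.single j 1) = s y * chartGrad c (f k.succ : M → ℝ) y j := by
    intro y hy j
    have he : u =ᶠ[𝓝 y] fun z => s y • ((f k.succ : M → ℝ) ∘ (extChartAt (𝓡 n) c).symm) z := by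
      filter_upwards [hU.mem_nhds hy,
        eventually_sign_eq (hνc.continuousAt (hU.mem_nhds hy)) (hν0 y hy)] with z hz hz2
      rw [hu, indicator_of_mem hz, hsdef]
      simp only [hz2, smul_eq_mul]
    rw [he.fderiv_eq, fderiv_fun_const_smul (smoothFunctions_differentiableAt _ hy)]
    rfl
  have hgu0 : ∀ y ∉ K, ∀ j : Fin n, fderiv ℝ u y (EuclideanSpace.single j 1) = 0 := by
    intro y hy j
    have he : u =ᶠ[𝓝 y] fun _ => 0 := by
      filter_upwards [hK.isClosed.isOpen_compl.mem_nhds hy] with z hz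
      exact hu0 z hz
    rw [he.fderiv_eq]
    simp
  have hint := integral_det_fderiv_eq_zero (h := Function.update w k u)
    (fun i => by
      by_cases hi : i = k
      · subst hi; simpa using huc
      · simpa [hi] using hw i) k
    (by simpa using HasCompactSupport.intro hK hu0)
  change ν.integral _ = 0
  rw [ν.integral_eq_of_chart (wedgeForm_mem_smoothForms fun j => (f j).2) c
    (fun x hx => wedgeForm_eq_zero (k := k) fun h => hx (hs h)), ← hint]
  refine Eq.trans ?_ (setIntegral_eq_integral_of_forall_compl_eq_zero
    (s := (extChartAt (𝓡 n) c).target) fun y hy => ?_)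
  · refine setIntegral_congr_fun hU.measurableSet fun y hy => ?_
    rw [chartCoeff_wedgeForm_coe f hy, h1, one_mul]
    by_cases hyK : y ∈ K
    · have : (Matrix.of fun i j => fderiv ℝ (Function.update w k u i) y
          (EuclideanSpace.single j 1)) = Matrix.updateRow
          (Matrix.of fun i => chartGrad c (f (Fin.succ i)) y) k
          (s y • chartGrad c (f k.succ : M → ℝ) y) := by
        ext i j
        by_cases hi : i = k
        · subst hi
          simpa using hgu y hy j
        · simp only [Matrix.of_apply, Function.update_of_ne hi, Matrix.updateRow_ne hi]
          rw [(hwe i y hyK).fderiv_eq]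
          rfl
      rw [this, Matrix.det_updateRow_smul]
      congr 2
      ext i j
      by_cases hi : i = k
      · subst hi; simp
      · simp [hi]
    · rw [Matrix.det_eq_zero_of_row_eq_zero (A := Matrix.of fun i => chartGrad c (f i.succ) y) k,
        Matrix.det_eq_zero_of_row_eq_zero (A := Matrix.of fun i j => fderiv ℝ _ y _) k, mul_zero]
      · intro j
        simpa using hgu0 y hyK j
      · intro j
        have he : ((f k.succ : M → ℝ) ∘ (extChartAt (𝓡 n) c).symm) =ᶠ[𝓝 y] fun _ => 0 := by
          filter_upwards [hK.isClosed.isOpen_compl.mem_nhds hyK, hU.mem_nhds hy] with z hz hz2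
          exact comp_symm_eq_zero hz2 hz
        simp only [Matrix.of_apply, chartGrad]
        rw [he.fderiv_eq]
        simp
  · refine Matrix.det_eq_zero_of_row_eq_zero k fun j => ?_
    simpa using hgu0 y (fun h => hy (hKU h)) j

/-- A smooth function is a finite sum of functions supported in the members of an open cover. -/
lemma exists_eq_sum_tsupport_subset (f : smoothFunctions n M) {U : M → Set M}
    (hU : ∀ c, IsOpen (U c)) (hmem : ∀ c, c ∈ U c) :
    ∃ (S : Finset M) (g : M → smoothFunctions n M), f = ∑ c ∈ S, g c ∧
      ∀ c, tsupport (g c : M → ℝ) ⊆ U c := by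
  obtain ⟨ρ, hρ⟩ := SmoothPartitionOfUnity.exists_isSubordinate (𝓡 n) isClosed_univ U hU
    fun x _ => mem_iUnion_of_mem x (hmem x)
  have hfin := ρ.locallyFinite.finite_nonempty_of_compact
  refine ⟨hfin.toFinset, fun c => ⟨fun x => ρ c x * (f : M → ℝ) x, (ρ c).contMDiff.mul f.2⟩, ?_,
    fun c => tsupport_mul_subset_left.trans (hρ c)⟩
  ext x
  have hsum : ∑ c ∈ hfin.toFinset, ρ c x = 1 := by
    rw [← ρ.sum_eq_one (mem_univ x)]
    refine (finsum_eq_sum_of_support_subset _ fun c hc => ?_).symm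
    simp only [Finite.coe_toFinset, mem_ofPred_eq]
    exact ⟨x, hc⟩
  rw [AddSubmonoidClass.coe_finsetSum, Finset.sum_apply, ← Finset.sum_mul, hsum, one_mul]

/-- A smooth function is a finite sum of functions supported in charts. -/
lemma exists_eq_sum_tsupport (f : smoothFunctions n M) :
    ∃ (S : Finset M) (g : M → smoothFunctions n M), f = ∑ c ∈ S, g c ∧
      ∀ c, tsupport (g c : M → ℝ) ⊆ (extChartAt (𝓡 n) c).source :=
  exists_eq_sum_tsupport_subset f (fun c => isOpen_extChartAt_source c) mem_extChartAt_source

/-- Stokes' theorem for `∫ df₁ ∧ ⋯ ∧ dfₙ`. -/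
lemma wedgeIntegral_eq_zero_of_eq_one (ν : VolumeForm n M)
    (f : Fin (n + 1) → smoothFunctions n M) (h1 : ∀ x, (f 0 : M → ℝ) x = 1) (k : Fin n) :
    wedgeIntegral ν f = 0 := by
  obtain ⟨S, g, hg, hs⟩ := exists_eq_sum_tsupport (f k.succ)
  rw [← Function.update_eq_self k.succ f, hg, MultilinearMap.map_update_sum]
  refine Finset.sum_eq_zero fun c _ => wedgeIntegral_eq_zero_of_tsupport ν _ (fun x => ?_) k c ?_
  · rw [Function.update_of_ne (Fin.succ_ne_zero k).symm, h1]
  · rw [Function.update_self]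
    exact hs c

/-- The identity `f df = d(f²/2)` replaces the pair of equal functions by the pair `1`, `f²/2`, and
Stokes' theorem applies. -/
lemma wedgeIntegral_eq_zero_of_zero_eq (ν : VolumeForm n M)
    (f : Fin (n + 1) → smoothFunctions n M) (k : Fin n) (h : f 0 = f k.succ) :
    wedgeIntegral ν f = 0 := by
  set g : smoothFunctions n M :=
    ⟨fun x => 2⁻¹ * ((f 0 : M → ℝ) x * (f 0 : M → ℝ) x),
      contMDiff_const.mul ((f 0).2.mul (f 0).2)⟩ with hg
  set one : smoothFunctions n M := ⟨fun _ => 1, contMDiff_const⟩ with hone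
  rw [← wedgeIntegral_eq_zero_of_eq_one ν (Function.update (Function.update f 0 one) k.succ g)
    (fun x => by rw [Function.update_of_ne (Fin.succ_ne_zero k).symm, Function.update_self]) k]
  change ν.integral _ = ν.integral _
  congr 1
  refine form_ext fun c y hy => ?_
  rw [chartCoeff_wedgeForm_coe _ hy, chartCoeff_wedgeForm_coe _ hy, chartGrad_update]
  rw [Function.update_of_ne (Fin.succ_ne_zero k).symm, Function.update_self]
  have hgrad : chartGrad c (g : M → ℝ) y = (f 0 : M → ℝ) ((extChartAt (𝓡 n) c).symm y) •
      chartGrad c (f k.succ : M → ℝ) y := by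
    funext j
    have hd := (smoothFunctions_differentiableAt (f 0) hy).hasFDerivAt
    have := ((hd.mul hd).const_mul (2⁻¹ : ℝ)).fderiv
    rw [← h]
    unfold chartGrad
    rw [show (g : M → ℝ) ∘ (extChartAt (𝓡 n) c).symm = fun y =>
      2⁻¹ * (((f 0 : M → ℝ) ∘ (extChartAt (𝓡 n) c).symm) *
        ((f 0 : M → ℝ) ∘ (extChartAt (𝓡 n) c).symm)) y from rfl, this]
    simp
    ring
  rw [hgrad, Matrix.det_updateRow_smul, hone]
  simp only [one_mul]
  congr 2
  ext i j
  by_cases hi : i = k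
  · subst hi; simp
  · simp [hi]

/-- `∫ f₀ df₁ ∧ ⋯ ∧ dfₙ`, as an alternating map. -/
def wedgeAlternating (ν : VolumeForm n M) : smoothFunctions n M [⋀^Fin (n + 1)]→ₗ[ℝ] ℝ :=
  { wedgeIntegral ν with
    map_eq_zero_of_eq' := by
      intro f i j hij hne
      cases i using Fin.cases with
      | zero =>
        cases j using Fin.cases with
        | zero => exact absurd rfl hne
        | succ k => exact wedgeIntegral_eq_zero_of_zero_eq ν f k hij
      | succ k =>
        cases j using Fin.cases with
        | zero => exact wedgeIntegral_eq_zero_of_zero_eq ν f k hij.symm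
        | succ l =>
          change ν.integral _ = 0
          -- When both equal arguments are differentiated, two rows of the determinant agree and the
          -- form itself vanishes.
          have : wedgeForm (fun i => (f i : M → ℝ)) = 0 := by
            refine form_ext fun c y hy => ?_
            rw [chartCoeff_wedgeForm_coe _ hy, Matrix.det_zero_of_row_eq (i := k) (j := l)
              (fun h => hne (congrArg _ h)) (by funext m; simp [hij]), mul_zero]
            rfl
          rw [this]
          simpa using ν.integral_smul 0 0 }

/-- `a ↦ a / μ`. -/
def ratioLinear (ν : VolumeForm n M) {μ : FormField n M} (hμ : μ ∈ smoothForms n M)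
    (h0 : ∀ x, μ x ≠ 0) : TangentProb ν →ₗ[ℝ] smoothFunctions n M where
  toFun a := ⟨ratio a μ, contMDiff_ratio h0 hμ a.2.1⟩
  map_add' a b := by
    ext x
    exact add_div _ _ _
  map_smul' r a := by
    ext x
    exact mul_div_assoc _ _ _

/-- `∫ (a₁/μ) d(a₂/μ) ∧ ⋯ ∧ d(aₙ₊₁/μ)`, as an alternating form. -/
def omegaAlternating (ν : VolumeForm n M) {μ : FormField n M} (hμ : μ ∈ smoothForms n M)
    (h0 : ∀ x, μ x ≠ 0) : TangentProb ν [⋀^Fin (n + 1)]→ₗ[ℝ] ℝ :=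
  (wedgeAlternating ν).compLinearMap (ratioLinear ν hμ h0)

end Alternating

/-! ### Partial derivatives on a product -/

section Partial

variable {P V : Type*} [NormedAddCommGroup P] [NormedSpace ℝ P] [NormedAddCommGroup V]
  [NormedSpace ℝ V] {W : Type*} [NormedAddCommGroup W] [NormedSpace ℝ W]

lemma hasFDerivAt_comp_mk_right {g : P × V → W} {p : P} {y : V}
    (hg : DifferentiableAt ℝ g (p, y)) :
    HasFDerivAt (fun y => g (p, y)) ((fderiv ℝ g (p, y)).comp (ContinuousLinearMap.inr ℝ P V)) y :=
  hg.hasFDerivAt.comp y (f := fun y : V => (p, y))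
    ((hasFDerivAt_const p y).prodMk (hasFDerivAt_id y))

lemma hasFDerivAt_comp_mk_left {g : P × V → W} {p : P} {y : V}
    (hg : DifferentiableAt ℝ g (p, y)) :
    HasFDerivAt (fun p => g (p, y)) ((fderiv ℝ g (p, y)).comp (ContinuousLinearMap.inl ℝ P V)) p :=
  hg.hasFDerivAt.comp p (f := fun p : P => (p, y))
    ((hasFDerivAt_id p).prodMk (hasFDerivAt_const y p))

lemma fderiv_mk_right {g : P × V → W} {p : P} {y : V} (hg : DifferentiableAt ℝ g (p, y)) (v : V) :
    fderiv ℝ (fun y => g (p, y)) y v = fderiv ℝ g (p, y) (0, v) := by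
  rw [(hasFDerivAt_comp_mk_right hg).fderiv]
  rfl

lemma fderiv_mk_left {g : P × V → W} {p : P} {y : V} (hg : DifferentiableAt ℝ g (p, y)) (e : P) :
    fderiv ℝ (fun p => g (p, y)) p e = fderiv ℝ g (p, y) (e, 0) := by
  rw [(hasFDerivAt_comp_mk_left hg).fderiv]
  rfl

/-- Being `C^∞` at a point does not spread to a neighbourhood, as the neighbourhood may shrink with
the order. Order two spreads, and it is enough below. -/
lemma eventually_contDiffAt {g : P × V → W} {q : P × V} (hg : ContDiffAt ℝ ∞ g q) :
    ∀ᶠ z in 𝓝 q, ContDiffAt ℝ 2 g z :=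
  (hg.of_le (by exact ENat.LEInfty.out)).eventually (by simp)

/-- Partial derivatives in a parameter and in space commute. -/
lemma fderiv_fderiv_mk_comm {g : P × V → ℝ} {p : P} {y : V} (hg : ContDiffAt ℝ ∞ g (p, y))
    (e : P) (v : V) :
    fderiv ℝ (fun p => fderiv ℝ (fun y => g (p, y)) y v) p e =
      fderiv ℝ (fun y => fderiv ℝ (fun p => g (p, y)) p e) y v := by
  have hev : ∀ᶠ z in 𝓝 (p, y), DifferentiableAt ℝ g z :=
    (eventually_contDiffAt hg).mono fun z hz => hz.differentiableAt (by simp)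
  have hd : ∀ w, DifferentiableAt ℝ (fun z => fderiv ℝ g z w) (p, y) := fun w =>
    ((hg.fderiv_right (m := 1) (by norm_num; exact ENat.LEInfty.out)).differentiableAt
      (by simp)).clm_apply (differentiableAt_const w)
  have e1 : (fun p => fderiv ℝ (fun y => g (p, y)) y v) =ᶠ[𝓝 p]
      fun p => fderiv ℝ g (p, y) (0, v) := by
    have : Tendsto (fun p : P => (p, y)) (𝓝 p) (𝓝 (p, y)) :=
      Continuous.tendsto (by fun_prop) p
    filter_upwards [this.eventually hev] with q hq
    exact fderiv_mk_right hq v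
  have e2 : (fun y => fderiv ℝ (fun p => g (p, y)) p e) =ᶠ[𝓝 y]
      fun y => fderiv ℝ g (p, y) (e, 0) := by
    have : Tendsto (fun y : V => (p, y)) (𝓝 y) (𝓝 (p, y)) :=
      Continuous.tendsto (by fun_prop) y
    filter_upwards [this.eventually hev] with q hq
    exact fderiv_mk_left hq e
  rw [e1.fderiv_eq, e2.fderiv_eq, fderiv_mk_left (hd _), fderiv_mk_right (hd _)]
  exact fderiv_fderiv_comm hg _ _

end Partial

/-! ### Smooth dependence of Jacobians on parameters -/

section Jacobian

variable {n : ℕ} {M : Type*} [TopologicalSpace M] [ChartedSpace (EuclideanSpace ℝ (Fin n)) M]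
  [IsManifold (𝓡 n) ∞ M] {P : Type*} [NormedAddCommGroup P] [NormedSpace ℝ P]

lemma contMDiffAt_prodMk_symm {c : M} {p : P} {y : EuclideanSpace ℝ (Fin n)}
    (hy : y ∈ (extChartAt (𝓡 n) c).target) :
    ContMDiffAt 𝓘(ℝ, P × EuclideanSpace ℝ (Fin n)) (𝓘(ℝ, P).prod (𝓡 n)) ∞
      (fun q : P × EuclideanSpace ℝ (Fin n) => (q.1, (extChartAt (𝓡 n) c).symm q.2)) (p, y) := by
  have h1 : ContMDiffAt 𝓘(ℝ, P × EuclideanSpace ℝ (Fin n)) 𝓘(ℝ, P) ∞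
      (fun q : P × EuclideanSpace ℝ (Fin n) => q.1) (p, y) := contDiff_fst.contMDiff.contMDiffAt
  have h2 : ContMDiffAt 𝓘(ℝ, P × EuclideanSpace ℝ (Fin n)) (𝓡 n) ∞
      (fun q : P × EuclideanSpace ℝ (Fin n) => q.2) (p, y) := contDiff_snd.contMDiff.contMDiffAt
  have h3 : ContMDiffAt (𝓡 n) (𝓡 n) ∞ (extChartAt (𝓡 n) c).symm y :=
    (contMDiffOn_extChartAt_symm c).contMDiffAt ((isOpen_extChartAt_target c).mem_nhds hy)
  exact h1.prodMk (h3.comp (p, y) h2)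

lemma contDiffAt_chart_family {Φ : P × M → M} {c c' : M} {p : P} {y : EuclideanSpace ℝ (Fin n)}
    (hy : y ∈ (extChartAt (𝓡 n) c).target)
    (hΦ : ContMDiffAt (𝓘(ℝ, P).prod (𝓡 n)) (𝓡 n) ∞ Φ (p, (extChartAt (𝓡 n) c).symm y))
    (hc' : Φ (p, (extChartAt (𝓡 n) c).symm y) ∈ (extChartAt (𝓡 n) c').source) :
    ContDiffAt ℝ ∞ (fun q : P × EuclideanSpace ℝ (Fin n) =>
      extChartAt (𝓡 n) c' (Φ (q.1, (extChartAt (𝓡 n) c).symm q.2))) (p, y) :=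
  ((contMDiffAt_extChartAt' (by simpa using hc')).comp (p, y)
    (hΦ.comp (p, y) (contMDiffAt_prodMk_symm hy))).contDiffAt

lemma contDiffAt_det {F : Type*} [NormedAddCommGroup F] [NormedSpace ℝ F]
    {A : F → EuclideanSpace ℝ (Fin n) →L[ℝ] EuclideanSpace ℝ (Fin n)} {x : F}
    (hA : ContDiffAt ℝ ∞ A x) : ContDiffAt ℝ ∞ (fun x => (A x).det) x := by
  simp_rw [det_eq_matrix_det, Matrix.det_apply', Matrix.of_apply]
  refine ContDiffAt.sum fun σ _ => contDiffAt_const.mul (contDiffAt_prod fun i _ => ?_)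
  exact (EuclideanSpace.proj (𝕜 := ℝ) (σ i)).contDiff.contDiffAt.comp x
    (hA.clm_apply contDiffAt_const)

/-- The coefficient of a pulled back form in terms of the coordinate expression of the map. -/
lemma chartCoeff_pullback {φ : M → M} {c c' : M} {y : EuclideanSpace ℝ (Fin n)}
    (hy : y ∈ (extChartAt (𝓡 n) c).target)
    (hφ : MDifferentiableAt (𝓡 n) (𝓡 n) φ ((extChartAt (𝓡 n) c).symm y))
    (hc' : φ ((extChartAt (𝓡 n) c).symm y) ∈ (extChartAt (𝓡 n) c').source) (η : FormField n M) :
    chartCoeff c (pullback φ η) y =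
      (fderiv ℝ (fun y => extChartAt (𝓡 n) c' (φ ((extChartAt (𝓡 n) c).symm y))) y).det *
      chartCoeff c' η (extChartAt (𝓡 n) c' (φ ((extChartAt (𝓡 n) c).symm y))) := by
  have hs := mdifferentiableAt_extChartAt_symm hy
  rw [chartCoeff_eq_formCoeff, formCoeff_pullback hs hφ]
  exact formCoeff_eq_det_mul (hφ.comp y hs) hc' η

/-- The Jacobian of a smooth family of maps depends smoothly on the parameter and the point. -/
lemma contDiffOn_ratio_pullback {μ : FormField n M} (h0 : ∀ x, μ x ≠ 0)
    (hμ : μ ∈ smoothForms n M) {Φ : P × M → M}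
    (hΦ : ContMDiff (𝓘(ℝ, P).prod (𝓡 n)) (𝓡 n) ∞ Φ) (c : M) :
    ContDiffOn ℝ ∞ (fun q : P × EuclideanSpace ℝ (Fin n) =>
      ratio (pullback (fun x => Φ (q.1, x)) μ) μ ((extChartAt (𝓡 n) c).symm q.2))
      (univ ×ˢ (extChartAt (𝓡 n) c).target) := by
  rintro ⟨p, y⟩ ⟨-, hy⟩
  refine ContDiffAt.contDiffWithinAt ?_
  simp only at hy
  -- The target chart is centred at the image point; by continuity it contains the images of all
  -- nearby points for nearby parameters.
  set c' := Φ (p, (extChartAt (𝓡 n) c).symm y) with hc'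
  set f : P × EuclideanSpace ℝ (Fin n) → EuclideanSpace ℝ (Fin n) := fun q =>
    extChartAt (𝓡 n) c' (Φ (q.1, (extChartAt (𝓡 n) c).symm q.2)) with hf
  have hsrc : c' ∈ (extChartAt (𝓡 n) c').source := mem_extChartAt_source c'
  have hfc : ContDiffAt ℝ ∞ f (p, y) := contDiffAt_chart_family hy hΦ.contMDiffAt hsrc
  have hcont : ContinuousAt (fun q : P × EuclideanSpace ℝ (Fin n) =>
      Φ (q.1, (extChartAt (𝓡 n) c).symm q.2)) (p, y) :=
    (hΦ.contMDiffAt.comp (p, y) (contMDiffAt_prodMk_symm hy)).continuousAt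
  -- Composing the total derivative with `inr` gives the derivative in the space variable.
  -- Smoothness jointly in parameter and point is thus inherited from the total derivative.
  have h1 : ContDiffAt ℝ ∞ (fun q => ((fderiv ℝ f q).comp
      (ContinuousLinearMap.inr ℝ P (EuclideanSpace ℝ (Fin n)))).det) (p, y) :=
    contDiffAt_det ((hfc.fderiv_right (by simp)).clm_comp contDiffAt_const)
  have h2 : ContDiffAt ℝ ∞ (fun q => chartCoeff c' μ (f q)) (p, y) :=
    ContDiffAt.comp (g := chartCoeff c' μ) (p, y) ((contDiffOn_chartCoeff hμ c').contDiffAt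
      ((isOpen_extChartAt_target c').mem_nhds ((extChartAt (𝓡 n) c').map_source hsrc))) hfc
  have h3 : ContDiffAt ℝ ∞ (fun q : P × EuclideanSpace ℝ (Fin n) => chartCoeff c μ q.2) (p, y) :=
    ((contDiffOn_chartCoeff hμ c).contDiffAt ((isOpen_extChartAt_target c).mem_nhds hy)).comp
      (p, y) contDiffAt_snd
  refine ((h1.mul h2).div h3 (chartCoeff_ne_zero h0 hy)).congr_of_eventuallyEq ?_
  have e1 : ∀ᶠ q : P × EuclideanSpace ℝ (Fin n) in 𝓝 (p, y),
      q.2 ∈ (extChartAt (𝓡 n) c).target :=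
    continuous_snd.continuousAt.eventually ((isOpen_extChartAt_target c).mem_nhds hy)
  filter_upwards [e1, hcont.eventually ((isOpen_extChartAt_source c').mem_nhds hsrc),
    eventually_contDiffAt hfc] with q hq hq2 hq3
  have hφ : MDifferentiableAt (𝓡 n) (𝓡 n) (fun x => Φ (q.1, x))
      ((extChartAt (𝓡 n) c).symm q.2) :=
    ((hΦ.comp (contMDiff_const.prodMk contMDiff_id)).mdifferentiableAt (by simp))
  rw [ratio_eq_chartCoeff h0 _ hq, chartCoeff_pullback hq hφ hq2]
  have := hasFDerivAt_comp_mk_right (g := f) (p := q.1) (y := q.2) (hq3.differentiableAt (by simp))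
  have e : fderiv ℝ (fun y => extChartAt (𝓡 n) c' (Φ (q.1, (extChartAt (𝓡 n) c).symm y))) q.2 =
    _ := this.fderiv
  rw [e]
  rfl

end Jacobian

/-! ### Mixed derivatives of integrals of triangular families -/

section MixedDerivative

variable {n : ℕ} {M : Type*} [TopologicalSpace M] [ChartedSpace (EuclideanSpace ℝ (Fin n)) M]
  [IsManifold (𝓡 n) ∞ M] [T2Space M] [CompactSpace M]

variable (n M) in
/-- The charts whose member of the partition of unity is not zero. -/
def activeCharts : Finset M :=
  ((partition n M).locallyFinite.finite_nonempty_of_compact).toFinset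

lemma VolumeForm.integral_eq_sum (ν : VolumeForm n M) (η : FormField n M) :
    ν.integral η = ∑ c ∈ activeCharts n M,
      ∫ y in (extChartAt (𝓡 n) c).target, chartIntegrand ν c η y := by
  refine finsum_eq_sum_of_support_subset _ fun c hc => ?_
  simp only [activeCharts, Finite.coe_toFinset, mem_ofPred_eq]
  by_contra hne
  rw [Set.not_nonempty_iff_eq_empty, Function.support_eq_empty_iff] at hne
  exact hc (by simp [chartIntegrand, hne])

/-- The dependence of a family of functions on the variables of index at most `i`. -/
structure IsTriangularFamily (G : Fin (n + 1) → (Fin (n + 1) → ℝ) → M → ℝ) : Prop where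
  smooth : ∀ i c, ContDiffOn ℝ ∞ (fun q : (Fin (n + 1) → ℝ) × EuclideanSpace ℝ (Fin n) =>
    G i q.1 ((extChartAt (𝓡 n) c).symm q.2)) (univ ×ˢ (extChartAt (𝓡 n) c).target)
  congr : ∀ i t t', (∀ j ≤ i, t j = t' j) → G i t = G i t'
  zero : ∀ i x, G i 0 x = 0

namespace IsTriangularFamily

variable {G : Fin (n + 1) → (Fin (n + 1) → ℝ) → M → ℝ} (hG : IsTriangularFamily G)

include hG

omit [IsManifold (𝓡 n) ∞ M] [T2Space M] [CompactSpace M] in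
lemma contDiffAt (i : Fin (n + 1)) {c : M} (t : Fin (n + 1) → ℝ) {y : EuclideanSpace ℝ (Fin n)}
    (hy : y ∈ (extChartAt (𝓡 n) c).target) :
    ContDiffAt ℝ ∞ (fun q : (Fin (n + 1) → ℝ) × EuclideanSpace ℝ (Fin n) =>
      G i q.1 ((extChartAt (𝓡 n) c).symm q.2)) (t, y) :=
  (hG.smooth i c).contDiffAt ((isOpen_univ.prod (isOpen_extChartAt_target c)).mem_nhds
    ⟨mem_univ _, hy⟩)

omit [T2Space M] [CompactSpace M] in
lemma contMDiff (i : Fin (n + 1)) (t : Fin (n + 1) → ℝ) :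
    ContMDiff (𝓡 n) 𝓘(ℝ, ℝ) ∞ (G i t) :=
  contMDiff_iff_charts.2 fun c y hy => (ContDiffAt.comp y (hG.contDiffAt i t hy)
    (f := fun y => (t, y)) (by fun_prop)).contDiffWithinAt

omit [IsManifold (𝓡 n) ∞ M] [T2Space M] [CompactSpace M] in
lemma contDiff_left (i : Fin (n + 1)) {c : M} {y : EuclideanSpace ℝ (Fin n)}
    (hy : y ∈ (extChartAt (𝓡 n) c).target) :
    ContDiff ℝ ∞ fun t => G i t ((extChartAt (𝓡 n) c).symm y) :=
  contDiff_iff_contDiffAt.2 fun t => ContDiffAt.comp t (hG.contDiffAt i t hy)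
    (f := fun t => (t, y)) (by fun_prop)

omit [IsManifold (𝓡 n) ∞ M] [T2Space M] [CompactSpace M] in
lemma contDiffOn_grad (i : Fin (n + 1)) (c : M) (v : EuclideanSpace ℝ (Fin n)) :
    ContDiffOn ℝ ∞ (fun q : (Fin (n + 1) → ℝ) × EuclideanSpace ℝ (Fin n) =>
      fderiv ℝ (G i q.1 ∘ (extChartAt (𝓡 n) c).symm) q.2 v)
      (univ ×ˢ (extChartAt (𝓡 n) c).target) := by
  have hU := (isOpen_univ (X := Fin (n + 1) → ℝ)).prod (isOpen_extChartAt_target (I := 𝓡 n) c)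
  refine (((hG.smooth i c).fderiv_of_isOpen hU (by simp)).clm_apply
    (contDiffOn_const (c := ((0 : Fin (n + 1) → ℝ), v)))).congr fun q hq => ?_
  exact fderiv_mk_right (g := fun q : (Fin (n + 1) → ℝ) × EuclideanSpace ℝ (Fin n) =>
    G i q.1 ((extChartAt (𝓡 n) c).symm q.2))
    ((hG.contDiffAt i q.1 hq.2).differentiableAt (by simp)) v

omit [IsManifold (𝓡 n) ∞ M] [T2Space M] [CompactSpace M] in
lemma contDiff_grad_left (i : Fin (n + 1)) {c : M} {y : EuclideanSpace ℝ (Fin n)}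
    (hy : y ∈ (extChartAt (𝓡 n) c).target) (v : EuclideanSpace ℝ (Fin n)) :
    ContDiff ℝ ∞ fun t => fderiv ℝ (G i t ∘ (extChartAt (𝓡 n) c).symm) y v :=
  contDiff_iff_contDiffAt.2 fun t => ContDiffAt.comp t
    ((hG.contDiffOn_grad i c v).contDiffAt
      ((isOpen_univ.prod (isOpen_extChartAt_target c)).mem_nhds ⟨mem_univ _, hy⟩))
    (f := fun t => (t, y)) (by fun_prop)

omit hG [TopologicalSpace M] [ChartedSpace (EuclideanSpace ℝ (Fin n)) M]
  [IsManifold (𝓡 n) ∞ M] [T2Space M] [CompactSpace M] in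
-- Along the `j`-th axis the coordinates of index at most `i` stay fixed, hence so does `p`.
lemma fderiv_single_eq_zero {p : (Fin (n + 1) → ℝ) → ℝ} {i j : Fin (n + 1)} (hij : i < j)
    (hp : Differentiable ℝ p) (h : ∀ t t', (∀ k ≤ i, t k = t' k) → p t = p t')
    (t : Fin (n + 1) → ℝ) : fderiv ℝ p t (Pi.single j 1) = 0 := by
  have h1 : HasDerivAt (fun s : ℝ => p (t + s • Pi.single j 1)) (fderiv ℝ p t (Pi.single j 1)) 0 :=
    (hp t).hasFDerivAt.hasLineDerivAt _
  have h2 : (fun s : ℝ => p (t + s • Pi.single j 1)) = fun _ => p t := by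
    funext s
    refine h _ _ fun k hk => ?_
    have : k ≠ j := (lt_of_le_of_lt hk hij).ne
    simp [this]
  rw [h2] at h1
  exact h1.unique (hasDerivAt_const _ _)

omit [IsManifold (𝓡 n) ∞ M] [T2Space M] [CompactSpace M] in
lemma fderiv_single_self {b : Fin (n + 1) → M → ℝ}
    (hb : ∀ i x, HasDerivAt (fun s => G i (Pi.single i s) x) (b i x) 0) (i : Fin (n + 1))
    {c : M} {y : EuclideanSpace ℝ (Fin n)} (hy : y ∈ (extChartAt (𝓡 n) c).target) :
    fderiv ℝ (fun t => G i t ((extChartAt (𝓡 n) c).symm y)) 0 (Pi.single i 1) =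
      b i ((extChartAt (𝓡 n) c).symm y) := by
  have h1 := ((hG.contDiff_left i hy).differentiable (by simp) 0).hasFDerivAt.hasLineDerivAt
    (Pi.single i 1)
  have h2 : HasDerivAt _ _ (0 : ℝ) := h1
  refine h2.unique ((hb i _).congr_of_eventuallyEq (Eventually.of_forall fun s => ?_))
  simp only [zero_add]
  rw [← Pi.single_smul', smul_eq_mul, mul_one]

/-- The integrand in a chart, extended by zero. -/
lemma contDiff_integrand (ν : VolumeForm n M) (c : M) :
    ContDiff ℝ ∞ (fun q : (Fin (n + 1) → ℝ) × EuclideanSpace ℝ (Fin n) =>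
      (extChartAt (𝓡 n) c).target.indicator
        (chartIntegrand ν c (wedgeForm fun i => G i q.1)) q.2) := by
  have hU := isOpen_extChartAt_target (I := 𝓡 n) c
  have hs : tsupport (partition n M c) ⊆ (extChartAt (𝓡 n) c).source := by
    rw [extChartAt_source]; exact partition_subordinate c
  have hK := isCompact_image_tsupport hs
  have h := contDiff_indicator (u := fun q : (Fin (n + 1) → ℝ) × EuclideanSpace ℝ (Fin n) =>
    Real.sign (chartCoeff c ν.toForm q.2) * (partition n M c ((extChartAt (𝓡 n) c).symm q.2) *
      (G 0 q.1 ((extChartAt (𝓡 n) c).symm q.2) * Matrix.det (Matrix.of fun i j : Fin n =>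
        fderiv ℝ (G i.succ q.1 ∘ (extChartAt (𝓡 n) c).symm) q.2 (EuclideanSpace.single j 1)))))
    (isOpen_univ.prod hU) (isClosed_univ.prod hK.isClosed)
    (prod_mono_right (image_tsupport_subset hs)) ?_ ?_
  · convert! h using 1
    funext q
    by_cases hq : q.2 ∈ (extChartAt (𝓡 n) c).target
    · rw [indicator_of_mem hq, indicator_of_mem (show q ∈ univ ×ˢ _ from ⟨mem_univ _, hq⟩),
        chartIntegrand, chartCoeff_wedgeForm (fun i => hG.contMDiff i q.1) hq]
    · rw [indicator_of_notMem hq, indicator_of_notMem fun h => hq h.2]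
  · refine ContDiffOn.mul ?_ (ContDiffOn.mul ?_ (ContDiffOn.mul (hG.smooth 0 c)
      (contDiffOn_matrix_det fun i j => hG.contDiffOn_grad _ _ _)))
    · exact (contDiffOn_sign hU (contDiffOn_chartCoeff ν.smooth c).continuousOn
        fun y hy => chartCoeff_ne_zero ν.ne_zero hy).comp contDiff_snd.contDiffOn fun q hq => hq.2
    · exact (contMDiff_iff_charts.1 (partition n M c).contMDiff c).comp contDiff_snd.contDiffOn
        fun q hq => hq.2
  · intro q hq hqK
    rw [comp_symm_eq_zero hq.2 fun h => hqK ⟨mem_univ _, h⟩, zero_mul, mul_zero]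

omit hG in
lemma integrand_eq_zero (ν : VolumeForm n M) (c : M) (η : FormField n M)
    {y : EuclideanSpace ℝ (Fin n)}
    (hy : y ∉ extChartAt (𝓡 n) c '' tsupport (partition n M c)) :
    (extChartAt (𝓡 n) c).target.indicator (chartIntegrand ν c η) y = 0 := by
  by_cases hyt : y ∈ (extChartAt (𝓡 n) c).target
  · rw [indicator_of_mem hyt, chartIntegrand, comp_symm_eq_zero hyt hy, zero_mul, mul_zero]
  · rw [indicator_of_notMem hyt]

omit hG in
lemma integral_eq_sum_indicator (ν : VolumeForm n M) :
    (fun t => ν.integral (wedgeForm fun i => G i t)) = fun t => ∑ c ∈ activeCharts n M,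
      ∫ y, (1 : ℝ) * (extChartAt (𝓡 n) c).target.indicator
        (chartIntegrand ν c (wedgeForm fun i => G i t)) y := by
  funext t
  rw [ν.integral_eq_sum]
  refine Finset.sum_congr rfl fun c _ => ?_
  simp_rw [one_mul]
  rw [integral_indicator (isOpen_extChartAt_target c).measurableSet]

lemma contDiff_summand (ν : VolumeForm n M) (c : M) :
    ContDiff ℝ ∞ fun t => ∫ y, (1 : ℝ) * (extChartAt (𝓡 n) c).target.indicator
        (chartIntegrand ν c (wedgeForm fun i => G i t)) y := by
  have hs : tsupport (partition n M c) ⊆ (extChartAt (𝓡 n) c).source := by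
    rw [extChartAt_source]; exact partition_subordinate c
  exact contDiffOn_univ.1 (contDiffOn_integral_param (m := volume) (locallyIntegrable_const (1 : ℝ))
    isOpen_univ (isCompact_image_tsupport hs) (fun t _ y hy => integrand_eq_zero ν c _ hy)
    (hG.contDiff_integrand ν c).contDiffOn)

lemma contDiff_integral (ν : VolumeForm n M) :
    ContDiff ℝ ∞ fun t => ν.integral (wedgeForm fun i => G i t) := by
  rw [integral_eq_sum_indicator]
  exact ContDiff.sum fun c _ => hG.contDiff_summand ν c

/-- The determinant is expanded into products of `n + 1` factors, each zero at the origin and each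
independent of the later times. `iteratedFDeriv_prod_mul` then leaves the product of the first
derivatives, and these reassemble into the determinant for `b`. -/
lemma iteratedFDeriv_integrand (ν : VolumeForm n M) {b : Fin (n + 1) → M → ℝ}
    (hb : ∀ i x, HasDerivAt (fun s => G i (Pi.single i s) x) (b i x) 0)
    (hbs : ∀ i, ContMDiff (𝓡 n) 𝓘(ℝ, ℝ) ∞ (b i)) {c : M} {y : EuclideanSpace ℝ (Fin n)}
    (hy : y ∈ (extChartAt (𝓡 n) c).target) :
    iteratedFDeriv ℝ (n + 1) (fun t => chartIntegrand ν c (wedgeForm fun i => G i t) y) 0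
      (fun i => Pi.single i (1 : ℝ)) = chartIntegrand ν c (wedgeForm b) y := by
  set κ : ℝ := Real.sign (chartCoeff c ν.toForm y) *
    partition n M c ((extChartAt (𝓡 n) c).symm y) with hκ
  -- The factors attached to `σ`: index zero is the undifferentiated function, index `i + 1` the
  -- partial derivative of `G i.succ` in direction `σ i`.
  set p : Equiv.Perm (Fin n) → Fin (n + 1) → (Fin (n + 1) → ℝ) → ℝ := fun σ =>
    Fin.cons (fun t => G 0 t ((extChartAt (𝓡 n) c).symm y)) fun i t =>
      fderiv ℝ (G i.succ t ∘ (extChartAt (𝓡 n) c).symm) y (EuclideanSpace.single (σ i) 1) with hp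
  have e1 : (fun t => chartIntegrand ν c (wedgeForm fun i => G i t) y) = fun t =>
      ∑ σ : Equiv.Perm (Fin n), (∏ i, p σ i t) * (((Equiv.Perm.sign σ : ℤ) : ℝ) * κ) := by
    funext t
    rw [chartIntegrand, chartCoeff_wedgeForm (fun i => hG.contMDiff i t) hy,
      ← Matrix.det_transpose, Matrix.det_apply', Finset.mul_sum, Finset.mul_sum, Finset.mul_sum]
    refine Finset.sum_congr rfl fun σ _ => ?_
    rw [Fin.prod_univ_succ]
    simp only [hp, Fin.cons_zero, Fin.cons_succ, Matrix.transpose_apply, Matrix.of_apply, hκ]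
    ring
  have hps : ∀ σ i, ContDiff ℝ ∞ (p σ i) := by
    intro σ i
    cases i using Fin.cases with
    | zero => exact hG.contDiff_left 0 hy
    | succ k => exact hG.contDiff_grad_left _ hy _
  have hpc : ∀ σ i t t', (∀ k ≤ i, t k = t' k) → p σ i t = p σ i t' := by
    intro σ i t t' h
    cases i using Fin.cases with
    | zero => simp only [hp, Fin.cons_zero, hG.congr 0 t t' h]
    | succ k => simp only [hp, Fin.cons_succ, hG.congr k.succ t t' h]
  have hp0 : ∀ σ i, p σ i 0 = 0 := by
    intro σ i
    cases i using Fin.cases with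
    | zero => exact hG.zero _ _
    | succ k =>
      simp only [hp, Fin.cons_succ]
      rw [show G k.succ 0 ∘ (extChartAt (𝓡 n) c).symm = fun _ => 0 from
        funext fun z => hG.zero _ _]
      simp
  have hpd : ∀ σ (k : Fin n), fderiv ℝ (p σ k.succ) 0 (Pi.single k.succ 1) =
      fderiv ℝ (b k.succ ∘ (extChartAt (𝓡 n) c).symm) y (EuclideanSpace.single (σ k) 1) := by
    intro σ k
    -- The time derivative is exchanged with the space derivative, after which it can be read off
    -- from `hb` near `y`.
    refine (fderiv_fderiv_mk_comm (hG.contDiffAt k.succ 0 hy) (Pi.single k.succ 1)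
      (EuclideanSpace.single (σ k) 1)).trans ?_
    refine congrArg (fun L : EuclideanSpace ℝ (Fin n) →L[ℝ] ℝ =>
      L (EuclideanSpace.single (σ k) 1)) (Filter.EventuallyEq.fderiv_eq ?_)
    filter_upwards [(isOpen_extChartAt_target c).mem_nhds hy] with z hz
    exact hG.fderiv_single_self hb k.succ hz
  rw [e1, iteratedFDeriv_fun_sum_apply fun σ _ =>
    (((contDiff_prod fun i _ => hps σ i).mul contDiff_const).of_le
      ENat.LEInfty.out).contDiffAt, sum_apply]
  rw [chartIntegrand, chartCoeff_wedgeForm hbs hy,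
      ← Matrix.det_transpose, Matrix.det_apply', Finset.mul_sum, Finset.mul_sum, Finset.mul_sum]
  refine Finset.sum_congr rfl fun σ _ => ?_
  rw [iteratedFDeriv_prod_mul (hps σ) (hp0 σ) (fun i j hij t => fderiv_single_eq_zero hij
    ((hps σ i).differentiable (by simp)) (hpc σ i) t) contDiff_const, Fin.prod_univ_succ]
  simp_rw [hpd]
  rw [show fderiv ℝ (p σ 0) 0 (Pi.single 0 1) = b 0 ((extChartAt (𝓡 n) c).symm y) from
    hG.fderiv_single_self hb 0 hy]
  simp only [Matrix.transpose_apply, Matrix.of_apply, hκ]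
  ring

/-- The mixed derivative at the origin of `∫ G₀ dG₁ ∧ ⋯ ∧ dGₙ`. -/
theorem iteratedFDeriv_integral (ν : VolumeForm n M) {b : Fin (n + 1) → M → ℝ}
    (hb : ∀ i x, HasDerivAt (fun s => G i (Pi.single i s) x) (b i x) 0)
    (hbs : ∀ i, ContMDiff (𝓡 n) 𝓘(ℝ, ℝ) ∞ (b i)) :
    iteratedFDeriv ℝ (n + 1) (fun t => ν.integral (wedgeForm fun i => G i t)) 0
      (fun i => Pi.single i (1 : ℝ)) = ν.integral (wedgeForm b) := by
  rw [integral_eq_sum_indicator, iteratedFDeriv_fun_sum_apply fun c _ =>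
    ((hG.contDiff_summand ν c).of_le ENat.LEInfty.out).contDiffAt,
    sum_apply, ν.integral_eq_sum]
  refine Finset.sum_congr rfl fun c _ => ?_
  have hs : tsupport (partition n M c) ⊆ (extChartAt (𝓡 n) c).source := by
    rw [extChartAt_source]; exact partition_subordinate c
  rw [iteratedFDeriv_integral_param (m := volume) (locallyIntegrable_const (1 : ℝ))
    (isCompact_image_tsupport hs) (n + 1) (fun t y hy => integrand_eq_zero ν c _ hy)
    (hG.contDiff_integrand ν c), ← integral_indicator (isOpen_extChartAt_target c).measurableSet]
  congr 1
  funext y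
  rw [one_mul]
  by_cases hy : y ∈ (extChartAt (𝓡 n) c).target
  · simp only [indicator_of_mem hy]
    exact hG.iteratedFDeriv_integrand ν hb hbs hy
  · simp only [indicator_of_notMem hy]
    simp

end IsTriangularFamily

end MixedDerivative

/-! ### Partial products of maps -/

section Products

variable {X : Type*} {k : ℕ}

/-- The composition of the maps with indices in a list, the first one being applied last. -/
def listComp (φ : Fin k → X → X) (L : List (Fin k)) : X → X :=
  (L.map φ).foldr (fun f g => f ∘ g) id

lemma listComp_cons (φ : Fin k → X → X) (j : Fin k) (L : List (Fin k)) :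
    listComp φ (j :: L) = φ j ∘ listComp φ L := rfl

lemma partialProduct_eq_listComp (φ : Fin k → X → X) (i : Fin k) :
    partialProduct φ i = listComp φ ((List.finRange k).take (i + 1)) := by
  rw [partialProduct, listComp, List.ofFn_eq_map, List.map_take]

lemma partialProductRev_eq_listComp (φ : Fin k → X → X) (i : Fin k) :
    partialProductRev φ i = listComp φ ((List.finRange k).take (i + 1)).reverse := by
  rw [partialProductRev, listComp, List.map_reverse, List.foldr_reverse, List.ofFn_eq_map,
    List.map_take]

lemma listComp_congr {φ ψ : Fin k → X → X} {L : List (Fin k)} (h : ∀ j ∈ L, φ j = ψ j) :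
    listComp φ L = listComp ψ L := by
  rw [listComp, listComp, List.map_congr_left h]

lemma listComp_eq_id {φ : Fin k → X → X} {L : List (Fin k)} (h : ∀ j ∈ L, φ j = id) :
    listComp φ L = id := by
  induction L with
  | nil => rfl
  | cons j L ih =>
    rw [listComp_cons, h j (by simp), ih fun l hl => h l (by simp [hl])]
    rfl

/-- Without repetitions, the only factor that is not the identity occurs exactly once. This
identifies the restriction of a partial product to one time axis. -/
lemma listComp_eq_single {φ : Fin k → X → X} {i : Fin k} {L : List (Fin k)} (hL : L.Nodup)
    (hi : i ∈ L) (h : ∀ j ∈ L, j ≠ i → φ j = id) : listComp φ L = φ i := by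
  induction L with
  | nil => simp at hi
  | cons j L ih =>
    rw [List.nodup_cons] at hL
    rw [listComp_cons]
    by_cases hj : j = i
    · subst hj
      rw [listComp_eq_id fun l hl => h l (by simp [hl]) fun hlj => hL.1 (hlj ▸ hl)]
      rfl
    · rw [h j (by simp) hj, ih hL.2 (by simpa [Ne.symm hj] using hi)
        fun l hl hli => h l (by simp [hl]) hli]
      rfl

/-- A list without repetitions, of indices up to `i`, that contains `i`. -/
structure IsInitialList (i : Fin k) (L : List (Fin k)) : Prop where
  nodup : L.Nodup
  mem : i ∈ L
  le : ∀ j ∈ L, j ≤ i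

/-- Indices start at zero, so taking `i + 1` entries includes `i` itself. -/
lemma isInitialList_take (i : Fin k) : IsInitialList i ((List.finRange k).take (i + 1)) := by
  refine ⟨(List.nodup_finRange k).sublist (List.take_sublist _ _), ?_, ?_⟩
  · rw [List.mem_take_iff_getElem]
    exact ⟨i, by simp, by simp⟩
  · intro j hj
    rw [List.mem_take_iff_getElem] at hj
    obtain ⟨l, hl, rfl⟩ := hj
    rw [Fin.le_def]
    simp at hl ⊢
    omega

lemma IsInitialList.reverse {i : Fin k} {L : List (Fin k)} (h : IsInitialList i L) :
    IsInitialList i L.reverse :=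
  ⟨List.nodup_reverse.2 h.nodup, by simpa using h.mem, fun j hj => h.le j (by simpa using hj)⟩

end Products

/-! ### The mixed derivative of the Bott–Thurston cochain -/

section BottThurstonCocycle

variable {n : ℕ} {M : Type*} [TopologicalSpace M] [ChartedSpace (EuclideanSpace ℝ (Fin n)) M]
  [IsManifold (𝓡 n) ∞ M] [T2Space M] [CompactSpace M]

lemma ne_zero_of_mem_Prob {ν : VolumeForm n M} {μ : FormField n M} (hμ : μ ∈ Prob ν) (x : M) :
    μ x ≠ 0 := by
  intro h
  have := hμ.2.1 x
  rw [ratio, h] at this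
  simp at this

lemma mdifferentiable_diff {ν : VolumeForm n M} (φ : Diff ν) :
    MDifferentiable (𝓡 n) (𝓡 n) φ.1 := φ.1.contMDiff.mdifferentiable (by simp)

omit [T2Space M] [CompactSpace M] in
-- Both sides compute `φ^*μ / ν`: one divides first by `μ`, the other first writes `μ` as a multiple
-- of `ν`. It transfers the positivity of Jacobians from the orienting form to `μ`.
lemma ratio_pullback_change {μ ν : FormField n M} (hμ : ∀ x, μ x ≠ 0) (hν : ∀ x, ν x ≠ 0)
    (φ : M → M) (x : M) :
    ratio (pullback φ μ) μ x * ratio μ ν x =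
      ratio μ ν (φ x) * ratio (pullback φ ν) ν x := by
  have h1 : pullback φ μ x (stdBasis x) = ratio μ ν (φ x) * pullback φ ν x (stdBasis x) :=
    ratio_mul (hν (φ x)) μ _
  have h2 := ratio_mul (hμ x) (pullback φ μ) (stdBasis x)
  have h3 := ratio_mul (hν x) (pullback φ ν) (stdBasis x)
  have h4 := ratio_mul (hν x) μ (stdBasis x)
  have h5 := form_stdBasis_ne_zero (hν x)
  apply mul_right_cancel₀ h5
  calc _ = ratio (pullback φ μ) μ x * (ratio μ ν x * ν x (stdBasis x)) := by ring
    _ = pullback φ μ x (stdBasis x) := by rw [← h4, ← h2]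
    _ = _ := by rw [h1, h3]; ring

lemma ratio_pullback_pos {ν : VolumeForm n M} {μ : FormField n M} (hμ : μ ∈ Prob ν) (φ : Diff ν)
    (x : M) : 0 < ratio (pullback φ.1 μ) μ x := by
  have h := ratio_pullback_change (ne_zero_of_mem_Prob hμ) ν.ne_zero φ.1 x
  have h2 : 0 < ratio μ ν.toForm (φ.1 x) * ratio (pullback φ.1 ν.toForm) ν.toForm x :=
    mul_pos (hμ.2.1 _) (φ.2 x)
  rw [← h] at h2
  exact (pos_iff_pos_of_mul_pos h2).2 (hμ.2.1 x)

lemma mdifferentiable_listComp {ν : VolumeForm n M} {k : ℕ} (φ : Fin k → Diff ν)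
    (L : List (Fin k)) : MDifferentiable (𝓡 n) (𝓡 n) (listComp (fun j => ⇑(φ j).1) L) := by
  induction L with
  | nil => exact mdifferentiable_id
  | cons j L ih => exact (mdifferentiable_diff (φ j)).comp ih

/-- Jacobians of products are products of positive Jacobians, so the logarithms in the cochain are
taken where the logarithm is smooth. -/
lemma ratio_pullback_listComp_pos {ν : VolumeForm n M} {μ : FormField n M} (hμ : μ ∈ Prob ν)
    {k : ℕ} (φ : Fin k → Diff ν) (L : List (Fin k)) (x : M) :
    0 < ratio (pullback (listComp (fun j => ⇑(φ j).1) L) μ) μ x := by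
  induction L with
  | nil =>
    rw [show listComp (fun j => ⇑(φ j).1) [] = id from rfl,
      ratio_eq_of_smul (ne_zero_of_mem_Prob hμ x) (r := 1) (by rw [pullback_id, one_smul])]
    exact one_pos
  | cons j L ih =>
    rw [listComp_cons, ratio_pullback_comp (ne_zero_of_mem_Prob hμ)
      (mdifferentiable_listComp φ L x) (mdifferentiable_diff _ _)]
    exact mul_pos (ratio_pullback_pos hμ _ _) ih

lemma DiffCurve.coe_zero {ν : VolumeForm n M} (φ : DiffCurve ν) : ⇑(φ.toFun 0).1 = id :=
  funext φ.map_zero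

lemma contMDiff_listComp {ν : VolumeForm n M} {k : ℕ} (φ : Fin k → DiffCurve ν)
    (L : List (Fin k)) :
    ContMDiff (𝓘(ℝ, Fin k → ℝ).prod (𝓡 n)) (𝓡 n) ∞ fun q : (Fin k → ℝ) × M =>
      listComp (fun j => ⇑((φ j).toFun (q.1 j)).1) L q.2 := by
  induction L with
  | nil => exact contMDiff_snd
  | cons j L ih =>
    have h : ContMDiff (𝓘(ℝ, Fin k → ℝ).prod (𝓡 n)) 𝓘(ℝ, ℝ) ∞
        fun q : (Fin k → ℝ) × M => q.1 j :=
      (contDiff_apply ℝ ℝ j).contMDiff.comp contMDiff_fst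
    exact (φ j).smooth.comp (h.prodMk ih)

lemma ratio_pullback_zero {ν : VolumeForm n M} {μ : FormField n M} (h0 : ∀ x, μ x ≠ 0)
    (φ : DiffCurve ν) (x : M) : ratio (pullback (φ.toFun 0).1 μ) μ x = 1 := by
  rw [φ.coe_zero, ratio_eq_of_smul (h0 x) (r := 1) (by rw [pullback_id, one_smul])]

lemma IsTangent.hasDerivAt_ratio {ν : VolumeForm n M} {μ : FormField n M} {φ : DiffCurve ν}
    {a : FormField n M} (h : IsTangent μ φ a) (x : M) :
    HasDerivAt (fun t => ratio (pullback (φ.toFun t).1 μ) μ x) (ratio a μ x) 0 :=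
  (h x (stdBasis x)).div_const _

lemma IsTangent.of_hasDerivAt_ratio {ν : VolumeForm n M} {μ : FormField n M}
    (h0 : ∀ x, μ x ≠ 0) {φ : DiffCurve ν} {a : FormField n M}
    (h : ∀ x, HasDerivAt (fun t => ratio (pullback (φ.toFun t).1 μ) μ x) (ratio a μ x) 0) :
    IsTangent μ φ a := fun x v => by
  rw [ratio_mul (h0 x) a]
  refine ((h x).mul_const (μ x v)).congr_of_eventuallyEq (Eventually.of_forall fun t => ?_)
  exact ratio_mul (h0 x) _ v

/-- Triangularity needs only that the `i`-th product involves indices up to `i`; vanishing at the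
origin, only that every curve starts at the identity. The order of composition is irrelevant. -/
lemma isTriangularFamily_logJac {ν : VolumeForm n M} {μ : FormField n M} (hμ : μ ∈ Prob ν)
    (φ : Fin (n + 1) → DiffCurve ν) {L : Fin (n + 1) → List (Fin (n + 1))}
    (hL : ∀ i, IsInitialList i (L i)) :
    IsTriangularFamily fun i (t : Fin (n + 1) → ℝ) =>
      logJac μ (listComp (fun j => ⇑((φ j).toFun (t j)).1) (L i)) where
  smooth i c := by
    refine ContDiffOn.log ?_ fun q _ => (ratio_pullback_listComp_pos hμ _ (L i) _).ne'
    exact contDiffOn_ratio_pullback (ne_zero_of_mem_Prob hμ) hμ.1 (contMDiff_listComp φ (L i)) c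
  congr i t t' h := by
    rw [listComp_congr fun j hj => ?_]
    rw [h j ((hL i).le j hj)]
  zero i x := by
    have e : listComp (fun j => ⇑((φ j).toFun ((0 : Fin (n + 1) → ℝ) j)).1) (L i) = id :=
      listComp_eq_id fun j _ => (φ j).coe_zero
    rw [logJac, e,
      ratio_eq_of_smul (ne_zero_of_mem_Prob hμ x) (r := 1) (by rw [pullback_id, one_smul]),
      Real.log_one]

/-- On the `i`-th time axis the product reduces to `φᵢ`. Its Jacobian is one at time zero, so the
logarithm does not change the derivative. -/
lemma hasDerivAt_logJac_single {ν : VolumeForm n M} {μ : FormField n M} (hμ : μ ∈ Prob ν)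
    (φ : Fin (n + 1) → DiffCurve ν) {L : Fin (n + 1) → List (Fin (n + 1))}
    (hL : ∀ i, IsInitialList i (L i)) {a : Fin (n + 1) → FormField n M}
    (ha : ∀ i, IsTangent μ (φ i) (a i)) (i : Fin (n + 1)) (x : M) :
    HasDerivAt (fun s : ℝ => logJac μ (listComp
      (fun j => ⇑((φ j).toFun ((Pi.single i s : Fin (n + 1) → ℝ) j)).1) (L i)) x)
      (ratio (a i) μ x) 0 := by
  have h1 := ((ha i).hasDerivAt_ratio x).log
    (by rw [ratio_pullback_zero (ne_zero_of_mem_Prob hμ)]; exact one_ne_zero)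
  rw [ratio_pullback_zero (ne_zero_of_mem_Prob hμ), div_one] at h1
  refine h1.congr_of_eventuallyEq (Eventually.of_forall fun s => ?_)
  simp only
  rw [logJac, listComp_eq_single (hL i).nodup (hL i).mem fun j _ hj => ?_, Pi.single_eq_same]
  rw [Pi.single_eq_of_ne hj]
  exact (φ j).coe_zero

/-- The Bott–Thurston cochain, for any order of the factors in the products, is smooth along
curves of diffeomorphisms, and its mixed derivative is the form `omegaForm`. -/
theorem mixed_derivative_listComp {ν : VolumeForm n M} {μ : FormField n M} (hμ : μ ∈ Prob ν)
    (φ : Fin (n + 1) → DiffCurve ν) {L : Fin (n + 1) → List (Fin (n + 1))}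
    (hL : ∀ i, IsInitialList i (L i)) {a : Fin (n + 1) → FormField n M}
    (has : ∀ i, a i ∈ smoothForms n M) (ha : ∀ i, IsTangent μ (φ i) (a i)) :
    ContDiff ℝ ∞ (fun t : Fin (n + 1) → ℝ => ν.integral (wedgeForm fun i =>
      logJac μ (listComp (fun j => ⇑((φ j).toFun (t j)).1) (L i)))) ∧
    iteratedFDeriv ℝ (n + 1) (fun t : Fin (n + 1) → ℝ => ν.integral (wedgeForm fun i =>
      logJac μ (listComp (fun j => ⇑((φ j).toFun (t j)).1) (L i)))) 0
      (fun i => Pi.single i (1 : ℝ)) = omegaForm ν μ a :=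
  ⟨(isTriangularFamily_logJac hμ φ hL).contDiff_integral ν,
    (isTriangularFamily_logJac hμ φ hL).iteratedFDeriv_integral ν
      (hasDerivAt_logJac_single hμ φ hL ha)
      fun i => contMDiff_ratio (ne_zero_of_mem_Prob hμ) hμ.1 (has i)⟩

end BottThurstonCocycle

/-! ### Vector fields and brackets in charts -/

section ChartField

variable {n : ℕ} {M : Type*} [TopologicalSpace M] [ChartedSpace (EuclideanSpace ℝ (Fin n)) M]
  [IsManifold (𝓡 n) ∞ M]

/-- The chart components are the fibre coordinate in the tangent bundle trivialization at `c`, and a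
section is smooth exactly when that coordinate is. -/
lemma contDiffOn_chartField (c : M) (u : Vect n M) :
    ContDiffOn ℝ ∞ (chartField c u) (extChartAt (𝓡 n) c).target := by
  have hb : (trivializationAt (EuclideanSpace ℝ (Fin n)) (TangentSpace (𝓡 n) : M → Type _) c).baseSet =
      (chartAt (EuclideanSpace ℝ (Fin n)) c).source := rfl
  have h := ((Bundle.Trivialization.contMDiffOn_section_baseSet_iff (IB := 𝓡 n) (n := ∞)
    (s := fun x => u x)
    (trivializationAt (EuclideanSpace ℝ (Fin n)) (TangentSpace (𝓡 n) : M → Type _) c)).1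
      u.contMDiff.contMDiffOn)
  rw [hb] at h
  have h2 : ContMDiffOn 𝓘(ℝ, EuclideanSpace ℝ (Fin n)) 𝓘(ℝ, EuclideanSpace ℝ (Fin n)) ∞ _ _ :=
    h.comp (contMDiffOn_extChartAt_symm (I := 𝓡 n) (n := ∞) c) (fun y hy => by
    have := (extChartAt (𝓡 n) c).map_target hy
    rwa [extChartAt_source] at this)
  refine h2.contDiffOn.congr fun y hy => ?_
  have hx := (extChartAt (𝓡 n) c).map_target hy
  rw [extChartAt_source] at hx
  have e := TangentBundle.continuousLinearMapAt_trivializationAt (I := 𝓡 n) hx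
  have e2 := congrArg (fun L => L (u ((extChartAt (𝓡 n) c).symm y))) e
  refine Eq.trans e2.symm ?_
  exact Bundle.Trivialization.continuousLinearMapAt_apply_of_mem (R := ℝ)
    (trivializationAt (EuclideanSpace ℝ (Fin n)) (TangentSpace (𝓡 n) : M → Type _) c) hx _

lemma differentiableAt_chartField {c : M} {y : EuclideanSpace ℝ (Fin n)}
    (hy : y ∈ (extChartAt (𝓡 n) c).target) (u : Vect n M) :
    DifferentiableAt ℝ (chartField c u) y :=
  ((contDiffOn_chartField c u).contDiffAt
    ((isOpen_extChartAt_target c).mem_nhds hy)).differentiableAt (by simp)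

lemma chartField_add (c : M) (u v : Vect n M) :
    chartField c (u + v) = chartField c u + chartField c v := by
  funext y
  exact map_add (mfderiv (𝓡 n) (𝓡 n) (extChartAt (𝓡 n) c) ((extChartAt (𝓡 n) c).symm y)) _ _

lemma chartField_smul (c : M) (r : ℝ) (u : Vect n M) :
    chartField c (r • u) = r • chartField c u := by
  funext y
  exact map_smul (mfderiv (𝓡 n) (𝓡 n) (extChartAt (𝓡 n) c) ((extChartAt (𝓡 n) c).symm y)) _ _

/-- The product of a vector field by a smooth function. -/
def smulField (f : smoothFunctions n M) (u : Vect n M) : Vect n M :=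
  ⟨fun x => (f : M → ℝ) x • u x, ContMDiff.smul_section f.2 u.contMDiff⟩

lemma chartField_smulField (c : M) (f : smoothFunctions n M) (u : Vect n M)
    (y : EuclideanSpace ℝ (Fin n)) :
    chartField c (smulField f u) y = (f : M → ℝ) ((extChartAt (𝓡 n) c).symm y) • chartField c u y :=
  map_smul (mfderiv (𝓡 n) (𝓡 n) (extChartAt (𝓡 n) c) ((extChartAt (𝓡 n) c).symm y)) _ _

/-- The differentials of a chart and of its inverse are mutually inverse. This links the components
to the pullback for which naturality of the bracket is available. -/
lemma mpullback_symm_eq_chartField {c : M} {y : EuclideanSpace ℝ (Fin n)}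
    (hy : y ∈ (extChartAt (𝓡 n) c).target) (u : Vect n M) :
    VectorField.mpullback (𝓡 n) (𝓡 n) (extChartAt (𝓡 n) c).symm u y = chartField c u y := by
  have h1 := mfderiv_extChartAt_comp_mfderivWithin_extChartAt_symm (I := 𝓡 n) hy
  have h2 := mfderivWithin_extChartAt_symm_comp_mfderiv_extChartAt (I := 𝓡 n) hy
  rw [show range (𝓡 n) = univ by simp, mfderivWithin_univ] at h1 h2
  rw [VectorField.mpullback_apply]
  exact congrArg (fun L : EuclideanSpace ℝ (Fin n) →L[ℝ] EuclideanSpace ℝ (Fin n) =>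
    L (u ((extChartAt (𝓡 n) c).symm y))) (ContinuousLinearMap.inverse_eq h2 h1)

/-- Naturality of the bracket under the inverse chart, followed by the fact that on a vector space
the manifold bracket is the ordinary one. -/
lemma chartField_lie {c : M} {y : EuclideanSpace ℝ (Fin n)}
    (hy : y ∈ (extChartAt (𝓡 n) c).target) (u v : Vect n M) :
    chartField c ⁅u, v⁆ y = fderiv ℝ (chartField c v) y (chartField c u y) -
      fderiv ℝ (chartField c u) y (chartField c v y) := by
  have : IsManifold (𝓡 n) (minSmoothness ℝ 2) M := isManifold_minSmoothness 2
  have : IsManifold (𝓡 n) (minSmoothness ℝ 3) M := isManifold_minSmoothness 3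
  have hs : ContMDiffAt (𝓡 n) (𝓡 n) (minSmoothness ℝ 2) (extChartAt (𝓡 n) c).symm y := by
    rw [minSmoothness_of_isRCLikeNormedField]
    exact ((contMDiffOn_extChartAt_symm (n := ∞) c).contMDiffAt
      ((isOpen_extChartAt_target c).mem_nhds hy)).of_le ENat.LEInfty.out
  have h := VectorField.mpullback_mlieBracket (u.mdiffAt ((extChartAt (𝓡 n) c).symm y))
    (v.mdiffAt ((extChartAt (𝓡 n) c).symm y)) hs le_rfl
  have e := mpullback_symm_eq_chartField hy ⁅u, v⁆
  refine (e.symm.trans h).trans ?_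
  have hev : ∀ w : Vect n M, VectorField.mpullback (𝓡 n) (𝓡 n) (extChartAt (𝓡 n) c).symm w =ᶠ[𝓝 y]
      chartField c w := fun w => by
    filter_upwards [(isOpen_extChartAt_target c).mem_nhds hy] with z hz
    exact mpullback_symm_eq_chartField hz w
  refine ((hev u).mlieBracket_vectorField_eq (hev v)).trans ?_
  have e3 : ∀ V W : (x : EuclideanSpace ℝ (Fin n)) → TangentSpace (𝓡 n) x,
      VectorField.mlieBracket (𝓡 n) V W = VectorField.lieBracket ℝ V W := fun V W => by
    rw [← VectorField.mlieBracketWithin_univ, VectorField.mlieBracketWithin_eq_lieBracketWithin]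
    exact VectorField.lieBracketWithin_univ
  exact congrFun (e3 (chartField c u) (chartField c v)) y

end ChartField

/-! ### The derivative of the determinant at the identity -/

section Trace

lemma hasDerivAt_det_of_one {n : ℕ} {B : ℝ → Matrix (Fin n) (Fin n) ℝ}
    {N : Matrix (Fin n) (Fin n) ℝ} (h0 : B 0 = 1)
    (hB : ∀ i j, HasDerivAt (fun t => B t i j) (N i j) 0) :
    HasDerivAt (fun t => (B t).det) N.trace 0 := by
  simp only [Matrix.det_apply']
  have h := HasDerivAt.fun_sum (u := Finset.univ) fun (σ : Equiv.Perm (Fin n)) _ =>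
    (HasDerivAt.fun_finsetProd (u := Finset.univ) fun (i : Fin n) _ => hB (σ i) i).const_mul
      ((Equiv.Perm.sign σ : ℤ) : ℝ)
  refine h.congr_deriv ?_
  rw [Finset.sum_eq_single 1]
  · simp [h0, Matrix.trace]
  · intro σ _ hσ
    refine mul_eq_zero_of_right _ (Finset.sum_eq_zero fun i _ => ?_)
    -- A permutation other than the identity moves at least two indices. After one factor has been
    -- differentiated, an off-diagonal entry of the identity matrix, namely zero, remains in the
    -- product.
    obtain ⟨j, hji, hj⟩ : ∃ j, j ≠ i ∧ σ j ≠ j := by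
      by_contra! hcon
      refine hσ (Equiv.ext fun j => ?_)
      by_cases hji : j = i
      · subst hji
        by_contra hne
        exact hne (σ.injective (hcon _ hne))
      · exact hcon j hji
    rw [Finset.prod_eq_zero (Finset.mem_erase.2 ⟨hji, Finset.mem_univ j⟩), zero_smul]
    rw [h0, Matrix.one_apply_ne hj]
  · simp

end Trace

/-! ### The derivative of the Jacobian along a curve -/

section CurveDerivative

variable {n : ℕ} {M : Type*} [TopologicalSpace M] [ChartedSpace (EuclideanSpace ℝ (Fin n)) M]
  [IsManifold (𝓡 n) ∞ M]

/-- The formula `ρ⁻¹ ∑ᵢ ∂ᵢ(ρ uᵢ)` for the divergence in the chart around `c`. -/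
def chartDivergence (c : M) (μ : FormField n M) (u : Vect n M) (y : EuclideanSpace ℝ (Fin n)) :
    ℝ :=
  (chartCoeff c μ y)⁻¹ * ∑ i : Fin n, fderiv ℝ (fun y => chartCoeff c μ y * chartField c u y i) y
    (EuclideanSpace.single i (1 : ℝ))

lemma sum_apply_single_smul (L : EuclideanSpace ℝ (Fin n) →L[ℝ] ℝ) (w : EuclideanSpace ℝ (Fin n)) :
    L w = ∑ i, w i * L (EuclideanSpace.single i 1) := by
  conv_lhs => rw [← (EuclideanSpace.basisFun (Fin n) ℝ).sum_repr w]
  simp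

/-- The product rule for the divergence. -/
lemma chartDivergence_eq {μ : FormField n M} (h0 : ∀ x, μ x ≠ 0) (hμ : μ ∈ smoothForms n M)
    (u : Vect n M) {c : M} {y : EuclideanSpace ℝ (Fin n)}
    (hy : y ∈ (extChartAt (𝓡 n) c).target) :
    chartDivergence c μ u y = (chartCoeff c μ y)⁻¹ * fderiv ℝ (chartCoeff c μ) y (chartField c u y) +
      ∑ i, fderiv ℝ (fun y => chartField c u y i) y (EuclideanSpace.single i (1 : ℝ)) := by
  have hd : DifferentiableAt ℝ (chartCoeff c μ) y := ((contDiffOn_chartCoeff hμ c).contDiffAt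
    ((isOpen_extChartAt_target c).mem_nhds hy)).differentiableAt (by simp)
  have hu := differentiableAt_chartField hy u
  have hui : ∀ i, DifferentiableAt ℝ (fun y => chartField c u y i) y := fun i =>
    (EuclideanSpace.proj (𝕜 := ℝ) i).differentiableAt.comp y hu
  have h1 := chartCoeff_ne_zero h0 hy
  rw [chartDivergence, sum_apply_single_smul (fderiv ℝ (chartCoeff c μ) y), ← mul_right_inj' h1,
    mul_inv_cancel_left₀ h1, mul_add, mul_inv_cancel_left₀ h1, Finset.mul_sum,
    ← Finset.sum_add_distrib]
  refine Finset.sum_congr rfl fun i _ => ?_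
  rw [fderiv_fun_mul hd (hui i)]
  simp
  ring

/-- The derivative of the Jacobian of a family of maps starting at the identity, in terms of the
velocity `V` in a chart. -/
lemma hasDerivAt_ratio_pullback_of_chart {μ : FormField n M} (h0 : ∀ x, μ x ≠ 0)
    (hμ : μ ∈ smoothForms n M) {Φ : ℝ × M → M} {c : M}
    {y : EuclideanSpace ℝ (Fin n)} (hy : y ∈ (extChartAt (𝓡 n) c).target)
    (hΦ : ContMDiffAt (𝓘(ℝ, ℝ).prod (𝓡 n)) (𝓡 n) ∞ Φ (0, (extChartAt (𝓡 n) c).symm y))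
    (hid : ∀ᶠ x in 𝓝 ((extChartAt (𝓡 n) c).symm y), Φ (0, x) = x)
    {V : EuclideanSpace ℝ (Fin n) → EuclideanSpace ℝ (Fin n)}
    (hgv : ∀ᶠ z in 𝓝 y, HasDerivAt (fun t : ℝ =>
      extChartAt (𝓡 n) c (Φ (t, (extChartAt (𝓡 n) c).symm z))) (V z) 0) :
    HasDerivAt (fun t => ratio (pullback (fun x => Φ (t, x)) μ) μ ((extChartAt (𝓡 n) c).symm y))
      ((chartCoeff c μ y)⁻¹ * fderiv ℝ (chartCoeff c μ) y (V y) +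
        ∑ i, fderiv ℝ (fun y => V y i) y (EuclideanSpace.single i (1 : ℝ))) 0 := by
  set x := (extChartAt (𝓡 n) c).symm y with hx
  set g : ℝ × EuclideanSpace ℝ (Fin n) → EuclideanSpace ℝ (Fin n) := fun q =>
    extChartAt (𝓡 n) c (Φ (q.1, (extChartAt (𝓡 n) c).symm q.2)) with hg
  have hxs : x ∈ (extChartAt (𝓡 n) c).source := (extChartAt (𝓡 n) c).map_target hy
  have hidx : Φ (0, x) = x := hid.self_of_nhds
  have hgc : ContDiffAt ℝ ∞ g (0, y) := contDiffAt_chart_family hy hΦ (by rwa [← hx, hidx])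
  have hgi : ∀ i, ContDiffAt ℝ ∞ (fun q => g q i) (0, y) := fun i =>
    (EuclideanSpace.proj (𝕜 := ℝ) i).contDiff.contDiffAt.comp (0, y) hgc
  have hsymm : Tendsto (extChartAt (𝓡 n) c).symm (𝓝 y) (𝓝 x) :=
    (mdifferentiableAt_extChartAt_symm hy).continuousAt
  have hg0 : ∀ᶠ z in 𝓝 y, g (0, z) = z := by
    filter_upwards [hsymm.eventually hid, (isOpen_extChartAt_target c).mem_nhds hy] with z hz hz2
    rw [hg]
    simp only
    rw [hz, (extChartAt (𝓡 n) c).right_inv hz2]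
  have hΦ1 := (contMDiffAt_iff_contMDiffAt_nhds (n := 1) (by simp)).1
    (hΦ.of_le (by exact ENat.LEInfty.out))
  have htt : Tendsto (fun t : ℝ => (t, x)) (𝓝 0) (𝓝 (0, x)) :=
    Continuous.tendsto (by fun_prop) 0
  -- The Jacobian is `det B(t)` times a quotient of coefficients of `μ`. Since `B(0)` is the
  -- identity, the determinant contributes the trace of `N`, the plain divergence of `V`; the moving
  -- coefficient contributes the logarithmic derivative of the density.
  set B : ℝ → Matrix (Fin n) (Fin n) ℝ := fun t => Matrix.of fun i j =>
    fderiv ℝ (fun z => g (t, z) i) y (EuclideanSpace.single j 1) with hB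
  set N : Matrix (Fin n) (Fin n) ℝ := Matrix.of fun i j =>
    fderiv ℝ (fun z => V z i) y (EuclideanSpace.single j 1) with hN
  have hB0 : B 0 = 1 := by
    ext i j
    have e : (fun z => g (0, z) i) =ᶠ[𝓝 y] EuclideanSpace.proj (𝕜 := ℝ) i := by
      filter_upwards [hg0] with z hz
      rw [hz]
      rfl
    rw [hB]
    simp only [Matrix.of_apply]
    rw [e.fderiv_eq, ContinuousLinearMap.fderiv]
    simp [Matrix.one_apply]
  have hBd : ∀ i j, HasDerivAt (fun t => B t i j) (N i j) 0 := by
    intro i j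
    have hdiff : DifferentiableAt ℝ (fun t => B t i j) 0 := by
      have e : (fun t => B t i j) =ᶠ[𝓝 0] fun t =>
          fderiv ℝ (fun q => g q i) (t, y) (0, EuclideanSpace.single j 1) := by
        have : Tendsto (fun t : ℝ => (t, y)) (𝓝 0) (𝓝 (0, y)) :=
          Continuous.tendsto (by fun_prop) 0
        filter_upwards [this.eventually (eventually_contDiffAt (hgi i))] with t ht
        exact fderiv_mk_right (g := fun q => g q i) (ht.differentiableAt (by simp)) _
      refine DifferentiableAt.congr_of_eventuallyEq ?_ e
      have h1 := ((hgi i).fderiv_right (m := 1) (by norm_num; exact ENat.LEInfty.out)).differentiableAt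
        (by simp)
      have h2 : DifferentiableAt ℝ (fun t : ℝ => (t, y)) 0 := by fun_prop
      exact (DifferentiableAt.comp (0 : ℝ) h1 h2).clm_apply (differentiableAt_const _)
    refine hdiff.hasDerivAt.congr_deriv ?_
    -- Exchanging time and space derivatives turns the derivative of the Jacobian matrix into the
    -- space derivative of the velocity.
    have h := fderiv_fderiv_mk_comm (hgi i) (1 : ℝ) (EuclideanSpace.single j (1 : ℝ))
    refine Eq.trans h ?_
    have e : (fun z => fderiv ℝ (fun t => g (t, z) i) 0 (1 : ℝ)) =ᶠ[𝓝 y]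
        fun z => V z i := by
      filter_upwards [hgv] with z hz
      exact ((EuclideanSpace.proj (𝕜 := ℝ) i).hasFDerivAt.comp_hasDerivAt (0 : ℝ) hz).deriv
    rw [e.fderiv_eq]
    rfl
  have hdet := hasDerivAt_det_of_one hB0 hBd
  have hμd : DifferentiableAt ℝ (chartCoeff c μ) y := ((contDiffOn_chartCoeff hμ c).contDiffAt
    ((isOpen_extChartAt_target c).mem_nhds hy)).differentiableAt (by simp)
  have hgy : g (0, y) = y := hg0.self_of_nhds
  have hmu : HasDerivAt (fun t => chartCoeff c μ (g (t, y)))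
      (fderiv ℝ (chartCoeff c μ) y (V y)) 0 := by
    have h1 : HasFDerivAt (chartCoeff c μ) (fderiv ℝ (chartCoeff c μ) y) (g (0, y)) := by
      rw [hgy]
      exact hμd.hasFDerivAt
    exact h1.comp_hasDerivAt (0 : ℝ) hgv.self_of_nhds
  have hall := (hdet.mul hmu).div_const (chartCoeff c μ y)
  have hval : (N.trace * chartCoeff c μ (g (0, y)) + (B 0).det *
      fderiv ℝ (chartCoeff c μ) y (V y)) / chartCoeff c μ y =
        (chartCoeff c μ y)⁻¹ * fderiv ℝ (chartCoeff c μ) y (V y) +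
        ∑ i, fderiv ℝ (fun y => V y i) y (EuclideanSpace.single i (1 : ℝ)) := by
    rw [hB0, Matrix.det_one, hgy, one_mul, add_div,
      mul_div_cancel_right₀ _ (chartCoeff_ne_zero h0 hy), Matrix.trace, add_comm, div_eq_inv_mul]
    rfl
  rw [← hval]
  refine hall.congr_of_eventuallyEq ?_
  have hcont : Tendsto (fun t : ℝ => Φ (t, x)) (𝓝 0) (𝓝 x) := by
    have := hΦ.continuousAt.tendsto.comp htt
    rwa [hidx] at this
  have htty : Tendsto (fun t : ℝ => (t, y)) (𝓝 0) (𝓝 (0, y)) :=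
    Continuous.tendsto (by fun_prop) 0
  filter_upwards [htt.eventually hΦ1, hcont.eventually ((isOpen_extChartAt_source c).mem_nhds hxs),
    htty.eventually (eventually_contDiffAt hgc)] with t ht1 ht2 ht3
  have hφ : MDifferentiableAt (𝓡 n) (𝓡 n) (fun x => Φ (t, x)) x :=
    (ht1.mdifferentiableAt (by simp)).comp x
      (mdifferentiableAt_const.prodMk mdifferentiableAt_id)
  rw [ratio_eq_chartCoeff h0 _ hy, chartCoeff_pullback hy hφ ht2, det_eq_matrix_det]
  have hgd : DifferentiableAt ℝ (fun z => g (t, z)) y :=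
    (hasFDerivAt_comp_mk_right (g := g) (ht3.differentiableAt (by simp))).differentiableAt
  have hmat : (Matrix.of fun i j => (fderiv ℝ (fun z => g (t, z)) y)
      (EuclideanSpace.single j 1) i) = B t := by
    ext i j
    have := ((EuclideanSpace.proj (𝕜 := ℝ) i).hasFDerivAt.comp y hgd.hasFDerivAt).fderiv
    rw [hB]
    simp only [Matrix.of_apply]
    exact (congrArg (fun L : EuclideanSpace ℝ (Fin n) →L[ℝ] ℝ => L (EuclideanSpace.single j 1))
      this).symm
  exact congrArg (fun A : Matrix (Fin n) (Fin n) ℝ => A.det * chartCoeff c μ (g (t, y)) / chartCoeff c μ y) hmat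

/-- By the chain rule the velocity in the chart is `chartField c u`, so the product rule for the
divergence identifies the derivative. The hypotheses are only local, so that local families suffice.
-/
lemma hasDerivAt_ratio_pullback {μ : FormField n M} (h0 : ∀ x, μ x ≠ 0)
    (hμ : μ ∈ smoothForms n M) (u : Vect n M) {Φ : ℝ × M → M} {c : M}
    {y : EuclideanSpace ℝ (Fin n)} (hy : y ∈ (extChartAt (𝓡 n) c).target)
    (hΦ : ContMDiffAt (𝓘(ℝ, ℝ).prod (𝓡 n)) (𝓡 n) ∞ Φ (0, (extChartAt (𝓡 n) c).symm y))
    (hid : ∀ᶠ x in 𝓝 ((extChartAt (𝓡 n) c).symm y), Φ (0, x) = x)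
    (hvel : ∀ᶠ x in 𝓝 ((extChartAt (𝓡 n) c).symm y),
      (mfderiv 𝓘(ℝ, ℝ) (𝓡 n) (fun t : ℝ => Φ (t, x)) 0 (1 : ℝ) : EuclideanSpace ℝ (Fin n)) = u x) :
    HasDerivAt (fun t => ratio (pullback (fun x => Φ (t, x)) μ) μ ((extChartAt (𝓡 n) c).symm y))
      (chartDivergence c μ u y) 0 := by
  have hsymm : Tendsto (extChartAt (𝓡 n) c).symm (𝓝 y) (𝓝 ((extChartAt (𝓡 n) c).symm y)) :=
    (mdifferentiableAt_extChartAt_symm hy).continuousAt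
  have hΦ1 := (contMDiffAt_iff_contMDiffAt_nhds (n := 1) (by simp)).1
    (hΦ.of_le (by exact ENat.LEInfty.out))
  have htx : Tendsto (fun x : M => ((0 : ℝ), x)) (𝓝 ((extChartAt (𝓡 n) c).symm y))
    (𝓝 (0, (extChartAt (𝓡 n) c).symm y)) := Continuous.tendsto (by fun_prop) _
  rw [chartDivergence_eq h0 hμ u hy]
  refine hasDerivAt_ratio_pullback_of_chart h0 hμ hy hΦ hid ?_
  filter_upwards [hsymm.eventually hid, hsymm.eventually hvel,
    hsymm.eventually (htx.eventually hΦ1), (isOpen_extChartAt_target c).mem_nhds hy]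
    with z hz hzv hzd hzt
  have hd1 : MDifferentiableAt 𝓘(ℝ, ℝ) (𝓡 n)
      (fun t : ℝ => Φ (t, (extChartAt (𝓡 n) c).symm z)) 0 :=
    (hzd.mdifferentiableAt (by simp)).comp (0 : ℝ)
      (mdifferentiableAt_id.prodMk mdifferentiableAt_const)
  have hd2 : MDifferentiableAt (𝓡 n) (𝓡 n) (extChartAt (𝓡 n) c)
      (Φ (0, (extChartAt (𝓡 n) c).symm z)) := by
    rw [hz]
    exact mdifferentiableAt_extChartAt' ((extChartAt (𝓡 n) c).map_target hzt)
  have hd := (hd2.comp (0 : ℝ) hd1).differentiableAt.hasDerivAt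
  refine hd.congr_deriv ?_
  have h2 := mfderiv_comp (0 : ℝ) hd2 hd1
  rw [mfderiv_eq_fderiv] at h2
  have h3 := congrArg (fun L : ℝ →L[ℝ] EuclideanSpace ℝ (Fin n) => L 1) h2
  refine Eq.trans h3 ?_
  have h4 : (mfderiv (𝓡 n) (𝓡 n) (extChartAt (𝓡 n) c)
    (Φ (0, (extChartAt (𝓡 n) c).symm z)) : EuclideanSpace ℝ (Fin n) →L[ℝ] EuclideanSpace ℝ (Fin n))
      (mfderiv 𝓘(ℝ, ℝ) (𝓡 n) (fun t : ℝ => Φ (t, (extChartAt (𝓡 n) c).symm z)) 0 (1 : ℝ)) =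
    (mfderiv (𝓡 n) (𝓡 n) (extChartAt (𝓡 n) c)
      (Φ (0, (extChartAt (𝓡 n) c).symm z)) : EuclideanSpace ℝ (Fin n) →L[ℝ] EuclideanSpace ℝ (Fin n))
      (u ((extChartAt (𝓡 n) c).symm z)) := congrArg _ hzv
  refine Eq.trans h4 ?_
  rw [hz]
  rfl

end CurveDerivative

/-! ### The divergence and the divergence theorem -/

section Divergence

variable {n : ℕ} {M : Type*} [TopologicalSpace M] [ChartedSpace (EuclideanSpace ℝ (Fin n)) M]
  [IsManifold (𝓡 n) ∞ M]

/-- The curve lemma at a point of the domain of a chart. -/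
lemma hasDerivAt_ratio_pullback' {μ : FormField n M} (h0 : ∀ x, μ x ≠ 0)
    (hμ : μ ∈ smoothForms n M) (u : Vect n M) {Φ : ℝ × M → M} {c x : M}
    (hx : x ∈ (extChartAt (𝓡 n) c).source)
    (hΦ : ContMDiffAt (𝓘(ℝ, ℝ).prod (𝓡 n)) (𝓡 n) ∞ Φ (0, x))
    (hid : ∀ᶠ x in 𝓝 x, Φ (0, x) = x)
    (hvel : ∀ᶠ x in 𝓝 x,
      (mfderiv 𝓘(ℝ, ℝ) (𝓡 n) (fun t : ℝ => Φ (t, x)) 0 (1 : ℝ) : EuclideanSpace ℝ (Fin n)) = u x) :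
    HasDerivAt (fun t => ratio (pullback (fun x => Φ (t, x)) μ) μ x)
      (chartDivergence c μ u (extChartAt (𝓡 n) c x)) 0 := by
  obtain ⟨y, hy, rfl⟩ : ∃ y ∈ (extChartAt (𝓡 n) c).target, (extChartAt (𝓡 n) c).symm y = x :=
    ⟨_, (extChartAt (𝓡 n) c).map_source hx, (extChartAt (𝓡 n) c).left_inv hx⟩
  rw [(extChartAt (𝓡 n) c).right_inv hy]
  exact hasDerivAt_ratio_pullback h0 hμ u hy hΦ hid hvel

/-- A local family of maps with a given velocity. -/
lemma exists_local_curve (u : Vect n M) (x : M) : ∃ Φ : ℝ × M → M,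
    ContMDiffAt (𝓘(ℝ, ℝ).prod (𝓡 n)) (𝓡 n) ∞ Φ (0, x) ∧ (∀ᶠ x in 𝓝 x, Φ (0, x) = x) ∧
    ∀ᶠ x in 𝓝 x, (mfderiv 𝓘(ℝ, ℝ) (𝓡 n) (fun t : ℝ => Φ (t, x)) 0 (1 : ℝ) :
      EuclideanSpace ℝ (Fin n)) = u x := by
  -- Straight segments in the chart suffice: only the velocity at time zero matters, so no flow is
  -- needed.
  refine ⟨fun q => (extChartAt (𝓡 n) x).symm (extChartAt (𝓡 n) x q.2 + q.1 •
    chartField x u (extChartAt (𝓡 n) x q.2)), ?_, ?_, ?_⟩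
  · have h1 : ContMDiffAt (𝓘(ℝ, ℝ).prod (𝓡 n)) 𝓘(ℝ, EuclideanSpace ℝ (Fin n)) ∞
        (fun q : ℝ × M => extChartAt (𝓡 n) x q.2) (0, x) :=
      (contMDiffAt_extChartAt (n := ∞)).comp (0, x) contMDiffAt_snd
    have h2 : ContMDiffAt 𝓘(ℝ, EuclideanSpace ℝ (Fin n)) 𝓘(ℝ, EuclideanSpace ℝ (Fin n)) ∞
        (chartField x u) (extChartAt (𝓡 n) x x) :=
      ((contDiffOn_chartField x u).contDiffAt ((isOpen_extChartAt_target x).mem_nhds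
        (mem_extChartAt_target x))).contMDiffAt
    have h3 : ContMDiffAt (𝓘(ℝ, ℝ).prod (𝓡 n)) 𝓘(ℝ, EuclideanSpace ℝ (Fin n)) ∞
        (fun q : ℝ × M => extChartAt (𝓡 n) x q.2 + q.1 •
          chartField x u (extChartAt (𝓡 n) x q.2)) (0, x) :=
      h1.add (contMDiffAt_fst.smul (h2.comp (0, x) h1))
    have h4 : ContMDiffAt (𝓡 n) (𝓡 n) ∞ (extChartAt (𝓡 n) x).symm
        (extChartAt (𝓡 n) x x + (0 : ℝ) • chartField x u (extChartAt (𝓡 n) x x)) := by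
      rw [zero_smul, add_zero]
      exact (contMDiffOn_extChartAt_symm x).contMDiffAt
        ((isOpen_extChartAt_target x).mem_nhds (mem_extChartAt_target x))
    exact h4.comp (0, x) h3
  · filter_upwards [extChartAt_source_mem_nhds (I := 𝓡 n) x] with z hz
    rw [zero_smul, add_zero, (extChartAt (𝓡 n) x).left_inv hz]
  · filter_upwards [extChartAt_source_mem_nhds (I := 𝓡 n) x] with z hz
    set w := chartField x u (extChartAt (𝓡 n) x z) with hw
    set γ : ℝ → EuclideanSpace ℝ (Fin n) := fun t => extChartAt (𝓡 n) x z + t • w with hγ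
    have hγd : HasDerivAt γ w 0 :=
      (((hasDerivAt_id (0 : ℝ)).smul_const w).const_add _).congr_deriv (one_smul _ _)
    have hγ0 : γ 0 = extChartAt (𝓡 n) x z := by simp [hγ]
    have hs : MDifferentiableAt (𝓡 n) (𝓡 n) (extChartAt (𝓡 n) x).symm (γ 0) := by
      rw [hγ0]
      exact mdifferentiableAt_extChartAt_symm ((extChartAt (𝓡 n) x).map_source hz)
    have h2 := mfderiv_comp (0 : ℝ) hs hγd.differentiableAt.mdifferentiableAt
    rw [mfderiv_eq_fderiv] at h2
    have h3 := congrArg (fun L : ℝ →L[ℝ] EuclideanSpace ℝ (Fin n) => L 1) h2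
    refine Eq.trans h3 ?_
    have h4 : (mfderiv (𝓡 n) (𝓡 n) (extChartAt (𝓡 n) x).symm (γ 0) :
        EuclideanSpace ℝ (Fin n) →L[ℝ] EuclideanSpace ℝ (Fin n)) (fderiv ℝ γ 0 1) =
      (mfderiv (𝓡 n) (𝓡 n) (extChartAt (𝓡 n) x).symm (γ 0) :
        EuclideanSpace ℝ (Fin n) →L[ℝ] EuclideanSpace ℝ (Fin n)) w := congrArg _ hγd.deriv
    refine Eq.trans h4 ?_
    rw [hγ0, hw, chartField, (extChartAt (𝓡 n) x).left_inv hz]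
    have h5 := mfderivWithin_extChartAt_symm_comp_mfderiv_extChartAt' (I := 𝓡 n) hz
    rw [show range (𝓡 n) = univ by simp, mfderivWithin_univ] at h5
    exact congrArg (fun L : EuclideanSpace ℝ (Fin n) →L[ℝ] EuclideanSpace ℝ (Fin n) => L (u z)) h5

/-- The divergence can be computed in any chart. -/
lemma divergence_eq_chartDivergence {μ : FormField n M} (h0 : ∀ x, μ x ≠ 0)
    (hμ : μ ∈ smoothForms n M) (u : Vect n M) {c : M} {y : EuclideanSpace ℝ (Fin n)}
    (hy : y ∈ (extChartAt (𝓡 n) c).target) :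
    divergence μ u ((extChartAt (𝓡 n) c).symm y) = chartDivergence c μ u y := by
  -- Both chart formulas are the derivative of the same Jacobian along one local curve, and
  -- derivatives are unique. No transformation law has to be computed.
  obtain ⟨Φ, h1, h2, h3⟩ := exists_local_curve u ((extChartAt (𝓡 n) c).symm y)
  exact (hasDerivAt_ratio_pullback' h0 hμ u (mem_extChartAt_source _) h1 h2 h3).unique
    (hasDerivAt_ratio_pullback h0 hμ u hy h1 h2 h3)

lemma contDiffOn_chartField_apply (c : M) (u : Vect n M) (i : Fin n) :
    ContDiffOn ℝ ∞ (fun y => chartField c u y i) (extChartAt (𝓡 n) c).target :=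
  (EuclideanSpace.proj (𝕜 := ℝ) i).contDiff.comp_contDiffOn (contDiffOn_chartField c u)

lemma contMDiff_divergence {μ : FormField n M} (h0 : ∀ x, μ x ≠ 0) (hμ : μ ∈ smoothForms n M)
    (u : Vect n M) : ContMDiff (𝓡 n) 𝓘(ℝ, ℝ) ∞ (divergence μ u) := by
  refine contMDiff_iff_charts.2 fun c => ContDiffOn.congr ?_ fun y hy =>
    divergence_eq_chartDivergence h0 hμ u hy
  refine ((hμ c).inv fun y hy => chartCoeff_ne_zero h0 hy).mul (ContDiffOn.sum fun i _ => ?_)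
  exact (((hμ c).mul (contDiffOn_chartField_apply c u i)).fderiv_of_isOpen
    (isOpen_extChartAt_target c) (by simp)).clm_apply contDiffOn_const

lemma lieDerivative_mem_smoothForms {μ : FormField n M} (h0 : ∀ x, μ x ≠ 0)
    (hμ : μ ∈ smoothForms n M) (u : Vect n M) : lieDerivative μ u ∈ smoothForms n M :=
  smul_mem_smoothForms (contMDiff_divergence h0 hμ u) hμ

lemma differentiableAt_chartField_apply {c : M} {y : EuclideanSpace ℝ (Fin n)}
    (hy : y ∈ (extChartAt (𝓡 n) c).target) (u : Vect n M) (i : Fin n) :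
    DifferentiableAt ℝ (fun y => chartField c u y i) y :=
  (EuclideanSpace.proj (𝕜 := ℝ) i).differentiableAt.comp y (differentiableAt_chartField hy u)

omit [IsManifold (𝓡 n) ∞ M] in
lemma differentiableAt_chartCoeff {μ : FormField n M} (hμ : μ ∈ smoothForms n M) {c : M}
    {y : EuclideanSpace ℝ (Fin n)} (hy : y ∈ (extChartAt (𝓡 n) c).target) :
    DifferentiableAt ℝ (chartCoeff c μ) y :=
  ((contDiffOn_chartCoeff hμ c).contDiffAt
    ((isOpen_extChartAt_target c).mem_nhds hy)).differentiableAt (by simp)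

lemma divergence_add {μ : FormField n M} (hμ : μ ∈ smoothForms n M) (u v : Vect n M) (x : M) :
    divergence μ (u + v) x = divergence μ u x + divergence μ v x := by
  have hy := mem_extChartAt_target (I := 𝓡 n) x
  unfold divergence
  rw [← mul_add, ← Finset.sum_add_distrib]
  refine congrArg _ (Finset.sum_congr rfl fun i _ => ?_)
  rw [chartField_add]
  have h := fderiv_fun_add ((differentiableAt_chartCoeff hμ hy).fun_mul
    (differentiableAt_chartField_apply hy u i)) ((differentiableAt_chartCoeff hμ hy).fun_mul
    (differentiableAt_chartField_apply hy v i))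
  simp only [← mul_add] at h
  exact congrArg (fun L : EuclideanSpace ℝ (Fin n) →L[ℝ] ℝ => L (EuclideanSpace.single i 1)) h

lemma divergence_smul {μ : FormField n M} (hμ : μ ∈ smoothForms n M) (r : ℝ) (u : Vect n M)
    (x : M) : divergence μ (r • u) x = r * divergence μ u x := by
  have hy := mem_extChartAt_target (I := 𝓡 n) x
  unfold divergence
  rw [mul_left_comm]
  congr 1
  rw [Finset.mul_sum]
  refine Finset.sum_congr rfl fun i _ => ?_
  rw [chartField_smul]
  have h := fderiv_const_mul ((differentiableAt_chartCoeff hμ hy).fun_mul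
    (differentiableAt_chartField_apply hy u i)) r
  simp only [mul_left_comm r] at h
  exact congrArg (fun L : EuclideanSpace ℝ (Fin n) →L[ℝ] ℝ => L (EuclideanSpace.single i 1)) h

lemma lieDerivative_add {μ : FormField n M} (hμ : μ ∈ smoothForms n M) (u v : Vect n M) :
    lieDerivative μ (u + v) = lieDerivative μ u + lieDerivative μ v :=
  funext fun x => by
    ext w
    exact (congrArg (· * μ x w) (divergence_add hμ u v x)).trans (add_mul _ _ _)

lemma lieDerivative_smul {μ : FormField n M} (hμ : μ ∈ smoothForms n M) (r : ℝ) (u : Vect n M) :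
    lieDerivative μ (r • u) = r • lieDerivative μ u :=
  funext fun x => by
    ext w
    exact (congrArg (· * μ x w) (divergence_smul hμ r u x)).trans (mul_assoc _ _ _)

/-- `u ↦ L_u μ`, as a linear map to the smooth forms. -/
def lieDerivativeForms {μ : FormField n M} (h0 : ∀ x, μ x ≠ 0) (hμ : μ ∈ smoothForms n M) :
    Vect n M →ₗ[ℝ] smoothForms n M where
  toFun u := ⟨lieDerivative μ u, lieDerivative_mem_smoothForms h0 hμ u⟩
  map_add' u v := Subtype.ext (lieDerivative_add hμ u v)
  map_smul' r u := Subtype.ext (lieDerivative_smul hμ r u)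

lemma divergence_smulField_eq_zero (μ : FormField n M) (g : smoothFunctions n M) (u : Vect n M)
    {x : M} (hx : x ∉ tsupport (g : M → ℝ)) : divergence μ (smulField g u) x = 0 := by
  have hg : (g : M → ℝ) =ᶠ[𝓝 x] fun _ => 0 := notMem_tsupport_iff_eventuallyEq.1 hx
  have hs : Tendsto (extChartAt (𝓡 n) x).symm (𝓝 (extChartAt (𝓡 n) x x)) (𝓝 x) := by
    have := (mdifferentiableAt_extChartAt_symm (mem_extChartAt_target (I := 𝓡 n) x)).continuousAt
    rwa [ContinuousAt, extChartAt_to_inv] at this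
  refine mul_eq_zero_of_right _ (Finset.sum_eq_zero fun i _ => ?_)
  have e : (fun y => chartCoeff x μ y * chartField x (smulField g u) y i) =ᶠ[𝓝
      (extChartAt (𝓡 n) x x)] fun _ => 0 := by
    filter_upwards [hs.eventually hg] with y hy
    rw [chartField_smulField, hy, zero_smul]
    simp
  rw [e.fderiv_eq]
  simp

variable [T2Space M] [CompactSpace M]

/-- In the chart the density cancels its inverse, and the integrand becomes a sum of partial
derivatives of compactly supported functions, with the locally constant orientation sign included.
-/
lemma integral_lieDerivative_smulField (ν : VolumeForm n M) {μ : FormField n M}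
    (h0 : ∀ x, μ x ≠ 0) (hμ : μ ∈ smoothForms n M) (g : smoothFunctions n M) (u : Vect n M) {c : M}
    (hs : tsupport (g : M → ℝ) ⊆ (extChartAt (𝓡 n) c).source) :
    ν.integral (lieDerivative μ (smulField g u)) = 0 := by
  set K := extChartAt (𝓡 n) c '' tsupport (g : M → ℝ) with hKdef
  have hK : IsCompact K := isCompact_image_tsupport hs
  have hKU : K ⊆ (extChartAt (𝓡 n) c).target := image_tsupport_subset hs
  have hU := isOpen_extChartAt_target (I := 𝓡 n) c
  have hνc := (contDiffOn_chartCoeff ν.smooth c).continuousOn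
  have hν0 : ∀ y ∈ (extChartAt (𝓡 n) c).target, chartCoeff c ν.toForm y ≠ 0 :=
    fun y hy => chartCoeff_ne_zero ν.ne_zero hy
  set s : EuclideanSpace ℝ (Fin n) → ℝ := fun y => Real.sign (chartCoeff c ν.toForm y) with hsdef
  have hsm : ContDiffOn ℝ ∞ s (extChartAt (𝓡 n) c).target := contDiffOn_sign hU hνc hν0
  set w : Fin n → EuclideanSpace ℝ (Fin n) → ℝ := fun i y =>
    chartCoeff c μ y * chartField c (smulField g u) y i with hw
  have hw0 : ∀ i, ∀ y ∈ (extChartAt (𝓡 n) c).target, y ∉ K → w i y = 0 := fun i y hy hyK => by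
    rw [hw]
    simp only
    rw [chartField_smulField, comp_symm_eq_zero hy hyK, zero_smul]
    simp
  have hws : ∀ i, ContDiffOn ℝ ∞ (w i) (extChartAt (𝓡 n) c).target := fun i =>
    (hμ c).mul (contDiffOn_chartField_apply c _ i)
  set W : Fin n → EuclideanSpace ℝ (Fin n) → ℝ := fun i =>
    (extChartAt (𝓡 n) c).target.indicator fun y => s y * w i y with hW
  have hWs : ∀ i, ContDiff ℝ ∞ (W i) := fun i => contDiff_indicator hU hK.isClosed hKU
    (hsm.mul (hws i)) fun y hy hyK => by rw [hw0 i y hy hyK, mul_zero]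
  have hW0 : ∀ i, ∀ y ∉ K, W i y = 0 := fun i y hyK => by
    by_cases hy : y ∈ (extChartAt (𝓡 n) c).target
    · rw [hW]
      simp only
      rw [indicator_of_mem hy, hw0 i y hy hyK, mul_zero]
    · rw [hW]
      simp only
      rw [indicator_of_notMem hy]
  have hWK : ∀ i, HasCompactSupport (W i) := fun i => HasCompactSupport.intro hK (hW0 i)
  rw [ν.integral_eq_of_chart (lieDerivative_mem_smoothForms h0 hμ _) c fun x hx => by
    rw [lieDerivative, divergence_smulField_eq_zero μ g u fun h => hx (hs h), zero_smul]]
  have key : ∀ y ∈ (extChartAt (𝓡 n) c).target,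
      Real.sign (chartCoeff c ν.toForm y) * chartCoeff c (lieDerivative μ (smulField g u)) y =
        ∑ i, fderiv ℝ (W i) y (EuclideanSpace.single i 1) := by
    intro y hy
    have e1 : chartCoeff c (lieDerivative μ (smulField g u)) y =
        divergence μ (smulField g u) ((extChartAt (𝓡 n) c).symm y) * chartCoeff c μ y := rfl
    rw [e1, divergence_eq_chartDivergence h0 hμ _ hy, chartDivergence, mul_comm (_⁻¹ * _),
      mul_inv_cancel_left₀ (chartCoeff_ne_zero h0 hy), Finset.mul_sum]
    refine Finset.sum_congr rfl fun i _ => ?_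
    have he : W i =ᶠ[𝓝 y] fun z => s y • w i z := by
      filter_upwards [hU.mem_nhds hy,
        eventually_sign_eq (hνc.continuousAt (hU.mem_nhds hy)) (hν0 y hy)] with z hz hz2
      rw [hW]
      simp only
      rw [indicator_of_mem hz, hsdef]
      simp only [hz2, smul_eq_mul]
    rw [he.fderiv_eq, fderiv_fun_const_smul
      (((hws i).contDiffAt (hU.mem_nhds hy)).differentiableAt (by simp))]
    rfl
  rw [setIntegral_congr_fun hU.measurableSet key, setIntegral_eq_integral_of_forall_compl_eq_zero,
    integral_finsetSum]
  · exact Finset.sum_eq_zero fun i _ => integral_fderiv_apply_eq_zero (hWs i) (hWK i) _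
  · exact fun i _ => (contDiff_fderiv_apply (hWs i) _).continuous.integrable_of_hasCompactSupport
      (hasCompactSupport_fderiv_apply (hWK i) _)
  · intro y hy
    refine Finset.sum_eq_zero fun i _ => ?_
    have he : W i =ᶠ[𝓝 y] fun _ => 0 := by
      filter_upwards [hK.isClosed.isOpen_compl.mem_nhds fun h => hy (hKU h)] with z hz
      exact hW0 i z hz
    rw [he.fderiv_eq]
    simp

/-- `∫ η`, as a linear form on the smooth forms. -/
def integralForms (ν : VolumeForm n M) : smoothForms n M →ₗ[ℝ] ℝ where
  toFun η := ν.integral η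
  map_add' a b := ν.integral_add a.2 b.2
  map_smul' r a := ν.integral_smul r a

/-- The divergence theorem on a closed manifold. -/
theorem integral_lieDerivative (ν : VolumeForm n M) {μ : FormField n M}
    (h0 : ∀ x, μ x ≠ 0) (hμ : μ ∈ smoothForms n M) (u : Vect n M) :
    ν.integral (lieDerivative μ u) = 0 := by
  obtain ⟨S, g, hg, hs⟩ := exists_eq_sum_tsupport (⟨fun _ => 1, contMDiff_const⟩ :
    smoothFunctions n M)
  -- The constant one, cut into pieces supported in charts, cuts `u` into such pieces.
  have hu : u = ∑ c ∈ S, smulField (g c) u := by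
    ext x : 1
    have h1 : (1 : ℝ) = ∑ c ∈ S, (g c : M → ℝ) x := by
      have := congrFun (congrArg Subtype.val hg) x
      rw [AddSubmonoidClass.coe_finsetSum, Finset.sum_apply] at this
      exact this
    have h2 : (∑ c ∈ S, smulField (g c) u) x = ∑ c ∈ S, smulField (g c) u x :=
      map_sum (⟨⟨fun v : Vect n M => v x, rfl⟩, fun _ _ => rfl⟩ : Vect n M →+ TangentSpace (𝓡 n) x)
        _ S
    rw [h2]
    refine Eq.trans ?_ (Finset.sum_smul (s := S) (f := fun c => (g c : M → ℝ) x) (x := u x))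
    rw [← h1, one_smul]
  change integralForms ν (lieDerivativeForms h0 hμ u) = 0
  rw [hu, map_sum, map_sum]
  exact Finset.sum_eq_zero fun c _ => integral_lieDerivative_smulField ν h0 hμ (g c) u (hs c)

/-- `u ↦ L_u μ`, as a linear map to the tangent space of `Prob(M)`. -/
def lieDerivativeLinear (ν : VolumeForm n M) {μ : FormField n M} (h0 : ∀ x, μ x ≠ 0)
    (hμ : μ ∈ smoothForms n M) : Vect n M →ₗ[ℝ] TangentProb ν where
  toFun u := ⟨lieDerivative μ u, lieDerivative_mem_smoothForms h0 hμ u,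
    integral_lieDerivative ν h0 hμ u⟩
  map_add' u v := Subtype.ext (lieDerivative_add hμ u v)
  map_smul' r u := Subtype.ext (lieDerivative_smul hμ r u)

lemma isTangent_lieDerivative {ν : VolumeForm n M} {μ : FormField n M} (h0 : ∀ x, μ x ≠ 0)
    (hμ : μ ∈ smoothForms n M) {φ : DiffCurve ν} {u : Vect n M} (h : IsVelocity φ u) :
    IsTangent μ φ (lieDerivative μ u) := by
  refine IsTangent.of_hasDerivAt_ratio h0 fun x => ?_
  have e : ratio (lieDerivative μ u) μ x = chartDivergence x μ u (extChartAt (𝓡 n) x x) :=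
    ratio_smul_self h0 (divergence μ u) x
  rw [e]
  exact hasDerivAt_ratio_pullback' h0 hμ u (Φ := fun p => (φ.toFun p.1).1 p.2)
    (mem_extChartAt_source x) φ.smooth.contMDiffAt (Eventually.of_forall φ.map_zero)
    (Eventually.of_forall h)

end Divergence

/-! ### The divergence of a bracket -/

section Bracket

variable {n : ℕ}

/-- This is `tr(AB) = tr(BA)`, which cancels the products of first derivatives in the divergence of
a bracket. -/
lemma sum_apply_comp_comm (A B : EuclideanSpace ℝ (Fin n) →L[ℝ] EuclideanSpace ℝ (Fin n)) :
    ∑ i, A (B (EuclideanSpace.single i 1)) i = ∑ i, B (A (EuclideanSpace.single i 1)) i := by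
  have h : ∀ A B : EuclideanSpace ℝ (Fin n) →L[ℝ] EuclideanSpace ℝ (Fin n),
      ∑ i, A (B (EuclideanSpace.single i 1)) i =
        ∑ i, ∑ j, B (EuclideanSpace.single i 1) j * A (EuclideanSpace.single j 1) i := by
    intro A B
    refine Finset.sum_congr rfl fun i _ => ?_
    exact sum_apply_single_smul ((EuclideanSpace.proj (𝕜 := ℝ) i).comp A) _
  rw [h, h, Finset.sum_comm]
  simp_rw [mul_comm]

/-- The divergence of a vector field on `ℝⁿ` for the density `exp h`. -/
def densityDivergence (h : EuclideanSpace ℝ (Fin n) → ℝ)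
    (U : EuclideanSpace ℝ (Fin n) → EuclideanSpace ℝ (Fin n)) (z : EuclideanSpace ℝ (Fin n)) : ℝ :=
  fderiv ℝ h z (U z) + ∑ i, fderiv ℝ U z (EuclideanSpace.single i 1) i

lemma differentiableAt_fderiv {V W : Type*} [NormedAddCommGroup V] [NormedSpace ℝ V]
    [NormedAddCommGroup W] [NormedSpace ℝ W] {f : V → W} {x : V} (hf : ContDiffAt ℝ ∞ f x) :
    DifferentiableAt ℝ (fderiv ℝ f) x :=
  (hf.fderiv_right (m := 1) (by norm_num; exact ENat.LEInfty.out)).differentiableAt (by simp)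

lemma hasFDerivAt_densityDivergence {h : EuclideanSpace ℝ (Fin n) → ℝ}
    {U : EuclideanSpace ℝ (Fin n) → EuclideanSpace ℝ (Fin n)} {y : EuclideanSpace ℝ (Fin n)}
    (hh : ContDiffAt ℝ ∞ h y) (hU : ContDiffAt ℝ ∞ U y) (p : EuclideanSpace ℝ (Fin n)) :
    fderiv ℝ (densityDivergence h U) y p = fderiv ℝ (fderiv ℝ h) y p (U y) +
      fderiv ℝ h y (fderiv ℝ U y p) +
      ∑ i, fderiv ℝ (fderiv ℝ U) y p (EuclideanSpace.single i 1) i := by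
  have h1 := (differentiableAt_fderiv hh).hasFDerivAt.clm_apply
    (hU.differentiableAt (by simp)).hasFDerivAt
  have h2 : ∀ i : Fin n, HasFDerivAt (fun z => fderiv ℝ U z (EuclideanSpace.single i 1) i)
      ((EuclideanSpace.proj (𝕜 := ℝ) i).comp ((fderiv ℝ (fderiv ℝ U) y).flip
        (EuclideanSpace.single i 1))) y := fun i => by
    have h3 := (differentiableAt_fderiv hU).hasFDerivAt.clm_apply
      (hasFDerivAt_const (EuclideanSpace.single i (1 : ℝ)) y)
    have h4 := (EuclideanSpace.proj (𝕜 := ℝ) i).hasFDerivAt.comp y h3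
    refine h4.congr_fderiv ?_
    simp
  have h3 := (h1.add (HasFDerivAt.fun_sum fun i (_ : i ∈ Finset.univ) => h2 i)).fderiv
  refine (congrArg (fun L : EuclideanSpace ℝ (Fin n) →L[ℝ] ℝ => L p) h3).trans ?_
  simp
  ring

/-- `div [U, V] = U (div V) - V (div U)`. -/
lemma densityDivergence_bracket {h : EuclideanSpace ℝ (Fin n) → ℝ}
    {U V W : EuclideanSpace ℝ (Fin n) → EuclideanSpace ℝ (Fin n)} {y : EuclideanSpace ℝ (Fin n)}
    (hh : ContDiffAt ℝ ∞ h y) (hU : ContDiffAt ℝ ∞ U y) (hV : ContDiffAt ℝ ∞ V y)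
    (hW : W =ᶠ[𝓝 y] fun z => fderiv ℝ V z (U z) - fderiv ℝ U z (V z)) :
    densityDivergence h W y = fderiv ℝ (densityDivergence h V) y (U y) -
      fderiv ℝ (densityDivergence h U) y (V y) := by
  have h2 : (2 : ℕ∞ω) ≤ ∞ := by exact ENat.LEInfty.out
  have sh : IsSymmSndFDerivAt ℝ h y := hh.isSymmSndFDerivAt (by simpa using h2)
  have sU : IsSymmSndFDerivAt ℝ U y := hU.isSymmSndFDerivAt (by simpa using h2)
  have sV : IsSymmSndFDerivAt ℝ V y := hV.isSymmSndFDerivAt (by simpa using h2)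
  have hUd := (hU.differentiableAt (by simp)).hasFDerivAt
  have hVd := (hV.differentiableAt (by simp)).hasFDerivAt
  have hWd := (((differentiableAt_fderiv hV).hasFDerivAt.clm_apply hUd).sub
    ((differentiableAt_fderiv hU).hasFDerivAt.clm_apply hVd)).fderiv
  have hWe : ∀ q, fderiv ℝ W y q = fderiv ℝ (fderiv ℝ V) y (U y) q + fderiv ℝ V y (fderiv ℝ U y q) -
      (fderiv ℝ (fderiv ℝ U) y (V y) q + fderiv ℝ U y (fderiv ℝ V y q)) := fun q => by
    rw [hW.fderiv_eq]
    refine (congrArg (fun L : EuclideanSpace ℝ (Fin n) →L[ℝ] EuclideanSpace ℝ (Fin n) => L q)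
      hWd).trans ?_
    -- Symmetry of the second derivatives puts `U y` and `V y` first, as in the derivatives of the
    -- divergences of `V` and `U`.
    rw [sV.eq (U y) q, sU.eq (V y) q]
    simp
    abel
  rw [hasFDerivAt_densityDivergence hh hU, hasFDerivAt_densityDivergence hh hV, densityDivergence,
    hW.self_of_nhds, map_sub, sh.eq (V y) (U y)]
  have : ∑ i, fderiv ℝ W y (EuclideanSpace.single i 1) i =
      ∑ i, fderiv ℝ (fderiv ℝ V) y (U y) (EuclideanSpace.single i 1) i -
      ∑ i, fderiv ℝ (fderiv ℝ U) y (V y) (EuclideanSpace.single i 1) i := by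
    have hc := sum_apply_comp_comm (fderiv ℝ V y) (fderiv ℝ U y)
    have e : ∀ i, fderiv ℝ W y (EuclideanSpace.single i 1) i =
      fderiv ℝ (fderiv ℝ V) y (U y) (EuclideanSpace.single i 1) i +
      fderiv ℝ V y (fderiv ℝ U y (EuclideanSpace.single i 1)) i -
      (fderiv ℝ (fderiv ℝ U) y (V y) (EuclideanSpace.single i 1) i +
      fderiv ℝ U y (fderiv ℝ V y (EuclideanSpace.single i 1)) i) := fun i => by
      rw [hWe]
      simp
    simp_rw [e]
    rw [Finset.sum_sub_distrib, Finset.sum_add_distrib, Finset.sum_add_distrib, hc]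
    ring
  rw [this]
  ring

variable {M : Type*} [TopologicalSpace M] [ChartedSpace (EuclideanSpace ℝ (Fin n)) M]
  [IsManifold (𝓡 n) ∞ M]

/-- The coefficient may be negative: `Real.log` is then the logarithm of its absolute value, whose
derivative is still the logarithmic derivative. No orientation assumption on the chart is needed. -/
lemma chartDivergence_eq_densityDivergence {μ : FormField n M} (h0 : ∀ x, μ x ≠ 0)
    (hμ : μ ∈ smoothForms n M) (u : Vect n M) {c : M} {y : EuclideanSpace ℝ (Fin n)}
    (hy : y ∈ (extChartAt (𝓡 n) c).target) :
    chartDivergence c μ u y =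
      densityDivergence (fun z => Real.log (chartCoeff c μ z)) (chartField c u) y := by
  have h1 := ((differentiableAt_chartCoeff hμ hy).hasFDerivAt.log (chartCoeff_ne_zero h0 hy)).fderiv
  rw [chartDivergence_eq h0 hμ u hy, densityDivergence, h1]
  congr 1
  refine Finset.sum_congr rfl fun i _ => ?_
  have := ((EuclideanSpace.proj (𝕜 := ℝ) i).hasFDerivAt.comp y
    (differentiableAt_chartField hy u).hasFDerivAt).fderiv
  exact congrArg (fun L : EuclideanSpace ℝ (Fin n) →L[ℝ] ℝ => L (EuclideanSpace.single i 1)) this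

/-- `div [u, v] = u (div v) - v (div u)`, in a chart. -/
lemma divergence_lie {μ : FormField n M} (h0 : ∀ x, μ x ≠ 0) (hμ : μ ∈ smoothForms n M)
    (u v : Vect n M) {c : M} {y : EuclideanSpace ℝ (Fin n)}
    (hy : y ∈ (extChartAt (𝓡 n) c).target) :
    divergence μ ⁅u, v⁆ ((extChartAt (𝓡 n) c).symm y) =
      ∑ i, chartField c u y i * chartGrad c (divergence μ v) y i -
      ∑ i, chartField c v y i * chartGrad c (divergence μ u) y i := by
  have hU := isOpen_extChartAt_target (I := 𝓡 n) c
  have hlog : ContDiffAt ℝ ∞ (fun z => Real.log (chartCoeff c μ z)) y :=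
    ((contDiffOn_chartCoeff hμ c).contDiffAt (hU.mem_nhds hy)).log (chartCoeff_ne_zero h0 hy)
  have hf : ∀ w : Vect n M, ContDiffAt ℝ ∞ (chartField c w) y := fun w =>
    (contDiffOn_chartField c w).contDiffAt (hU.mem_nhds hy)
  have hd : ∀ w : Vect n M, divergence μ w ∘ (extChartAt (𝓡 n) c).symm =ᶠ[𝓝 y]
      densityDivergence (fun z => Real.log (chartCoeff c μ z)) (chartField c w) := fun w => by
    filter_upwards [hU.mem_nhds hy] with z hz
    rw [Function.comp_apply, divergence_eq_chartDivergence h0 hμ w hz,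
      chartDivergence_eq_densityDivergence h0 hμ w hz]
  rw [divergence_eq_chartDivergence h0 hμ _ hy, chartDivergence_eq_densityDivergence h0 hμ _ hy,
    densityDivergence_bracket hlog (hf u) (hf v) (by
      filter_upwards [hU.mem_nhds hy] with z hz
      exact chartField_lie hz u v), ← (hd u).fderiv_eq, ← (hd v).fderiv_eq,
    sum_apply_single_smul _ (chartField c u y), sum_apply_single_smul _ (chartField c v y)]
  rfl

end Bracket

/-! ### Closedness for the Chevalley–Eilenberg differential -/

section Closedness

/-- Laplace expansion of a determinant whose first column depends on the others. -/
lemma sum_neg_one_pow_mul_det_eq_zero {n : ℕ} (G : Fin (n + 1) → Fin n → ℝ) (X : Fin n → ℝ) :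
    ∑ i : Fin (n + 1), (-1) ^ (i : ℕ) * (∑ k, X k * G i k) *
      Matrix.det (Matrix.of fun l : Fin n => G (i.succAbove l)) = 0 := by
  set A : Matrix (Fin (n + 1)) (Fin (n + 1)) ℝ := Matrix.of fun i =>
    (Fin.cons (∑ k, X k * G i k) (G i) : Fin (n + 1) → ℝ) with hA
  have h1 : A.det = 0 := by
    -- The first column is the combination of the others with coefficients `X`, so `(-1, X)` lies in
    -- the kernel.
    refine Matrix.exists_mulVec_eq_zero_iff.1 ⟨Fin.cons (-1) X, fun h => ?_, ?_⟩
    · have := congrFun h 0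
      simp at this
    · ext i
      simp only [Matrix.mulVec, dotProduct, hA, Matrix.of_apply, Fin.sum_univ_succ, Fin.cons_zero,
        Fin.cons_succ, Pi.zero_apply]
      simp_rw [mul_comm (G i _)]
      ring
  rw [← h1, Matrix.det_succ_column_zero]
  rfl

/-- The sum of the values of a function of two distinct indices, over the unordered pairs. -/
lemma sum_ite_castSucc_lt {n : ℕ} (T : Fin (n + 2) → Fin (n + 1) → ℝ) :
    ∑ j : Fin (n + 2), ∑ i : Fin (n + 1), (if i.castSucc < j then
      T j i + T (j.succAbove i) (i.predAbove j) else 0) = ∑ j, ∑ i, T j i := by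
  -- A pair `(j, i)` encodes the two distinct indices `j` and `j.succAbove i`; the involution `σ`
  -- exchanges their roles.
  set σ : Fin (n + 2) × Fin (n + 1) → Fin (n + 2) × Fin (n + 1) :=
    fun p => (p.1.succAbove p.2, p.2.predAbove p.1) with hσ
  have hinv : Function.Involutive σ := by
    rintro ⟨j, i⟩
    simp only [hσ, Prod.mk.injEq]
    exact ⟨Fin.succAbove_succAbove_predAbove _ _, Fin.predAbove_predAbove_succAbove _ _⟩
  have hP : ∀ p, (σ p).2.castSucc < (σ p).1 ↔ ¬ p.2.castSucc < p.1 := by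
    rintro ⟨j, i⟩
    simp only [hσ]
    by_cases h : i.castSucc < j
    · rw [Fin.succAbove_of_castSucc_lt _ _ h, Fin.predAbove_of_castSucc_lt _ _ h]
      simp only [h, not_true, iff_false, not_lt]
      rw [Fin.le_def]
      rw [Fin.lt_def] at h
      simp at h ⊢
      omega
    · rw [Fin.succAbove_of_le_castSucc _ _ (not_lt.1 h), Fin.predAbove_of_le_castSucc _ _ (not_lt.1 h)]
      simp only [h, not_false_iff, iff_true]
      rw [not_lt, Fin.le_def] at h
      rw [Fin.lt_def]
      simp at h ⊢
      omega
  simp_rw [← Fintype.sum_prod_type']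
  have h1 : ∑ p : Fin (n + 2) × Fin (n + 1), (if p.2.castSucc < p.1 then 0 else T p.1 p.2) =
      ∑ p : Fin (n + 2) × Fin (n + 1), (if p.2.castSucc < p.1 then T (σ p).1 (σ p).2 else 0) := by
    rw [← Equiv.sum_comp hinv.toPerm]
    refine Finset.sum_congr rfl fun p _ => ?_
    change (if (σ p).2.castSucc < (σ p).1 then 0 else T (σ p).1 (σ p).2) = _
    simp only [hP]
    by_cases h : p.2.castSucc < p.1 <;> simp [h]
  have h2 : ∑ p : Fin (n + 2) × Fin (n + 1), T p.1 p.2 =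
      ∑ p : Fin (n + 2) × Fin (n + 1), (if p.2.castSucc < p.1 then T p.1 p.2 else 0) +
      ∑ p : Fin (n + 2) × Fin (n + 1), (if p.2.castSucc < p.1 then 0 else T p.1 p.2) := by
    rw [← Finset.sum_add_distrib]
    refine Finset.sum_congr rfl fun p _ => ?_
    by_cases h : p.2.castSucc < p.1 <;> simp [h]
  rw [h2, h1, ← Finset.sum_add_distrib]
  refine Finset.sum_congr rfl fun p _ => ?_
  by_cases h : p.2.castSucc < p.1 <;> simp [h, hσ]

/-- The pointwise core of the cocycle identity. Up to sign, the two halves of each term are `T` at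
an ordered pair and at the exchanged pair, so the sum over `i < j` is minus the sum of `T` over all
ordered pairs. For fixed `j` the latter is a Laplace expansion of a determinant with dependent
columns. -/
lemma sum_wedge_eq_zero {n : ℕ} (G X : Fin (n + 2) → Fin n → ℝ) :
    ∑ j : Fin (n + 2), ∑ i : Fin (n + 1), (if i.castSucc < j then (-1) ^ ((i : ℕ) + (j : ℕ)) *
      ((∑ k, X i.castSucc k * G j k - ∑ k, X j k * G i.castSucc k) *
        Matrix.det (Matrix.of (i.removeNth (j.removeNth G)))) else 0) = 0 := by
  set T : Fin (n + 2) → Fin (n + 1) → ℝ := fun j i => (-1) ^ ((i : ℕ) + (j : ℕ)) *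
    ((∑ k, X j k * G (j.succAbove i) k) *
      Matrix.det (Matrix.of (i.removeNth (j.removeNth G)))) with hT
  have h1 : ∀ (j : Fin (n + 2)) (i : Fin (n + 1)), T (j.succAbove i) (i.predAbove j) = -((-1) ^ ((i : ℕ) + (j : ℕ)) *
      ((∑ k, X (j.succAbove i) k * G j k) *
      Matrix.det (Matrix.of (i.removeNth (j.removeNth G))))) := by
    intro j i
    rw [hT]
    simp only
    rw [← Fin.removeNth_removeNth_eq_swap, Fin.succAbove_succAbove_predAbove,
      add_comm, Fin.neg_one_pow_succAbove_add_predAbove, add_comm (j : ℕ)]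
    ring
  have h2 : ∑ j, ∑ i, T j i = 0 := by
    refine Finset.sum_eq_zero fun j _ => ?_
    have h := sum_neg_one_pow_mul_det_eq_zero (fun i => G (j.succAbove i)) (X j)
    have h3 := congrArg (fun r => (-1) ^ (j : ℕ) * r) h
    simp only [mul_zero, Finset.mul_sum] at h3
    rw [← h3]
    refine Finset.sum_congr rfl fun i _ => ?_
    rw [hT]
    simp only [pow_add]
    rw [mul_comm ((-1 : ℝ) ^ (i : ℕ)), mul_assoc, ← mul_assoc ((-1 : ℝ) ^ (i : ℕ)), Finset.mul_sum]
    rfl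
  rw [← sum_ite_castSucc_lt] at h2
  refine neg_eq_zero.1 (Eq.trans ?_ h2)
  rw [← Finset.sum_neg_distrib]
  refine Finset.sum_congr rfl fun j _ => ?_
  rw [← Finset.sum_neg_distrib]
  refine Finset.sum_congr rfl fun i _ => ?_
  by_cases h : i.castSucc < j
  · rw [if_pos h, if_pos h, h1, hT, Fin.succAbove_of_castSucc_lt _ _ h]
    simp only
    rw [Fin.succAbove_of_castSucc_lt _ _ h]
    ring
  · rw [if_neg h, if_neg h, neg_zero]

variable {n : ℕ} {M : Type*} [TopologicalSpace M] [ChartedSpace (EuclideanSpace ℝ (Fin n)) M]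
  [IsManifold (𝓡 n) ∞ M] [T2Space M] [CompactSpace M]

/-- The form `omegaForm` is closed on the Lie algebra of vector fields. -/
theorem lieDifferential_omega_eq_zero (ν : VolumeForm n M) {μ : FormField n M}
    (h0 : ∀ x, μ x ≠ 0) (hμ : μ ∈ smoothForms n M) (u : Fin (n + 2) → Vect n M) :
    lieDifferential ((omegaAlternating ν hμ h0).compLinearMap (lieDerivativeLinear ν h0 hμ)) u =
      0 := by
  set d : Vect n M → smoothFunctions n M := fun v =>
    ⟨divergence μ v, contMDiff_divergence h0 hμ v⟩ with hd
  set F : Fin (n + 2) → Fin (n + 1) → smoothForms n M := fun j i =>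
    ⟨wedgeForm fun k => (d ((Fin.cons ⁅u i.castSucc, u j⁆ (i.removeNth (j.removeNth u)) :
      Fin (n + 1) → Vect n M) k) : M → ℝ), wedgeForm_mem_smoothForms fun k => (d _).2⟩ with hF
  have hval : ∀ j i, ((omegaAlternating ν hμ h0).compLinearMap (lieDerivativeLinear ν h0 hμ))
      (Fin.cons ⁅u i.castSucc, u j⁆ (i.removeNth (j.removeNth u))) = integralForms ν (F j i) := by
    intro j i
    change ν.integral (wedgeForm _) = ν.integral (wedgeForm _)
    congr 2
    funext k x
    exact ratio_smul_self h0 _ x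
  -- The alternating sum already vanishes as a differential form. Integration enters only through
  -- its linearity.
  have hsum : ∑ j : Fin (n + 2), ∑ i : Fin (n + 1), (if i.castSucc < j then
      ((-1 : ℝ) ^ ((i : ℕ) + (j : ℕ))) • F j i else 0) = 0 := by
    refine Subtype.ext (form_ext fun c y hy => ?_)
    have hlin : ∀ η : smoothForms n M, chartCoeff c (η : FormField n M) y =
        (⟨⟨fun η => chartCoeff c (η : FormField n M) y, fun _ _ => rfl⟩, fun _ _ => rfl⟩ :
          smoothForms n M →ₗ[ℝ] ℝ) η := fun _ => rfl
    rw [hlin, map_sum]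
    simp_rw [map_sum]
    have hz : chartCoeff c ((0 : smoothForms n M) : FormField n M) y = 0 := rfl
    rw [hz, ← sum_wedge_eq_zero (fun j => chartGrad c (divergence μ (u j)) y)
      (fun j k => chartField c (u j) y k)]
    refine Finset.sum_congr rfl fun j _ => Finset.sum_congr rfl fun i _ => ?_
    by_cases h : i.castSucc < j
    · rw [if_pos h, if_pos h, map_smul, ← hlin, smul_eq_mul]
      congr 1
      rw [hF]
      simp only
      rw [chartCoeff_wedgeForm_coe (fun k => d _) hy]
      congr 1
      exact divergence_lie h0 hμ _ _ hy
    · rw [if_neg h, if_neg h, map_zero]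
  rw [lieDifferential]
  simp_rw [hval]
  have := congrArg (integralForms ν) hsum
  rw [map_zero, map_sum] at this
  refine Eq.trans (Finset.sum_congr rfl fun j _ => ?_) this
  rw [map_sum]
  refine Finset.sum_congr rfl fun i _ => ?_
  by_cases h : i.castSucc < j
  · rw [if_pos h, if_pos h, map_smul, smul_eq_mul]
  · rw [if_neg h, if_neg h, map_zero]

end Closedness

/-! ### Perturbations of the identity of Euclidean space -/

section Perturbation

variable {n : ℕ}

local notation "𝔼" => EuclideanSpace ℝ (Fin n)

/-- The perturbation of the identity by a map with a small Lipschitz constant is a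
diffeomorphism. -/
lemma exists_homeomorph_id_add {w : 𝔼 → 𝔼} (hw : ContDiff ℝ ∞ w) {C : NNReal}
    (hC : LipschitzWith C w) (hC1 : C < 1) :
    ∃ h : 𝔼 ≃ₜ 𝔼, (∀ y, h y = y + w y) ∧ ContDiff ℝ ∞ h.symm := by
  have happ : ApproximatesLinearOn (fun y => y + w y)
      ((ContinuousLinearEquiv.refl ℝ 𝔼 : 𝔼 ≃L[ℝ] 𝔼) : 𝔼 →L[ℝ] 𝔼) univ C := by
    rintro x - y -
    have e : (x + w x) - (y + w y) - (x - y) = w x - w y := by abel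
    change ‖(x + w x) - (y + w y) - (x - y)‖ ≤ C * ‖x - y‖
    rw [e]
    exact hC.norm_sub_le x y
  -- In dimension zero the identity has norm zero rather than one, so that case is separated.
  have hsub : Subsingleton 𝔼 ∨ C < ‖((ContinuousLinearEquiv.refl ℝ 𝔼).symm : 𝔼 →L[ℝ] 𝔼)‖₊⁻¹ := by
    rcases subsingleton_or_nontrivial 𝔼 with h | h
    · exact Or.inl h
    · right
      have : ‖((ContinuousLinearEquiv.refl ℝ 𝔼).symm : 𝔼 →L[ℝ] 𝔼)‖₊ = 1 :=
        NNReal.eq ContinuousLinearMap.norm_id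
      rw [this, inv_one]
      exact hC1
  refine ⟨happ.toHomeomorph _ hsub, fun y => rfl, ?_⟩
  have hlt : ∀ y, ‖-fderiv ℝ w y‖ < 1 := fun y => by
    rw [norm_neg]
    exact (norm_fderiv_le_of_lipschitz ℝ hC).trans_lt (by exact_mod_cast hC1)
  -- The derivative `1 + Dw` is invertible by the Neumann series for `1 - (-Dw)`, hence the inverse
  -- is smooth.
  refine Homeomorph.contDiff_symm _
    (f₀' := fun y => ContinuousLinearEquiv.ofUnit (Units.oneSub _ (hlt y))) (fun y => ?_)
    (contDiff_id.add hw)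
  have h1 := (hasFDerivAt_id y).add (hw.differentiable (by simp) y).hasFDerivAt
  refine h1.congr_fderiv ?_
  ext1 v
  change _ = (1 - -fderiv ℝ w y) v
  simp

end Perturbation

/-! ### Diffeomorphisms supported in a chart -/

section Glue

variable {n : ℕ} {M : Type*} [TopologicalSpace M] [ChartedSpace (EuclideanSpace ℝ (Fin n)) M]

open Classical in
/-- The map of `M` that is `g` in the chart around `c`, and the identity outside the chart. -/
def glue (c : M) (g : EuclideanSpace ℝ (Fin n) → EuclideanSpace ℝ (Fin n)) (x : M) : M :=
  if x ∈ (extChartAt (𝓡 n) c).source then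
    (extChartAt (𝓡 n) c).symm (g (extChartAt (𝓡 n) c x)) else x

/-- The map `g` preserves `K` and is the identity outside `K`. -/
def IsSupportedIn (K : Set (EuclideanSpace ℝ (Fin n)))
    (g : EuclideanSpace ℝ (Fin n) → EuclideanSpace ℝ (Fin n)) : Prop :=
  (∀ y ∉ K, g y = y) ∧ MapsTo g K K

lemma glue_of_mem {c x : M} (hx : x ∈ (extChartAt (𝓡 n) c).source)
    (g : EuclideanSpace ℝ (Fin n) → EuclideanSpace ℝ (Fin n)) :
    glue c g x = (extChartAt (𝓡 n) c).symm (g (extChartAt (𝓡 n) c x)) := if_pos hx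

lemma glue_of_notMem {c x : M} (hx : x ∉ (extChartAt (𝓡 n) c).source)
    (g : EuclideanSpace ℝ (Fin n) → EuclideanSpace ℝ (Fin n)) : glue c g x = x := if_neg hx

variable {K : Set (EuclideanSpace ℝ (Fin n))} {c : M}

lemma IsSupportedIn.mapsTo {g : EuclideanSpace ℝ (Fin n) → EuclideanSpace ℝ (Fin n)}
    (hg : IsSupportedIn K g) {s : Set (EuclideanSpace ℝ (Fin n))} (hK : K ⊆ s) : MapsTo g s s := by
  intro y hy
  by_cases h : y ∈ K
  · exact hK (hg.2 h)
  · rwa [hg.1 y h]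

lemma extChartAt_glue {g : EuclideanSpace ℝ (Fin n) → EuclideanSpace ℝ (Fin n)}
    (hg : IsSupportedIn K g) (hK : K ⊆ (extChartAt (𝓡 n) c).target)
    {y : EuclideanSpace ℝ (Fin n)} (hy : y ∈ (extChartAt (𝓡 n) c).target) :
    extChartAt (𝓡 n) c (glue c g ((extChartAt (𝓡 n) c).symm y)) = g y := by
  rw [glue_of_mem ((extChartAt (𝓡 n) c).map_target hy), (extChartAt (𝓡 n) c).right_inv hy,
    (extChartAt (𝓡 n) c).right_inv (hg.mapsTo hK hy)]

lemma glue_glue {g h : EuclideanSpace ℝ (Fin n) → EuclideanSpace ℝ (Fin n)}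
    (hh : IsSupportedIn K h) (hK : K ⊆ (extChartAt (𝓡 n) c).target) (hgh : ∀ y, g (h y) = y)
    (x : M) : glue c g (glue c h x) = x := by
  by_cases hx : x ∈ (extChartAt (𝓡 n) c).source
  · have hy := hh.mapsTo hK ((extChartAt (𝓡 n) c).map_source hx)
    rw [glue_of_mem hx, glue_of_mem ((extChartAt (𝓡 n) c).map_target hy),
      (extChartAt (𝓡 n) c).right_inv hy, hgh, (extChartAt (𝓡 n) c).left_inv hx]
  · rw [glue_of_notMem hx, glue_of_notMem hx]

lemma glue_of_notMem_image {g : EuclideanSpace ℝ (Fin n) → EuclideanSpace ℝ (Fin n)}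
    (hg : IsSupportedIn K g) {x : M} (hx : x ∉ (extChartAt (𝓡 n) c).symm '' K) :
    glue c g x = x := by
  by_cases h : x ∈ (extChartAt (𝓡 n) c).source
  · rw [glue_of_mem h, hg.1, (extChartAt (𝓡 n) c).left_inv h]
    exact fun hK => hx ⟨_, hK, (extChartAt (𝓡 n) c).left_inv h⟩
  · exact glue_of_notMem h g

lemma isClosed_symm_image [T2Space M] (hKc : IsCompact K)
    (hK : K ⊆ (extChartAt (𝓡 n) c).target) : IsClosed ((extChartAt (𝓡 n) c).symm '' K) :=
  (hKc.image_of_continuousOn ((continuousOn_extChartAt_symm c).mono hK)).isClosed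

variable [IsManifold (𝓡 n) ∞ M] [T2Space M]

/-- Inside the chart the map is a composition of smooth maps. A point outside the chart lies off the
closed image of `K`, near which the map is the identity; the same `K` serves all parameters, so this
holds jointly. -/
lemma contMDiff_glue {P : Type*} [NormedAddCommGroup P] [NormedSpace ℝ P]
    {G : P × EuclideanSpace ℝ (Fin n) → EuclideanSpace ℝ (Fin n)} (hG : ContDiff ℝ ∞ G)
    (hKc : IsCompact K) (hK : K ⊆ (extChartAt (𝓡 n) c).target)
    (hs : ∀ t, IsSupportedIn K fun y => G (t, y)) :
    ContMDiff (𝓘(ℝ, P).prod (𝓡 n)) (𝓡 n) ∞ fun p : P × M => glue c (fun y => G (p.1, y)) p.2 := by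
  rintro ⟨t, x⟩
  by_cases hx : x ∈ (extChartAt (𝓡 n) c).source
  · have h1 : ContMDiffAt (𝓘(ℝ, P).prod (𝓡 n)) 𝓘(ℝ, EuclideanSpace ℝ (Fin n)) ∞
        (fun q : P × M => extChartAt (𝓡 n) c q.2) (t, x) :=
      (contMDiffAt_extChartAt' (n := ∞) (by simpa using hx)).comp (t, x) contMDiffAt_snd
    have h2 : ContMDiffAt (𝓘(ℝ, P).prod (𝓡 n)) 𝓘(ℝ, P × EuclideanSpace ℝ (Fin n)) ∞
        (fun q : P × M => (q.1, extChartAt (𝓡 n) c q.2)) (t, x) :=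
      ContMDiffAt.prodMk_space contMDiffAt_fst h1
    have h3 : ContMDiffAt (𝓘(ℝ, P).prod (𝓡 n)) 𝓘(ℝ, EuclideanSpace ℝ (Fin n)) ∞
        (fun q : P × M => G (q.1, extChartAt (𝓡 n) c q.2)) (t, x) :=
      hG.contMDiff.contMDiffAt.comp (t, x) h2
    have h4 : ContMDiffAt (𝓡 n) (𝓡 n) ∞ (extChartAt (𝓡 n) c).symm
        (G (t, extChartAt (𝓡 n) c x)) :=
      (contMDiffOn_extChartAt_symm c).contMDiffAt ((isOpen_extChartAt_target c).mem_nhds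
        ((hs t).mapsTo hK ((extChartAt (𝓡 n) c).map_source hx)))
    refine (ContMDiffAt.comp (t, x) h4 h3).congr_of_eventuallyEq ?_
    filter_upwards [continuous_snd.continuousAt.eventually
      ((isOpen_extChartAt_source c).mem_nhds hx)] with q hq
    exact glue_of_mem hq _
  · have hx2 : x ∉ (extChartAt (𝓡 n) c).symm '' K := by
      rintro ⟨y, hy, rfl⟩
      exact hx ((extChartAt (𝓡 n) c).map_target (hK hy))
    refine contMDiffAt_snd.congr_of_eventuallyEq ?_
    filter_upwards [continuous_snd.continuousAt.eventually
      ((isClosed_symm_image hKc hK).isOpen_compl.mem_nhds hx2)] with q hq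
    exact glue_of_notMem_image (hs q.1) hq

lemma contMDiff_glue_const {g : EuclideanSpace ℝ (Fin n) → EuclideanSpace ℝ (Fin n)}
    (hg : ContDiff ℝ ∞ g) (hKc : IsCompact K) (hK : K ⊆ (extChartAt (𝓡 n) c).target)
    (hs : IsSupportedIn K g) : ContMDiff (𝓡 n) (𝓡 n) ∞ (glue c g) :=
  (contMDiff_glue (P := ℝ) (G := fun q => g q.2) (hg.comp contDiff_snd) hKc hK fun _ => hs).comp
    ((contMDiff_const (c := (0 : ℝ))).prodMk contMDiff_id)

/-- A diffeomorphism of `ℝⁿ` supported in the range of a chart defines one of `M`. -/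
def glueDiffeomorph {h : EuclideanSpace ℝ (Fin n) ≃ EuclideanSpace ℝ (Fin n)}
    (h1 : ContDiff ℝ ∞ h) (h2 : ContDiff ℝ ∞ h.symm) (hKc : IsCompact K)
    (hK : K ⊆ (extChartAt (𝓡 n) c).target) (hs : IsSupportedIn K h)
    (hs' : IsSupportedIn K h.symm) : M ≃ₘ^∞⟮𝓡 n, 𝓡 n⟯ M where
  toFun := glue c h
  invFun := glue c h.symm
  left_inv := glue_glue hs hK h.symm_apply_apply
  right_inv := glue_glue hs' hK h.apply_symm_apply
  contMDiff_toFun := contMDiff_glue_const h1 hKc hK hs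
  contMDiff_invFun := contMDiff_glue_const h2 hKc hK hs'

end Glue

/-! ### Curves of diffeomorphisms and their tangent functions -/

section Curves

variable {n : ℕ} {M : Type*} [TopologicalSpace M] [ChartedSpace (EuclideanSpace ℝ (Fin n)) M]
  [IsManifold (𝓡 n) ∞ M] [T2Space M] [CompactSpace M]

omit [IsManifold (𝓡 n) ∞ M] [T2Space M] [CompactSpace M] in
-- Applied to `φ⁻¹ ∘ φ = id`, multiplicativity makes the Jacobian a factor of one.
lemma ratio_pullback_diffeomorph_ne_zero {ν : FormField n M} (h0 : ∀ x, ν x ≠ 0)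
    (φ : M ≃ₘ^∞⟮𝓡 n, 𝓡 n⟯ M) (x : M) : ratio (pullback φ ν) ν x ≠ 0 := by
  have h1 : MDifferentiable (𝓡 n) (𝓡 n) φ := φ.contMDiff.mdifferentiable (by simp)
  have h2 : MDifferentiable (𝓡 n) (𝓡 n) φ.symm := φ.symm.contMDiff.mdifferentiable (by simp)
  have h := ratio_pullback_comp h0 (h1 x) (h2 (φ x))
  have e : φ.symm ∘ φ = id := funext φ.symm_apply_apply
  rw [e, ratio_eq_of_smul (h0 x) (r := 1) (by rw [pullback_id, one_smul])] at h
  intro h3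
  rw [h3, mul_zero] at h
  exact one_ne_zero h

omit [T2Space M] [CompactSpace M] in
/-- The Jacobian of a smooth family of maps is a smooth function of the parameter. -/
lemma contDiff_ratio_pullback_left {P : Type*} [NormedAddCommGroup P] [NormedSpace ℝ P]
    {μ : FormField n M} (h0 : ∀ x, μ x ≠ 0) (hμ : μ ∈ smoothForms n M) {Φ : P × M → M}
    (hΦ : ContMDiff (𝓘(ℝ, P).prod (𝓡 n)) (𝓡 n) ∞ Φ) (x : M) :
    ContDiff ℝ ∞ fun t => ratio (pullback (fun x => Φ (t, x)) μ) μ x := by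
  have h := contDiffOn_ratio_pullback h0 hμ hΦ x
  have h2 : ContDiff ℝ ∞ fun t : P => (t, extChartAt (𝓡 n) x x) := contDiff_prodMk_left _
  have h3 := h.comp_contDiff h2 fun t => ⟨mem_univ _, mem_extChartAt_target x⟩
  simpa [Function.comp_def] using h3

omit [T2Space M] [CompactSpace M] in
/-- A smooth family of diffeomorphisms through the identity preserves the orientation. -/
lemma ratio_pullback_family_pos (ν : VolumeForm n M) {Φ : ℝ → M ≃ₘ^∞⟮𝓡 n, 𝓡 n⟯ M}
    (hΦ : ContMDiff (𝓘(ℝ, ℝ).prod (𝓡 n)) (𝓡 n) ∞ fun p : ℝ × M => Φ p.1 p.2)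
    (hid : ∀ x, Φ 0 x = x) (t : ℝ) (x : M) :
    0 < ratio (pullback (Φ t) ν.toForm) ν.toForm x := by
  have hc : Continuous fun t => ratio (pullback (Φ t) ν.toForm) ν.toForm x :=
    (contDiff_ratio_pullback_left ν.ne_zero ν.smooth hΦ x).continuous
  have h1 : ratio (pullback (Φ 0) ν.toForm) ν.toForm x = 1 := by
    rw [show (Φ 0 : M → M) = id from funext hid,
      ratio_eq_of_smul (ν.ne_zero x) (r := 1) (by rw [pullback_id, one_smul])]
  by_contra! hneg
  -- By the intermediate value theorem a Jacobian that is one at time zero and not positive at time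
  -- `t` vanishes at some time, which is impossible for a diffeomorphism.
  obtain ⟨s, hs⟩ := mem_range_of_exists_le_of_exists_ge hc ⟨t, hneg⟩ ⟨0, h1.symm ▸ zero_le_one⟩
  exact ratio_pullback_diffeomorph_ne_zero ν.ne_zero (Φ s) x hs

/-- The curve in `Diff(M)` defined by a smooth family of diffeomorphisms. -/
def DiffCurve.ofFamily (ν : VolumeForm n M) (Φ : ℝ → M ≃ₘ^∞⟮𝓡 n, 𝓡 n⟯ M)
    (hΦ : ContMDiff (𝓘(ℝ, ℝ).prod (𝓡 n)) (𝓡 n) ∞ fun p : ℝ × M => Φ p.1 p.2)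
    (hid : ∀ x, Φ 0 x = x) : DiffCurve ν where
  toFun t := ⟨Φ t, ratio_pullback_family_pos ν hΦ hid t⟩
  smooth := hΦ
  map_zero := hid

/-- The derivative of the Jacobian of a composition of two curves. -/
lemma hasDerivAt_ratio_pullback_comp {ν : VolumeForm n M} {μ : FormField n M}
    (h0 : ∀ x, μ x ≠ 0) (hμ : μ ∈ smoothForms n M) (φ ψ : DiffCurve ν) {x : M} {a b : ℝ}
    (ha : HasDerivAt (fun t => ratio (pullback (φ.toFun t).1 μ) μ x) a 0)
    (hb : HasDerivAt (fun t => ratio (pullback (ψ.toFun t).1 μ) μ x) b 0) :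
    HasDerivAt (fun t => ratio (pullback ((φ.toFun t).1 ∘ (ψ.toFun t).1) μ) μ x) (a + b) 0 := by
  have hy := mem_extChartAt_target (I := 𝓡 n) x
  set y := extChartAt (𝓡 n) x x with hydef
  set F : ℝ × EuclideanSpace ℝ (Fin n) → ℝ := fun q =>
    ratio (pullback (φ.toFun q.1).1 μ) μ ((extChartAt (𝓡 n) x).symm q.2) with hF
  have hFd : DifferentiableAt ℝ F (0, y) := ((contDiffOn_ratio_pullback h0 hμ φ.smooth x).contDiffAt
    ((isOpen_univ.prod (isOpen_extChartAt_target x)).mem_nhds ⟨mem_univ _, hy⟩)).differentiableAt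
      (by simp)
  have hψx : ContMDiff 𝓘(ℝ, ℝ) (𝓡 n) ∞ fun t : ℝ => (ψ.toFun t).1 x :=
    ψ.smooth.comp (contMDiff_id.prodMk contMDiff_const)
  have hψ0 : (ψ.toFun 0).1 x = x := ψ.map_zero x
  have hγ : DifferentiableAt ℝ (fun t : ℝ => extChartAt (𝓡 n) x ((ψ.toFun t).1 x)) 0 := by
    have h1 : MDifferentiableAt (𝓡 n) (𝓡 n) (extChartAt (𝓡 n) x) ((ψ.toFun 0).1 x) := by
      rw [hψ0]
      exact mdifferentiableAt_extChartAt' (mem_extChartAt_source x)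
    exact (h1.comp (0 : ℝ) (hψx.mdifferentiableAt (by simp))).differentiableAt
  set v := deriv (fun t : ℝ => extChartAt (𝓡 n) x ((ψ.toFun t).1 x)) 0 with hv
  have hγ2 : HasDerivAt (fun t : ℝ => (t, extChartAt (𝓡 n) x ((ψ.toFun t).1 x)))
      ((1 : ℝ), v) 0 := (hasDerivAt_id (0 : ℝ)).prodMk hγ.hasDerivAt
  have hF2 : HasFDerivAt F (fderiv ℝ F (0, y)) (0, extChartAt (𝓡 n) x ((ψ.toFun 0).1 x)) := by
    rw [hψ0]
    exact hFd.hasFDerivAt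
  have h1 := hF2.comp_hasDerivAt (0 : ℝ) hγ2
  have e1 : fderiv ℝ F (0, y) (1, 0) = a := by
    rw [← fderiv_mk_left hFd]
    have : (fun t => F (t, y)) = fun t => ratio (pullback (φ.toFun t).1 μ) μ x := by
      funext t
      rw [hF]
      simp only
      rw [hydef, extChartAt_to_inv]
    rw [this]
    exact ha.deriv
  -- At time zero the Jacobian of `φ` is one at every point, so displacing the base point by `ψ` has
  -- no effect to first order.
  have e2 : fderiv ℝ F (0, y) (0, v) = 0 := by
    rw [← fderiv_mk_right hFd]
    have : (fun z => F (0, z)) = fun _ => 1 := funext fun z => ratio_pullback_zero h0 φ _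
    rw [this]
    simp
  have e3 : fderiv ℝ F (0, y) (1, v) = a := by
    have : ((1 : ℝ), v) = (1, 0) + (0, v) := by simp
    rw [this, map_add, e1, e2, add_zero]
  rw [e3] at h1
  have h2 := h1.mul hb
  have hF0 : F (0, extChartAt (𝓡 n) x ((ψ.toFun 0).1 x)) = 1 := ratio_pullback_zero h0 φ _
  refine (h2.congr_deriv ?_).congr_of_eventuallyEq ?_
  · rw [ratio_pullback_zero h0, Function.comp_apply, hF0]
    ring
  · have hcont : Tendsto (fun t : ℝ => (ψ.toFun t).1 x) (𝓝 0) (𝓝 x) := by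
      have := hψx.continuous.tendsto 0
      rwa [hψ0] at this
    filter_upwards [hcont.eventually (extChartAt_source_mem_nhds (I := 𝓡 n) x)] with t ht
    rw [ratio_pullback_comp h0 (mdifferentiable_diff _ _) (mdifferentiable_diff _ _)]
    change _ = F _ * _
    rw [hF]
    simp only
    rw [(extChartAt (𝓡 n) x).left_inv ht]

/-- The functions `f` such that `f μ` is tangent to a curve `(φ^t)^* μ`. -/
def tangentFunctions (ν : VolumeForm n M) {μ : FormField n M} (h0 : ∀ x, μ x ≠ 0)
    (hμ : μ ∈ smoothForms n M) : Submodule ℝ (M → ℝ) where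
  carrier := {f | ∃ φ : DiffCurve ν, ∀ x,
    HasDerivAt (fun t => ratio (pullback (φ.toFun t).1 μ) μ x) (f x) 0}
  zero_mem' := ⟨DiffCurve.ofFamily ν (fun _ => Diffeomorph.refl (𝓡 n) M ∞) contMDiff_snd
    fun _ => rfl, fun x => hasDerivAt_const (0 : ℝ) (ratio (pullback id μ) μ x)⟩
  -- Composition of curves adds the tangent functions; reparametrization of time multiplies them by
  -- scalars.
  add_mem' := by
    rintro f g ⟨φ, hφ⟩ ⟨ψ, hψ⟩
    exact ⟨DiffCurve.ofFamily ν (fun t => (ψ.toFun t).1.trans (φ.toFun t).1)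
      (φ.smooth.comp (contMDiff_fst.prodMk ψ.smooth))
      (fun x => (congrArg _ (ψ.map_zero x)).trans (φ.map_zero x)),
      fun x => hasDerivAt_ratio_pullback_comp h0 hμ φ ψ (hφ x) (hψ x)⟩
  smul_mem' := by
    rintro r f ⟨φ, hφ⟩
    refine ⟨DiffCurve.ofFamily ν (fun t => (φ.toFun (r * t)).1) ?_ ?_, fun x => ?_⟩
    · have h : ContMDiff (𝓘(ℝ, ℝ).prod (𝓡 n)) 𝓘(ℝ, ℝ) ∞ fun q : ℝ × M => r * q.1 :=
        contMDiff_const.mul contMDiff_fst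
      exact φ.smooth.comp (h.prodMk contMDiff_snd)
    · intro x
      simp only [mul_zero]
      exact φ.map_zero x
    · have h1 : HasDerivAt (fun t : ℝ => r * t) r 0 := by
        simpa using (hasDerivAt_id (0 : ℝ)).const_mul r
      have h2 : HasDerivAt (fun t => ratio (pullback (φ.toFun t).1 μ) μ x) (f x) (r * 0) := by
        rw [mul_zero]
        exact hφ x
      exact (h2.comp (0 : ℝ) h1).congr_deriv (mul_comm _ _)

lemma exists_isTangent_of_mem {ν : VolumeForm n M} {μ : FormField n M} (h0 : ∀ x, μ x ≠ 0)
    (hμ : μ ∈ smoothForms n M) {a : FormField n M}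
    (ha : ratio a μ ∈ tangentFunctions ν h0 hμ) : ∃ φ : DiffCurve ν, IsTangent μ φ a := by
  obtain ⟨φ, hφ⟩ : ∃ φ : DiffCurve ν, ∀ x,
    HasDerivAt (fun t => ratio (pullback (φ.toFun t).1 μ) μ x) (ratio a μ x) 0 := ha
  exact ⟨φ, IsTangent.of_hasDerivAt_ratio h0 hφ⟩

end Curves

/-! ### Divergences of fields supported in a chart are tangent -/

section Generators

variable {n : ℕ} {M : Type*} [TopologicalSpace M] [ChartedSpace (EuclideanSpace ℝ (Fin n)) M]

/-- If a point of `K` were sent to a point outside `K`, that point would be fixed and so would have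
two preimages. -/
lemma isSupportedIn_of_injective {K : Set (EuclideanSpace ℝ (Fin n))}
    {g : EuclideanSpace ℝ (Fin n) → EuclideanSpace ℝ (Fin n)} (hg : Function.Injective g)
    (h : ∀ y ∉ K, g y = y) : IsSupportedIn K g :=
  ⟨h, fun y hy => by
    by_contra hn
    have := hg (h _ hn)
    rw [this] at hn
    exact hn hy⟩

/-- A smooth function bounded by `ε` that vanishes at zero with derivative one. -/
lemma exists_bounded_contDiff {ε : ℝ} (hε : 0 < ε) :
    ∃ s : ℝ → ℝ, ContDiff ℝ ∞ s ∧ s 0 = 0 ∧ HasDerivAt s 1 0 ∧ ∀ t, ‖s t‖ ≤ ε := by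
  -- Curves are defined for all real times, so the displacement must stay small forever; the sine
  -- provides this with unit speed at zero.
  refine ⟨fun t => ε * Real.sin (t / ε),
    contDiff_const.mul (Real.contDiff_sin.comp (contDiff_id.div_const ε)), ?_, ?_, fun t => ?_⟩
  · change ε * Real.sin (0 / ε) = 0
    rw [zero_div, Real.sin_zero, mul_zero]
  · refine ((((hasDerivAt_id (0 : ℝ)).div_const ε).sin).const_mul ε).congr_deriv ?_
    rw [id, zero_div, Real.cos_zero, one_mul, mul_one_div_cancel hε.ne']
  · rw [norm_mul, Real.norm_of_nonneg hε.le]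
    exact mul_le_of_le_one_right hε.le (Real.abs_sin_le_one _)

lemma lipschitzWith_const_smul {E : Type*} [NormedAddCommGroup E] [NormedSpace ℝ E] {C : NNReal}
    {w : E → E} (hw : LipschitzWith C w) (r : ℝ) : LipschitzWith (‖r‖₊ * C) fun y => r • w y :=
  LipschitzWith.of_dist_le_mul fun x y => by
    rw [dist_smul₀, NNReal.coe_mul, mul_assoc]
    exact mul_le_mul_of_nonneg_left (hw.dist_le_mul x y) (norm_nonneg _)

/-- A smooth map with compact support is the velocity of a family of diffeomorphisms of `ℝⁿ`. -/
lemma exists_diffeomorph_family {K : Set (EuclideanSpace ℝ (Fin n))} (hKc : IsCompact K)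
    {w : EuclideanSpace ℝ (Fin n) → EuclideanSpace ℝ (Fin n)} (hw : ContDiff ℝ ∞ w)
    (hwK : ∀ y ∉ K, w y = 0) :
    ∃ (h : ℝ → EuclideanSpace ℝ (Fin n) ≃ EuclideanSpace ℝ (Fin n)) (s : ℝ → ℝ),
      ContDiff ℝ ∞ s ∧ s 0 = 0 ∧ HasDerivAt s 1 0 ∧ (∀ t y, h t y = y + s t • w y) ∧
      (∀ t, ContDiff ℝ ∞ (h t).symm) ∧ (∀ t, IsSupportedIn K (h t)) ∧
      ∀ t, IsSupportedIn K (h t).symm := by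
  obtain ⟨C, hC⟩ := ContDiff.lipschitzWith_of_hasCompactSupport (HasCompactSupport.intro hKc hwK)
    hw (by simp)
  have hC0 : (0 : ℝ) < C + 1 := add_pos_of_nonneg_of_pos C.2 one_pos
  -- The bound `1/(C+1)` makes the Lipschitz constant of `s t • w` smaller than one for every `t`,
  -- also when `C` is zero.
  obtain ⟨s, hs, hs0, hs1, hsb⟩ := exists_bounded_contDiff (inv_pos.2 hC0)
  have hlt : ∀ t, ‖s t‖₊ * C < 1 := fun t => by
    have h2 : ‖s t‖ * C < 1 := by
      calc ‖s t‖ * C ≤ (C + 1 : ℝ)⁻¹ * C := mul_le_mul_of_nonneg_right (hsb t) C.2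
        _ < (C + 1 : ℝ)⁻¹ * (C + 1) := mul_lt_mul_of_pos_left (lt_add_one _) (inv_pos.2 hC0)
        _ = 1 := inv_mul_cancel₀ hC0.ne'
    exact NNReal.coe_lt_coe.1 h2
  have hex : ∀ t, ∃ h : EuclideanSpace ℝ (Fin n) ≃ₜ EuclideanSpace ℝ (Fin n),
      (∀ y, h y = y + s t • w y) ∧ ContDiff ℝ ∞ h.symm := fun t =>
    exists_homeomorph_id_add (hw.const_smul (s t)) (lipschitzWith_const_smul hC (s t)) (hlt t)
  choose h hh hsymm using hex
  have hfix : ∀ t, ∀ y ∉ K, h t y = y := fun t y hy => by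
    rw [hh, hwK y hy, smul_zero, add_zero]
  exact ⟨fun t => (h t).toEquiv, s, hs, hs0, hs1, hh, hsymm,
    fun t => isSupportedIn_of_injective (h t).injective (hfix t),
    fun t => isSupportedIn_of_injective (h t).symm.injective fun y hy =>
      (h t).symm_apply_eq.2 (hfix t y hy).symm⟩

lemma pullback_congr {φ ψ : M → M} {x : M} (h : φ =ᶠ[𝓝 x] ψ) (η : FormField n M) :
    pullback φ η x = pullback ψ η x := by
  ext v
  have h1 : mfderiv (𝓡 n) (𝓡 n) φ x = mfderiv (𝓡 n) (𝓡 n) ψ x := h.mfderiv_eq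
  have h2 : ∀ (y z : M) (_ : y = z) (v : Fin n → EuclideanSpace ℝ (Fin n)), η y v = η z v := by
    rintro y _ rfl v
    rfl
  refine (h2 _ _ h.self_of_nhds _).trans ?_
  exact congrArg (fun L : EuclideanSpace ℝ (Fin n) →L[ℝ] EuclideanSpace ℝ (Fin n) =>
    η (ψ x) fun i => L (v i)) h1

open Classical in
/-- The function on `M` given by `u` in the chart around `c`, and by zero outside the chart. -/
def chartFun (c : M) (u : EuclideanSpace ℝ (Fin n) → ℝ) (x : M) : ℝ :=
  if x ∈ (extChartAt (𝓡 n) c).source then u (extChartAt (𝓡 n) c x) else 0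

lemma chartFun_of_mem {c x : M} (hx : x ∈ (extChartAt (𝓡 n) c).source)
    (u : EuclideanSpace ℝ (Fin n) → ℝ) : chartFun c u x = u (extChartAt (𝓡 n) c x) := if_pos hx

lemma chartFun_of_notMem {c x : M} (hx : x ∉ (extChartAt (𝓡 n) c).source)
    (u : EuclideanSpace ℝ (Fin n) → ℝ) : chartFun c u x = 0 := if_neg hx

variable [IsManifold (𝓡 n) ∞ M] [T2Space M] [CompactSpace M]

/-- The divergence of a vector field with compact support in a chart is a tangent function. -/
lemma chartFun_fderiv_mem_tangentFunctions (ν : VolumeForm n M) {μ : FormField n M}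
    (h0 : ∀ x, μ x ≠ 0) (hμ : μ ∈ smoothForms n M) {c : M} {K : Set (EuclideanSpace ℝ (Fin n))}
    (hKc : IsCompact K) (hK : K ⊆ (extChartAt (𝓡 n) c).target)
    {U : EuclideanSpace ℝ (Fin n) → ℝ} (hU : ContDiff ℝ ∞ U) (hUK : ∀ y ∉ K, U y = 0) (i : Fin n) :
    chartFun c (fun y => (chartCoeff c μ y)⁻¹ * fderiv ℝ U y (EuclideanSpace.single i 1)) ∈
      tangentFunctions ν h0 hμ := by
  have hto := isOpen_extChartAt_target (I := 𝓡 n) c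
  -- Dividing `U` by the density makes the density times the field equal to `U` in the direction of
  -- axis `i`, so that its divergence is the prescribed function.
  set w₀ : EuclideanSpace ℝ (Fin n) → ℝ :=
    (extChartAt (𝓡 n) c).target.indicator fun y => (chartCoeff c μ y)⁻¹ * U y with hw₀
  have hw₀s : ContDiff ℝ ∞ w₀ := contDiff_indicator hto hKc.isClosed hK
    (((hμ c).inv fun y hy => chartCoeff_ne_zero h0 hy).mul hU.contDiffOn)
    fun y _ hy => by rw [hUK y hy, mul_zero]
  have hw₀K : ∀ y ∉ K, w₀ y = 0 := fun y hy => by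
    by_cases hyt : y ∈ (extChartAt (𝓡 n) c).target
    · rw [hw₀, indicator_of_mem hyt, hUK y hy, mul_zero]
    · rw [hw₀, indicator_of_notMem hyt]
  set w : EuclideanSpace ℝ (Fin n) → EuclideanSpace ℝ (Fin n) := fun y =>
    w₀ y • EuclideanSpace.single i 1 with hw
  obtain ⟨h, s, hs, hs0, hs1, hh, hsymm, hK1, hK2⟩ := exists_diffeomorph_family hKc
    (w := w) (hw₀s.smul contDiff_const) fun y hy => by rw [hw]; simp only; rw [hw₀K y hy, zero_smul]
  have hG : ContDiff ℝ ∞ fun q : ℝ × EuclideanSpace ℝ (Fin n) => q.2 + s q.1 • w q.2 :=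
    contDiff_snd.add ((hs.comp contDiff_fst).smul
      ((hw₀s.smul contDiff_const).comp contDiff_snd))
  have hhc : ∀ t, ContDiff ℝ ∞ (h t) := fun t => by
    rw [show ⇑(h t) = fun y => y + s t • w y from funext (hh t)]
    exact hG.comp (contDiff_prodMk_right t)
  set Φ : ℝ → M ≃ₘ^∞⟮𝓡 n, 𝓡 n⟯ M := fun t =>
    glueDiffeomorph (c := c) (hhc t) (hsymm t) hKc hK (hK1 t) (hK2 t) with hΦ
  have hΦg : ∀ t x, Φ t x = glue c (fun y => y + s t • w y) x := fun t x => by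
    rw [← show ⇑(h t) = fun y => y + s t • w y from funext (hh t)]
    rfl
  have hsup : ∀ t, IsSupportedIn K fun y => y + s t • w y := fun t => by
    rw [← show ⇑(h t) = fun y => y + s t • w y from funext (hh t)]
    exact hK1 t
  have hsm : ContMDiff (𝓘(ℝ, ℝ).prod (𝓡 n)) (𝓡 n) ∞ fun p : ℝ × M => Φ p.1 p.2 := by
    simp only [hΦg]
    exact contMDiff_glue hG hKc hK hsup
  have hid : ∀ x, Φ 0 x = x := fun x => by
    rw [hΦg, hs0]
    by_cases hx : x ∈ (extChartAt (𝓡 n) c).source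
    · rw [glue_of_mem hx, zero_smul, add_zero, (extChartAt (𝓡 n) c).left_inv hx]
    · exact glue_of_notMem hx _
  refine ⟨DiffCurve.ofFamily ν Φ hsm hid, fun x => ?_⟩
  change HasDerivAt (fun t => ratio (pullback (fun x => Φ t x) μ) μ x) _ 0
  by_cases hx : x ∈ (extChartAt (𝓡 n) c).source
  · rw [chartFun_of_mem hx]
    obtain ⟨y, hy, rfl⟩ : ∃ y ∈ (extChartAt (𝓡 n) c).target, (extChartAt (𝓡 n) c).symm y = x :=
      ⟨_, (extChartAt (𝓡 n) c).map_source hx, (extChartAt (𝓡 n) c).left_inv hx⟩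
    rw [(extChartAt (𝓡 n) c).right_inv hy]
    refine (hasDerivAt_ratio_pullback_of_chart (V := w) h0 hμ hy hsm.contMDiffAt
      (Eventually.of_forall hid) ?_).congr_deriv ?_
    · filter_upwards [hto.mem_nhds hy] with z hz
      simp only [hΦg]
      have e : (fun t => extChartAt (𝓡 n) c (glue c (fun y => y + s t • w y)
          ((extChartAt (𝓡 n) c).symm z))) = fun t => z + s t • w z :=
        funext fun t => extChartAt_glue (hsup t) hK hz
      rw [e]
      exact ((hs1.smul_const (w z)).const_add z).congr_deriv (one_smul _ _)
    · have hμd := differentiableAt_chartCoeff hμ hy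
      have hw₀d : DifferentiableAt ℝ w₀ y := hw₀s.differentiable (by simp) y
      have e : U =ᶠ[𝓝 y] fun z => chartCoeff c μ z * w₀ z := by
        filter_upwards [hto.mem_nhds hy] with z hz
        rw [hw₀, indicator_of_mem hz, mul_inv_cancel_left₀ (chartCoeff_ne_zero h0 hz)]
      have hsum : ∑ k, fderiv ℝ (fun y => w y k) y (EuclideanSpace.single k (1 : ℝ)) =
          fderiv ℝ w₀ y (EuclideanSpace.single i 1) := by
        rw [Finset.sum_eq_single i]
        · congr 2
          funext z
          simp [hw]
        · intro k _ hk
          have : (fun y => w y k) = fun _ => 0 := funext fun z => by simp [hw, hk]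
          rw [this]
          simp
        · simp
      have h1 := chartCoeff_ne_zero h0 hy
      rw [hsum, e.fderiv_eq, fderiv_fun_mul hμd hw₀d, hw]
      simp only [map_smul, add_apply, smul_apply,
        smul_eq_mul, mul_add, inv_mul_cancel_left₀ h1]
      ring
  · rw [chartFun_of_notMem hx]
    have hx2 : x ∉ (extChartAt (𝓡 n) c).symm '' K := by
      rintro ⟨y, hy, rfl⟩
      exact hx ((extChartAt (𝓡 n) c).map_target (hK hy))
    have e : ∀ t, ratio (pullback (fun x => Φ t x) μ) μ x = 1 := fun t => by
      have he : (fun x => Φ t x) =ᶠ[𝓝 x] id := by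
        filter_upwards [(isClosed_symm_image hKc hK).isOpen_compl.mem_nhds hx2] with z hz
        rw [hΦg]
        exact glue_of_notMem_image (hsup t) hz
      refine ratio_eq_of_smul (h0 x) ?_
      rw [one_smul]
      exact (pullback_congr he μ).trans (pullback_id μ x)
    simp only [e]
    exact hasDerivAt_const _ _

end Generators

/-! ### Every function of integral zero is tangent -/

section Local

variable {n : ℕ} {M : Type*} [TopologicalSpace M] [ChartedSpace (EuclideanSpace ℝ (Fin n)) M]
  [IsManifold (𝓡 n) ∞ M] [T2Space M] [CompactSpace M]

/-- `∫ f μ`, as a linear form on the smooth functions. -/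
def integralFunctions (ν : VolumeForm n M) {μ : FormField n M} (hμ : μ ∈ smoothForms n M) :
    smoothFunctions n M →ₗ[ℝ] ℝ where
  toFun f := ν.integral fun x => (f : M → ℝ) x • μ x
  map_add' f g := by
    rw [← ν.integral_add (smul_mem_smoothForms f.2 hμ) (smul_mem_smoothForms g.2 hμ)]
    congr 1
    funext x
    ext v
    exact add_mul _ _ _
  map_smul' r f := by
    refine Eq.trans ?_ (ν.integral_smul r _)
    congr 1
    funext x
    ext v
    exact mul_assoc _ _ _

/-- The density of `f μ` in a chart that contains the support of `f`. -/
def chartDensity (ν : VolumeForm n M) (μ : FormField n M) (c : M) (f : M → ℝ) :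
    EuclideanSpace ℝ (Fin n) → ℝ :=
  (extChartAt (𝓡 n) c).target.indicator fun y => Real.sign (chartCoeff c ν.toForm y) *
    (f ((extChartAt (𝓡 n) c).symm y) * chartCoeff c μ y)

section

variable (ν : VolumeForm n M) {μ : FormField n M} (hμ : μ ∈ smoothForms n M) {c : M}
  {f : smoothFunctions n M}

lemma chartDensity_eq_zero {y : EuclideanSpace ℝ (Fin n)}
    (hy : y ∉ extChartAt (𝓡 n) c '' tsupport (f : M → ℝ)) : chartDensity ν μ c f y = 0 := by
  by_cases hyt : y ∈ (extChartAt (𝓡 n) c).target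
  · rw [chartDensity, indicator_of_mem hyt, comp_symm_eq_zero hyt hy, zero_mul, mul_zero]
  · rw [chartDensity, indicator_of_notMem hyt]

include hμ

lemma contDiff_chartDensity (hs : tsupport (f : M → ℝ) ⊆ (extChartAt (𝓡 n) c).source) :
    ContDiff ℝ ∞ (chartDensity ν μ c f) :=
  contDiff_indicator (isOpen_extChartAt_target c) (isCompact_image_tsupport hs).isClosed
    (image_tsupport_subset hs) ((contDiffOn_sign (isOpen_extChartAt_target c)
      (contDiffOn_chartCoeff ν.smooth c).continuousOn
      fun y hy => chartCoeff_ne_zero ν.ne_zero hy).mul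
        ((smoothFunctions_contDiffOn f c).mul (hμ c)))
    fun y hy hyK => by rw [comp_symm_eq_zero hy hyK, zero_mul, mul_zero]

lemma integralFunctions_eq_integral (hs : tsupport (f : M → ℝ) ⊆ (extChartAt (𝓡 n) c).source) :
    integralFunctions ν hμ f = ∫ y, chartDensity ν μ c f y := by
  rw [chartDensity, integral_indicator (isOpen_extChartAt_target c).measurableSet]
  refine ν.integral_eq_of_chart (smul_mem_smoothForms f.2 hμ) c fun x hx => ?_
  have : (f : M → ℝ) x = 0 := image_eq_zero_of_notMem_tsupport fun h => hx (hs h)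
  rw [this, zero_smul]

end

lemma abs_apply_le_norm (x : EuclideanSpace ℝ (Fin n)) (j : Fin n) : |x j| ≤ ‖x‖ :=
  PiLp.norm_apply_le x j

lemma exists_closedBox_subset {a : EuclideanSpace ℝ (Fin n)} {s : Set (EuclideanSpace ℝ (Fin n))}
    (hs : s ∈ 𝓝 a) : ∃ r > 0, closedBox a r ⊆ s := by
  obtain ⟨ε, hε, hball⟩ := Metric.mem_nhds_iff.1 hs
  -- The norm is at most the sum of `n` coordinates, hence at most `nε/(n+1) < ε`; the denominator
  -- `n + 1` also covers dimension zero.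
  refine ⟨ε / (n + 1), by positivity, fun x hx => hball ?_⟩
  rw [mem_ball_iff_norm]
  calc ‖x - a‖ = ‖∑ j, (x - a) j • (EuclideanSpace.single j 1 : EuclideanSpace ℝ (Fin n))‖ := by
        congr 1
        conv_lhs => rw [← (EuclideanSpace.basisFun (Fin n) ℝ).sum_repr (x - a)]
        simp
    _ ≤ ∑ j : Fin n, ε / (n + 1) := by
        refine norm_sum_le_of_le _ fun j _ => ?_
        rw [norm_smul]
        simpa using hx j
    _ = n * (ε / (n + 1)) := by simp
    _ < ε := by
        rw [mul_div_assoc', div_lt_iff₀ (by positivity)]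
        nlinarith

/-- Near every point, the smooth functions of integral zero are tangent functions. -/
lemma exists_isOpen_mem_tangentFunctions (ν : VolumeForm n M) {μ : FormField n M}
    (h0 : ∀ x, μ x ≠ 0) (hμ : μ ∈ smoothForms n M) (p : M) :
    ∃ N : Set M, IsOpen N ∧ p ∈ N ∧ ∀ f : smoothFunctions n M, tsupport (f : M → ℝ) ⊆ N →
      integralFunctions ν hμ f = 0 → (f : M → ℝ) ∈ tangentFunctions ν h0 hμ := by
  have hto := isOpen_extChartAt_target (I := 𝓡 n) p
  obtain ⟨r, hr, hbox⟩ := exists_closedBox_subset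
    (hto.mem_nhds (mem_extChartAt_target (I := 𝓡 n) p))
  set a := extChartAt (𝓡 n) p p with ha
  refine ⟨(extChartAt (𝓡 n) p).source ∩ extChartAt (𝓡 n) p ⁻¹' Metric.ball a r,
    (continuousOn_extChartAt p).isOpen_inter_preimage (isOpen_extChartAt_source p)
      Metric.isOpen_ball, ⟨mem_extChartAt_source p, Metric.mem_ball_self hr⟩, fun f hf hI => ?_⟩
  have hs : tsupport (f : M → ℝ) ⊆ (extChartAt (𝓡 n) p).source := fun x hx => (hf hx).1
  rw [integralFunctions_eq_integral ν hμ hs] at hI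
  have hB : BoxSupported a r (chartDensity ν μ p f) := by
    refine ⟨contDiff_chartDensity ν hμ hs, fun y j hj => chartDensity_eq_zero ν ?_⟩
    rintro ⟨x, hx, rfl⟩
    have h1 := (hf hx).2
    rw [mem_preimage, mem_ball_iff_norm] at h1
    exact absurd (abs_apply_le_norm (extChartAt (𝓡 n) p x - a) j) (not_le.2 (h1.trans hj))
  obtain ⟨θ⟩ := nonempty_unitBump hr
  obtain ⟨U, κ, hU, hsum⟩ := hB.exists_eq_sum_fderiv θ
  -- Integrating the decomposition removes the derivatives, and the product of bumps has positive
  -- integral.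
  have hκ : κ = 0 := by
    simp_rw [hsum] at hI
    have hP := θ.boxSupported_prod a
    have hint : ∀ i, Integrable fun y => fderiv ℝ (U i) y (EuclideanSpace.single i 1) := fun i =>
      (contDiff_fderiv_apply (hU i).smooth _).continuous.integrable_of_hasCompactSupport
        (hasCompactSupport_fderiv_apply (hU i).hasCompactSupport _)
    rw [integral_add ((hP.smooth.continuous.integrable_of_hasCompactSupport
      hP.hasCompactSupport).const_mul κ) (integrable_finsetSum _ fun i _ => hint i),
      integral_finsetSum _ fun i _ => hint i, integral_const_mul,
      Finset.sum_eq_zero fun i _ => integral_fderiv_apply_eq_zero (hU i).smooth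
        (hU i).hasCompactSupport _, add_zero] at hI
    exact (mul_eq_zero.1 hI).resolve_right (θ.integral_prod_pos a).ne'
  have hνc := (contDiffOn_chartCoeff ν.smooth p).continuousOn
  have hν0 : ∀ y ∈ (extChartAt (𝓡 n) p).target, chartCoeff p ν.toForm y ≠ 0 :=
    fun y hy => chartCoeff_ne_zero ν.ne_zero hy
  -- The density contains the orientation sign. Multiplying the potentials by the same sign cancels
  -- it, because its square is one.
  set U' : Fin n → EuclideanSpace ℝ (Fin n) → ℝ := fun i =>
    (extChartAt (𝓡 n) p).target.indicator fun y => Real.sign (chartCoeff p ν.toForm y) * U i y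
    with hU'
  have hU's : ∀ i, ContDiff ℝ ∞ (U' i) := fun i => contDiff_indicator hto
    (isCompact_closedBox a r).isClosed hbox ((contDiffOn_sign hto hνc hν0).mul
      (hU i).smooth.contDiffOn) fun y _ hy => by rw [(hU i).eq_zero_of_notMem hy, mul_zero]
  have hU'0 : ∀ i, ∀ y ∉ closedBox a r, U' i y = 0 := fun i y hy => by
    rw [hU']
    simp only
    by_cases hyt : y ∈ (extChartAt (𝓡 n) p).target
    · rw [indicator_of_mem hyt, (hU i).eq_zero_of_notMem hy, mul_zero]
    · rw [indicator_of_notMem hyt]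
  have hfd : ∀ i, ∀ y ∈ (extChartAt (𝓡 n) p).target,
      fderiv ℝ (U' i) y (EuclideanSpace.single i 1) =
        Real.sign (chartCoeff p ν.toForm y) * fderiv ℝ (U i) y (EuclideanSpace.single i 1) := by
    intro i y hy
    have he : U' i =ᶠ[𝓝 y] fun z => Real.sign (chartCoeff p ν.toForm y) • U i z := by
      filter_upwards [hto.mem_nhds hy,
        eventually_sign_eq (hνc.continuousAt (hto.mem_nhds hy)) (hν0 y hy)] with z hz hz2
      rw [hU']
      simp only
      rw [indicator_of_mem hz, hz2, smul_eq_mul]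
    rw [he.fderiv_eq, fderiv_fun_const_smul ((hU i).smooth.differentiable (by simp) y)]
    rfl
  have hf2 : (f : M → ℝ) = ∑ i, chartFun p fun y => (chartCoeff p μ y)⁻¹ *
      fderiv ℝ (U' i) y (EuclideanSpace.single i 1) := by
    funext x
    rw [Finset.sum_apply]
    by_cases hx : x ∈ (extChartAt (𝓡 n) p).source
    · have hy := (extChartAt (𝓡 n) p).map_source hx
      simp_rw [chartFun_of_mem hx, hfd _ _ hy, ← Finset.mul_sum]
      have h1 := hsum (extChartAt (𝓡 n) p x)
      rw [hκ, zero_mul, zero_add, chartDensity, indicator_of_mem hy,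
        (extChartAt (𝓡 n) p).left_inv hx] at h1
      rw [← h1, ← mul_assoc (Real.sign _)]
      have hsq : Real.sign (chartCoeff p ν.toForm (extChartAt (𝓡 n) p x)) *
          Real.sign (chartCoeff p ν.toForm (extChartAt (𝓡 n) p x)) = 1 := by
        rcases lt_or_gt_of_ne (hν0 _ hy) with h | h
        · rw [Real.sign_of_neg h]
          norm_num
        · rw [Real.sign_of_pos h, mul_one]
      rw [hsq, one_mul, mul_comm ((f : M → ℝ) x), inv_mul_cancel_left₀ (chartCoeff_ne_zero h0 hy)]
    · simp_rw [chartFun_of_notMem hx]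
      rw [Finset.sum_const_zero]
      exact image_eq_zero_of_notMem_tsupport fun h => hx (hs h)
  rw [hf2]
  exact Submodule.sum_mem _ fun i _ => chartFun_fderiv_mem_tangentFunctions ν h0 hμ
    (isCompact_closedBox a r) hbox (hU's i) (hU'0 i) i

/-- Every neighbourhood of a point supports a smooth function of integral one. -/
lemma exists_integralFunctions_eq_one {ν : VolumeForm n M} {μ : FormField n M} (hμ : μ ∈ Prob ν)
    (p : M) {O : Set M} (hO : O ∈ 𝓝 p) : ∃ f : smoothFunctions n M, tsupport (f : M → ℝ) ⊆ O ∧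
      integralFunctions ν hμ.1 f = 1 := by
  have h0 := ne_zero_of_mem_Prob hμ
  obtain ⟨b, -, hb⟩ := (SmoothBumpFunction.nhds_basis_tsupport (I := 𝓡 n) p).mem_iff.1
    (inter_mem hO (extChartAt_source_mem_nhds (I := 𝓡 n) p))
  set f : smoothFunctions n M := ⟨b, b.contMDiff⟩ with hf
  have hs : tsupport (f : M → ℝ) ⊆ (extChartAt (𝓡 n) p).source := fun x hx => (hb hx).2
  have hsign : ∀ y ∈ (extChartAt (𝓡 n) p).target,
      0 < Real.sign (chartCoeff p ν.toForm y) * chartCoeff p μ y := fun y hy => by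
    have h1 : chartCoeff p μ y = ratio μ ν.toForm ((extChartAt (𝓡 n) p).symm y) *
      chartCoeff p ν.toForm y := formCoeff_eq_ratio ν.ne_zero _ μ y
    rw [h1, mul_left_comm]
    refine mul_pos (hμ.2.1 _) ?_
    rcases lt_or_gt_of_ne (chartCoeff_ne_zero ν.ne_zero hy) with h | h
    · rw [Real.sign_of_neg h]
      linarith
    · rw [Real.sign_of_pos h, one_mul]
      exact h
  have hpos : 0 < integralFunctions ν hμ.1 f := by
    rw [integralFunctions_eq_integral ν hμ.1 hs]
    refine (contDiff_chartDensity ν hμ.1 hs).continuous.integral_pos_of_hasCompactSupport_nonneg_nonzero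
      (HasCompactSupport.intro (isCompact_image_tsupport hs) fun y hy => chartDensity_eq_zero ν hy)
      (fun y => ?_) (x := extChartAt (𝓡 n) p p) ?_
    · by_cases hy : y ∈ (extChartAt (𝓡 n) p).target
      · rw [chartDensity, indicator_of_mem hy, mul_left_comm]
        exact mul_nonneg b.nonneg (hsign y hy).le
      · rw [chartDensity, indicator_of_notMem hy]
        exact le_rfl
    · have hy := mem_extChartAt_target (I := 𝓡 n) p
      rw [chartDensity, indicator_of_mem hy, mul_left_comm, extChartAt_to_inv]
      refine mul_ne_zero ?_ (hsign _ hy).ne'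
      change b p ≠ 0
      rw [b.eq_one]
      exact one_ne_zero
  refine ⟨(integralFunctions ν hμ.1 f)⁻¹ • f, fun x hx => (hb ?_).1, ?_⟩
  · exact (tsupport_smul_subset_right (fun _ => (integralFunctions ν hμ.1 f)⁻¹) b) hx
  · rw [map_smul, smul_eq_mul, inv_mul_cancel₀ hpos.ne']

/-- On a connected manifold, every smooth function of integral zero is tangent to a curve. -/
theorem mem_tangentFunctions [ConnectedSpace M] {ν : VolumeForm n M} {μ : FormField n M}
    (hμ : μ ∈ Prob ν) (f : smoothFunctions n M) (hf : integralFunctions ν hμ.1 f = 0) :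
    (f : M → ℝ) ∈ tangentFunctions ν (ne_zero_of_mem_Prob hμ) hμ.1 := by
  have h0 := ne_zero_of_mem_Prob hμ
  set W := tangentFunctions ν h0 hμ.1 with hW
  choose N hNo hNp hN using exists_isOpen_mem_tangentFunctions ν h0 hμ.1
  choose b hbN hb1 using fun p => exists_integralFunctions_eq_one hμ p ((hNo p).mem_nhds (hNp p))
  -- Modulo tangent functions, a function supported in one of the small neighbourhoods is determined
  -- by its integral.
  have key : ∀ p (g g' : smoothFunctions n M), tsupport (g : M → ℝ) ⊆ N p →
      tsupport (g' : M → ℝ) ⊆ N p → integralFunctions ν hμ.1 g = integralFunctions ν hμ.1 g' →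
      W.mkQ (g : M → ℝ) = W.mkQ (g' : M → ℝ) := by
    intro p g g' hg hg' h
    rw [← sub_eq_zero, ← map_sub, Submodule.mkQ_apply, Submodule.Quotient.mk_eq_zero]
    refine hN p (g - g') ?_ (by rw [map_sub, h, sub_self])
    exact (tsupport_sub (g : M → ℝ) (g' : M → ℝ)).trans (union_subset hg hg')
  have hloc : IsLocallyConstant fun p => W.mkQ (b p : M → ℝ) := by
    refine (IsLocallyConstant.iff_exists_open _).2 fun p => ⟨N p, hNo p, hNp p, fun z hz => ?_⟩
    -- The two bumps are compared through a third one supported in the intersection of their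
    -- neighbourhoods.
    obtain ⟨g, hg, hg1⟩ := exists_integralFunctions_eq_one hμ z
      (inter_mem ((hNo p).mem_nhds hz) ((hNo z).mem_nhds (hNp z)))
    rw [key z (b z) g (hbN z) (fun x hx => (hg hx).2) (by rw [hb1, hg1]),
      key p (b p) g (hbN p) (fun x hx => (hg hx).1) (by rw [hb1, hg1])]
  obtain ⟨S, g, hfg, hgN⟩ := exists_eq_sum_tsupport_subset f hNo hNp
  obtain ⟨p₀⟩ := (inferInstance : Nonempty M)
  -- By connectedness all bumps have one and the same class, so each piece of `f` is its integral
  -- times that class. The pieces add up to the integral of `f`, which is zero.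
  have hg : ∀ c, W.mkQ (g c : M → ℝ) = integralFunctions ν hμ.1 (g c) • W.mkQ (b p₀ : M → ℝ) := by
    intro c
    rw [← hloc.apply_eq_of_preconnectedSpace c p₀, ← map_smul]
    refine key c (g c) (integralFunctions ν hμ.1 (g c) • b c) (hgN c) ?_ (by
      rw [map_smul, hb1, smul_eq_mul, mul_one])
    exact (tsupport_smul_subset_right (fun _ => integralFunctions ν hμ.1 (g c))
      (b c : M → ℝ)).trans (hbN c)
  rw [← Submodule.Quotient.mk_eq_zero, ← Submodule.mkQ_apply, hfg,
    AddSubmonoidClass.coe_finsetSum, map_sum]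
  simp_rw [hg]
  rw [← Finset.sum_smul, ← map_sum, ← hfg, hf, zero_smul]

/-- On a connected manifold, every tangent vector of `Prob(M)` is tangent to a curve `(φ^t)^* μ`. -/
theorem exists_isTangent [ConnectedSpace M] {ν : VolumeForm n M} {μ : FormField n M}
    (hμ : μ ∈ Prob ν) (a : TangentProb ν) : ∃ φ : DiffCurve ν, IsTangent μ φ a := by
  have h0 := ne_zero_of_mem_Prob hμ
  refine exists_isTangent_of_mem h0 hμ.1 (mem_tangentFunctions hμ
    ⟨ratio a μ, contMDiff_ratio h0 hμ.1 a.2.1⟩ ?_)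
  change ν.integral (fun x => ratio a μ x • μ x) = 0
  rw [ratio_smul_form h0]
  exact a.2.2

end Local

/-! ### The form `dx` and integration on the circle -/

section CircleForm

/-- The inclusion of the circle in the complex plane. -/
def circleInclusion (p : Circle) : ℂ := p

lemma contMDiff_circleInclusion : ContMDiff (𝓡 1) 𝓘(ℝ, ℂ) ∞ circleInclusion :=
  haveI := finrank_real_complex_fact'
  contMDiff_coe_sphere

/-- The differential of the inclusion of the circle in the complex plane. -/
def circleDifferential (p : Circle) : EuclideanSpace ℝ (Fin 1) →L[ℝ] ℂ :=
  mfderiv (𝓡 1) 𝓘(ℝ, ℂ) circleInclusion p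

/-- The covector `v ↦ Im (p⁻¹ v)` on the tangent line of the circle at `p`. -/
def circleCovector (p : Circle) : EuclideanSpace ℝ (Fin 1) →L[ℝ] ℝ :=
  Complex.imCLM ∘L (ContinuousLinearMap.mul ℝ ℂ (starRingEnd ℂ (p : ℂ))) ∘L
    circleDifferential p

/-- The form `dx` on the circle. -/
def circleForm : FormField 1 Circle := fun p =>
  (wedge fun _ : Fin 1 => circleCovector p : EuclideanSpace ℝ (Fin 1) [⋀^Fin 1]→L[ℝ] ℝ)

lemma circleForm_apply (p : Circle) (v : Fin 1 → TangentSpace (𝓡 1) p) :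
    circleForm p v = (starRingEnd ℂ (p : ℂ) *
      circleDifferential p (v 0)).im := by
  refine (wedge_apply (V := EuclideanSpace ℝ (Fin 1)) (fun _ : Fin 1 => circleCovector p) v).trans ?_
  rw [Matrix.det_fin_one]
  rfl

lemma mdifferentiableAt_circleExp (x : ℝ) :
    MDifferentiableAt 𝓘(ℝ, ℝ) (𝓡 1) Circle.exp x :=
  (contMDiff_circleExp (m := ∞)).mdifferentiableAt (by simp)

/-- The curve `exp(ix)` has velocity `i exp(ix)`; multiplying by the conjugate of the point gives
`i`, with imaginary part one. -/
lemma circleForm_circlePartial (x : ℝ) :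
    circleForm (Circle.exp x) (fun _ => circlePartial x) = 1 := by
  rw [circleForm_apply]
  have h1 : HasDerivAt (fun x : ℝ => ((Circle.exp x : Circle) : ℂ))
      (Complex.exp (x * Complex.I) * Complex.I) x := by
    simp only [Circle.coe_exp]
    have := ((Complex.ofRealCLM.hasDerivAt (x := x)).mul_const Complex.I).cexp
    simpa using this
  have h2 : circleDifferential (Circle.exp x) (circlePartial x) =
      Complex.exp (x * Complex.I) * Complex.I := by
    have h3 := mfderiv_comp x (contMDiff_circleInclusion.mdifferentiableAt (by simp))
      (mdifferentiableAt_circleExp x)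
    have h4 := congrArg (fun L : ℝ →L[ℝ] ℂ => L 1) h3
    refine Eq.trans h4.symm ?_
    rw [mfderiv_eq_fderiv]
    exact h1.deriv
  rw [h2, Circle.coe_exp, ← mul_assoc, ← Complex.normSq_eq_conj_mul_self,
    Complex.normSq_eq_norm_sq, Complex.norm_exp_ofReal_mul_I]
  simp

lemma circleForm_mem_smoothForms : circleForm ∈ smoothForms 1 Circle := by
  intro c
  set s := (extChartAt (𝓡 1) c).symm with hs
  have hto := isOpen_extChartAt_target (I := 𝓡 1) c
  have h1 : ContDiffOn ℝ ∞ (circleInclusion ∘ s) (extChartAt (𝓡 1) c).target :=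
    (contMDiff_circleInclusion.comp_contMDiffOn (contMDiffOn_extChartAt_symm c)).contDiffOn
  have h2 : ContDiffOn ℝ ∞ (fun y => (starRingEnd ℂ ((s y : Circle) : ℂ) *
      fderiv ℝ (circleInclusion ∘ s) y (EuclideanSpace.single 0 1)).im)
      (extChartAt (𝓡 1) c).target :=
    Complex.imCLM.contDiff.comp_contDiffOn ((Complex.conjCLE.contDiff.comp_contDiffOn h1).mul
      ((h1.fderiv_of_isOpen hto (by simp)).clm_apply contDiffOn_const))
  refine h2.congr fun y hy => (circleForm_apply _ _).trans ?_
  have h3 := mfderiv_comp y (contMDiff_circleInclusion.mdifferentiableAt (by simp))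
    (mdifferentiableAt_extChartAt_symm hy)
  rw [mfderiv_eq_fderiv] at h3
  exact congrArg (fun L : EuclideanSpace ℝ (Fin 1) →L[ℝ] ℂ => (starRingEnd ℂ ((s y : Circle) : ℂ) *
    L (EuclideanSpace.single 0 1)).im) h3.symm

/-- The form `dx` on the circle, as a volume form. -/
def circleVolume : VolumeForm 1 Circle where
  toForm := circleForm
  smooth := circleForm_mem_smoothForms
  ne_zero p h := by
    have h1 := circleForm_circlePartial (Complex.arg (p : ℂ))
    rw [Circle.exp_arg, h] at h1
    exact zero_ne_one h1

/-- The universal cover of the circle, with domain the Euclidean line. -/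
def angle (z : EuclideanSpace ℝ (Fin 1)) : Circle := Circle.exp (z 0)

lemma mdifferentiableAt_proj (z : EuclideanSpace ℝ (Fin 1)) :
    MDifferentiableAt (𝓡 1) 𝓘(ℝ, ℝ) (fun z : EuclideanSpace ℝ (Fin 1) => z 0) z :=
  ((EuclideanSpace.proj (𝕜 := ℝ) (0 : Fin 1)).differentiableAt (x := z)).mdifferentiableAt

lemma mdifferentiableAt_angle (z : EuclideanSpace ℝ (Fin 1)) :
    MDifferentiableAt (𝓡 1) (𝓡 1) angle z :=
  (mdifferentiableAt_circleExp (z 0)).comp z (mdifferentiableAt_proj z)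

lemma mfderiv_angle (z : EuclideanSpace ℝ (Fin 1)) :
    mfderiv (𝓡 1) (𝓡 1) angle z (EuclideanSpace.single 0 (1 : ℝ)) = circlePartial (z 0) := by
  have h1 := mfderiv_comp z (mdifferentiableAt_circleExp (z 0)) (mdifferentiableAt_proj z)
  have h2 : mfderiv (𝓡 1) 𝓘(ℝ, ℝ) (fun z : EuclideanSpace ℝ (Fin 1) => z 0) z =
      EuclideanSpace.proj (𝕜 := ℝ) (0 : Fin 1) := by
    rw [mfderiv_eq_fderiv]
    exact (EuclideanSpace.proj (𝕜 := ℝ) (0 : Fin 1)).fderiv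
  rw [h2] at h1
  have h3 : EuclideanSpace.proj (𝕜 := ℝ) (0 : Fin 1) (EuclideanSpace.single 0 (1 : ℝ)) = 1 := by simp
  refine (congrArg (fun L : EuclideanSpace ℝ (Fin 1) →L[ℝ] EuclideanSpace ℝ (Fin 1) =>
    L (EuclideanSpace.single 0 1)) h1).trans ?_
  refine congrArg (mfderiv 𝓘(ℝ, ℝ) (𝓡 1) Circle.exp (z 0) : ℝ →L[ℝ] EuclideanSpace ℝ (Fin 1)) h3

lemma formCoeff_angle_circleForm (z : EuclideanSpace ℝ (Fin 1)) :
    formCoeff angle circleForm z = 1 := by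
  rw [← circleForm_circlePartial (z 0)]
  refine congrArg (circleForm (Circle.exp (z 0))) (funext fun i => ?_)
  rw [Subsingleton.elim i 0]
  exact mfderiv_angle z

lemma measurePreserving_proj :
    MeasurePreserving (fun z : EuclideanSpace ℝ (Fin 1) => z 0) volume volume :=
  (volume_preserving_funUnique (Fin 1) ℝ).comp (PiLp.volume_preserving_ofLp (Fin 1))

lemma setIntegral_proj (F : ℝ → ℝ) (s : Set ℝ) :
    ∫ z in (fun z : EuclideanSpace ℝ (Fin 1) => z 0) ⁻¹' s, F (z 0) = ∫ x in s, F x :=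
  measurePreserving_proj.setIntegral_preimage_emb
    ((MeasurableEquiv.funUnique (Fin 1) ℝ).measurableEmbedding.comp
      (MeasurableEquiv.toLp 2 (Fin 1 → ℝ)).symm.measurableEmbedding) F s

lemma exists_mem_Ioo_circleExp_eq {p : Circle} (hp : p ≠ 1) :
    ∃ x ∈ Ioo 0 (2 * Real.pi), Circle.exp x = p := by
  have h1 := Circle.exp_arg p
  have h2 := Complex.neg_pi_lt_arg (p : ℂ)
  have h3 := Complex.arg_le_pi (p : ℂ)
  have hpi := Real.pi_pos
  rcases lt_trichotomy (Complex.arg (p : ℂ)) 0 with h | h | h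
  · refine ⟨Complex.arg (p : ℂ) + 2 * Real.pi, ⟨by linarith, by linarith⟩, ?_⟩
    rw [Circle.exp_add_two_pi, h1]
  · rw [h, Circle.exp_zero] at h1
    exact absurd h1.symm hp
  · exact ⟨_, ⟨h, by linarith⟩, h1⟩

/-- Two preimages differ by an integer multiple of `2π`, and in the open interval the difference is
less than `2π` in absolute value. -/
lemma injOn_angle :
    InjOn angle ((fun z : EuclideanSpace ℝ (Fin 1) => z 0) ⁻¹' Ioo 0 (2 * Real.pi)) := by
  rintro z ⟨hz1, hz2⟩ w ⟨hw1, hw2⟩ h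
  obtain ⟨m, hm⟩ := Circle.exp_eq_exp.1 h
  have hpi := Real.two_pi_pos
  have h1 : (m : ℝ) < 1 := by
    by_contra hn
    nlinarith [not_lt.1 hn]
  have h2 : (-1 : ℝ) < m := by
    by_contra hn
    nlinarith [not_lt.1 hn]
  have h3 : m < 1 := by exact_mod_cast h1
  have h4 : -1 < m := by exact_mod_cast h2
  have h5 : m = 0 := by omega
  ext i
  rw [Subsingleton.elim i 0, hm, h5]
  simp

/-- Integrals over the circle are integrals over a period. -/
lemma circleVolume_integral {η : FormField 1 Circle} (hη : η ∈ smoothForms 1 Circle) {F : ℝ → ℝ}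
    (hF : ∀ z, formCoeff angle η z = F (z 0)) :
    circleVolume.integral η = ∫ x in (0 : ℝ)..(2 * Real.pi), F x := by
  have hcont : Continuous fun z : EuclideanSpace ℝ (Fin 1) => z 0 :=
    (EuclideanSpace.proj (𝕜 := ℝ) (0 : Fin 1)).continuous
  rw [circleVolume.integral_eq_setIntegral hη (isOpen_Ioo.preimage hcont)
    (fun z _ => mdifferentiableAt_angle z) injOn_angle, intervalIntegral.integral_of_le
      Real.two_pi_pos.le, integral_Ioc_eq_integral_Ioo, ← setIntegral_proj]
  · congr 1
    funext z
    rw [show circleVolume.toForm = circleForm from rfl, formCoeff_angle_circleForm, hF,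
      Real.sign_one, one_mul]
  -- The interval covers the circle except the point `1`, which is at most one point of each chart
  -- and therefore null.
  · intro c
    have h1 : ∀ᵐ y : EuclideanSpace ℝ (Fin 1), y ≠ extChartAt (𝓡 1) c 1 :=
      compl_mem_ae_iff.2 (measure_singleton _)
    filter_upwards [h1] with y hy hyt hyV
    exfalso
    have h2 : (extChartAt (𝓡 1) c).symm y ≠ 1 := fun h => hy (by
      rw [← h, (extChartAt (𝓡 1) c).right_inv hyt])
    obtain ⟨x, hx, hxp⟩ := exists_mem_Ioo_circleExp_eq h2
    refine hyV ⟨EuclideanSpace.single 0 x, ?_, ?_⟩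
    · simpa using hx
    · rw [← hxp, angle]
      simp

lemma ratio_smul_self_const {n : ℕ} {M : Type*} [TopologicalSpace M]
    [ChartedSpace (EuclideanSpace ℝ (Fin n)) M] {μ : FormField n M} (h : ∀ x, μ x ≠ 0) (r : ℝ)
    (x : M) : ratio (r • μ) μ x = r := ratio_eq_of_smul (h x) rfl

lemma smul_circleForm_mem_Prob : (2 * Real.pi)⁻¹ • circleVolume.toForm ∈ Prob circleVolume := by
  refine ⟨Submodule.smul_mem _ _ circleVolume.smooth, fun x => ?_, ?_⟩
  · rw [ratio_smul_self_const circleVolume.ne_zero]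
    exact inv_pos.2 Real.two_pi_pos
  · rw [circleVolume.integral_smul, circleVolume_integral (F := fun _ => 1) circleVolume.smooth
      formCoeff_angle_circleForm, intervalIntegral.integral_const, sub_zero, smul_eq_mul, mul_one,
      inv_mul_cancel₀ Real.two_pi_pos.ne']

end CircleForm

/-! ### The Gelfand–Fuchs cocycle -/

section GelfandFuchs

variable {r : ℝ} {f : ℝ → ℝ} {u : Vect 1 Circle}

lemma single_zero_smul (v : EuclideanSpace ℝ (Fin 1)) :
    v = v 0 • EuclideanSpace.single (0 : Fin 1) (1 : ℝ) := by
  ext i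
  rw [Subsingleton.elim i 0]
  simp

/-- The divergence of `f ∂ₓ` is `f'`. -/
lemma hasDerivAt_divergence_circle (hr : 0 < r)
    (hu : ∀ x, u (Circle.exp x) = f x • circlePartial x) (x : ℝ) :
    HasDerivAt f (divergence (r • circleForm) u (Circle.exp x)) x := by
  set μ : FormField 1 Circle := r • circleForm with hμd
  have hμ : μ ∈ smoothForms 1 Circle := Submodule.smul_mem _ _ circleVolume.smooth
  have h0 : ∀ p, μ p ≠ 0 := fun p => smul_ne_zero hr.ne' (circleVolume.ne_zero p)
  set c : Circle := Circle.exp x with hc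
  set T : EuclideanSpace ℝ (Fin 1) → EuclideanSpace ℝ (Fin 1) := extChartAt (𝓡 1) c ∘ angle with hT
  set z₀ : EuclideanSpace ℝ (Fin 1) := EuclideanSpace.single 0 x with hz₀
  have hz : angle z₀ = c := by simp [angle, hz₀, hc]
  have hcont : Continuous angle := Circle.exp.continuous.comp
    (EuclideanSpace.proj (𝕜 := ℝ) (0 : Fin 1)).continuous
  have hnhds : ∀ᶠ w in 𝓝 z₀, angle w ∈ (extChartAt (𝓡 1) c).source :=
    hcont.continuousAt ((isOpen_extChartAt_source c).mem_nhds (by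
      rw [hz]
      exact mem_extChartAt_source c))
  have hTd : ∀ w, angle w ∈ (extChartAt (𝓡 1) c).source → DifferentiableAt ℝ T w := fun w hw =>
    ((mdifferentiableAt_extChartAt' hw).comp w (mdifferentiableAt_angle w)).differentiableAt
  have hdet : ∀ w, fderiv ℝ T w (EuclideanSpace.single 0 1) 0 = (fderiv ℝ T w).det := fun w => by
    rw [det_eq_matrix_det, Matrix.det_fin_one]
    rfl
  -- In the angle coordinate the form is `r dx`, so its chart coefficient is `r` divided by the
  -- derivative of the coordinate change `T`.
  have hcoeff : ∀ w, angle w ∈ (extChartAt (𝓡 1) c).source →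
      (fderiv ℝ T w).det * chartCoeff c μ (T w) = r := fun w hw => by
    rw [hT, Function.comp_apply, ← formCoeff_eq_det_mul (mdifferentiableAt_angle w) hw μ]
    have h1 : formCoeff angle μ w = r * formCoeff angle circleForm w := rfl
    rw [h1, formCoeff_angle_circleForm, mul_one]
  have hfield : ∀ w, angle w ∈ (extChartAt (𝓡 1) c).source →
      chartField c u (T w) = f (w 0) • fderiv ℝ T w (EuclideanSpace.single 0 1) := fun w hw => by
    have h1 : chartField c u (T w) = (mfderiv (𝓡 1) (𝓡 1) (extChartAt (𝓡 1) c) (angle w) :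
        EuclideanSpace ℝ (Fin 1) →L[ℝ] EuclideanSpace ℝ (Fin 1)) (u (angle w)) := by
      have h2 : (extChartAt (𝓡 1) c).symm (T w) = angle w := (extChartAt (𝓡 1) c).left_inv hw
      have h3 : ∀ p q : Circle, p = q →
          (mfderiv (𝓡 1) (𝓡 1) (extChartAt (𝓡 1) c) p (u p) : EuclideanSpace ℝ (Fin 1)) =
            mfderiv (𝓡 1) (𝓡 1) (extChartAt (𝓡 1) c) q (u q) := by
        rintro p _ rfl
        rfl
      exact h3 _ _ h2
    have h2 := mfderiv_comp w (mdifferentiableAt_extChartAt' hw) (mdifferentiableAt_angle w)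
    rw [mfderiv_eq_fderiv] at h2
    have h3 := congrArg (fun L : EuclideanSpace ℝ (Fin 1) →L[ℝ] EuclideanSpace ℝ (Fin 1) =>
      L (EuclideanSpace.single 0 1)) h2
    rw [h1]
    have h4 : (u (angle w) : EuclideanSpace ℝ (Fin 1)) = f (w 0) •
        (mfderiv (𝓡 1) (𝓡 1) angle w (EuclideanSpace.single 0 (1 : ℝ)) :
          EuclideanSpace ℝ (Fin 1)) :=
      (hu (w 0)).trans (congrArg (fun v : EuclideanSpace ℝ (Fin 1) => f (w 0) • v)
        (mfderiv_angle w).symm)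
    rw [h4, map_smul]
    exact congrArg (fun v : EuclideanSpace ℝ (Fin 1) => f (w 0) • v) h3.symm
  set A : EuclideanSpace ℝ (Fin 1) → ℝ := fun y => chartCoeff c μ y * chartField c u y 0 with hA
  -- Density and field component transform with inverse factors, so their product in the chart is
  -- just `r f` of the angle. Differentiating it by the chain rule yields `f'`.
  have hAT : ∀ᶠ w in 𝓝 z₀, A (T w) = r * f (w 0) := by
    filter_upwards [hnhds] with w hw
    rw [hA]
    simp only
    rw [hfield w hw, PiLp.smul_apply, hdet, smul_eq_mul, ← hcoeff w hw]
    ring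
  have hw₀ : angle z₀ ∈ (extChartAt (𝓡 1) c).source := hnhds.self_of_nhds
  have hyt : T z₀ ∈ (extChartAt (𝓡 1) c).target := (extChartAt (𝓡 1) c).map_source hw₀
  have hAd : DifferentiableAt ℝ A (T z₀) :=
    (differentiableAt_chartCoeff hμ hyt).mul (differentiableAt_chartField_apply hyt u 0)
  have hdiv : divergence μ u c =
      (chartCoeff c μ (T z₀))⁻¹ * fderiv ℝ A (T z₀) (EuclideanSpace.single 0 1) := by
    have h1 : T z₀ = extChartAt (𝓡 1) c c := by rw [hT, Function.comp_apply, hz]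
    rw [h1, divergence, Fin.sum_univ_one]
  have hsingle : HasDerivAt (fun s : ℝ => (EuclideanSpace.single 0 s : EuclideanSpace ℝ (Fin 1)))
      (EuclideanSpace.single 0 1) x := by
    have e : (fun s : ℝ => (EuclideanSpace.single 0 s : EuclideanSpace ℝ (Fin 1))) =
        fun s => s • EuclideanSpace.single 0 1 := by
      funext s
      rw [single_zero_smul (EuclideanSpace.single 0 s)]
      simp
    rw [e]
    exact ((hasDerivAt_id x).smul_const _).congr_deriv (one_smul _ _)
  have hder : HasDerivAt (fun s : ℝ => A (T (EuclideanSpace.single 0 s)))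
      (fderiv ℝ A (T z₀) (fderiv ℝ T z₀ (EuclideanSpace.single 0 1))) x :=
    HasFDerivAt.comp_hasDerivAt (l := A) (f := fun s : ℝ => T (EuclideanSpace.single 0 s)) x
      hAd.hasFDerivAt (HasFDerivAt.comp_hasDerivAt (l := T) x (hTd z₀ hw₀).hasFDerivAt hsingle)
  have heq : f =ᶠ[𝓝 x] fun s => r⁻¹ * A (T (EuclideanSpace.single 0 s)) := by
    filter_upwards [hsingle.continuousAt.eventually hAT] with s hs
    rw [hs, inv_mul_cancel_left₀ hr.ne']
    simp
  refine ((hder.const_mul r⁻¹).congr_of_eventuallyEq heq).congr_deriv ?_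
  have hd := hcoeff z₀ hw₀
  rw [hdiv, single_zero_smul (fderiv ℝ T z₀ (EuclideanSpace.single 0 1)), hdet, map_smul,
    smul_eq_mul, ← mul_assoc]
  congr 1
  have h1 := chartCoeff_ne_zero h0 hyt
  rw [← hd]
  have h2 : (fderiv ℝ T z₀).det ≠ 0 := left_ne_zero_of_mul (hd.trans_ne hr.ne')
  field_simp

/-- On the circle, the form is the Gelfand–Fuchs cocycle. -/
theorem omegaForm_circle (hr : 0 < r) {g : ℝ → ℝ} {v : Vect 1 Circle}
    (hu : ∀ x, u (Circle.exp x) = f x • circlePartial x)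
    (hv : ∀ x, v (Circle.exp x) = g x • circlePartial x) :
    omegaForm circleVolume (r • circleVolume.toForm)
      ![lieDerivative (r • circleVolume.toForm) u, lieDerivative (r • circleVolume.toForm) v] =
        ∫ x in (0 : ℝ)..(2 * Real.pi), deriv f x * deriv (deriv g) x := by
  set μ : FormField 1 Circle := r • circleForm with hμd
  have hμ : μ ∈ smoothForms 1 Circle := Submodule.smul_mem _ _ circleVolume.smooth
  have h0 : ∀ p, μ p ≠ 0 := fun p => smul_ne_zero hr.ne' (circleVolume.ne_zero p)
  have hf : deriv f = divergence μ u ∘ Circle.exp :=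
    funext fun x => (hasDerivAt_divergence_circle hr hu x).deriv
  have hg : deriv g = divergence μ v ∘ Circle.exp :=
    funext fun x => (hasDerivAt_divergence_circle hr hv x).deriv
  have hD : ∀ i, ContMDiff (𝓡 1) 𝓘(ℝ, ℝ) ∞ ((![divergence μ u, divergence μ v] :
      Fin 2 → Circle → ℝ) i) := by
    intro i
    fin_cases i
    · exact contMDiff_divergence h0 hμ u
    · exact contMDiff_divergence h0 hμ v
  have hratio : (fun i => ratio ((![lieDerivative μ u, lieDerivative μ v] :
      Fin 2 → FormField 1 Circle) i) μ) = ![divergence μ u, divergence μ v] := by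
    funext i x
    fin_cases i
    · exact ratio_smul_self h0 _ x
    · exact ratio_smul_self h0 _ x
  change circleVolume.integral (wedgeForm fun i => ratio ((![lieDerivative μ u,
    lieDerivative μ v] : Fin 2 → FormField 1 Circle) i) μ) = _
  rw [hratio]
  refine circleVolume_integral (wedgeForm_mem_smoothForms hD) fun z => ?_
  rw [formCoeff_wedgeForm (mdifferentiableAt_angle z)
    fun i => (hD i).mdifferentiableAt (by simp), Matrix.det_fin_one, hf]
  -- The determinant has size one; what remains is the derivative of `div v`, that is of `g'`, along
  -- the angle.
  refine congrArg (fun d : ℝ => divergence μ u (Circle.exp (z 0)) * d) ?_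
  have hgd : DifferentiableAt ℝ (deriv g) (z 0) := by
    rw [hg]
    exact (((contMDiff_divergence h0 hμ v).mdifferentiableAt (by simp)).comp (z 0)
      (mdifferentiableAt_circleExp (z 0))).differentiableAt
  have h1 := hgd.hasDerivAt.comp_hasFDerivAt z
    (EuclideanSpace.proj (𝕜 := ℝ) (0 : Fin 1)).hasFDerivAt
  have h2 : (![divergence μ u, divergence μ v] : Fin 2 → Circle → ℝ) (Fin.succ 0) ∘ angle =
      deriv g ∘ EuclideanSpace.proj (𝕜 := ℝ) (0 : Fin 1) := by
    rw [hg]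
    rfl
  rw [Matrix.of_apply, h2, h1.fderiv]
  simp

end GelfandFuchs

end BottThurston

end

/-! ### The main theorem -/

theorem mainTheorem6 :
    (∀ (n : ℕ) (M : Type*) [TopologicalSpace M] [ChartedSpace (EuclideanSpace ℝ (Fin n)) M]
      [IsManifold (𝓡 n) ∞ M] [T2Space M] [CompactSpace M]
      (ν : VolumeForm n M) (μ : FormField n M), μ ∈ Prob ν →
      -- the antisymmetric form on the tangent space of `Prob(M)`
      ∃ Ω : TangentProb ν [⋀^Fin (n + 1)]→ₗ[ℝ] ℝ,
        (∀ a : Fin (n + 1) → TangentProb ν, Ω a = omegaForm ν μ fun i => a i) ∧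
        -- it is the mixed derivative of the Bott–Thurston cocycle
        (∀ (φ : Fin (n + 1) → DiffCurve ν) (a : Fin (n + 1) → TangentProb ν),
          (∀ i, IsTangent μ (φ i) (a i)) →
            ContDiff ℝ ∞ (fun t : Fin (n + 1) → ℝ =>
              bottThurston ν μ fun i => (φ i).toFun (t i)) ∧
            iteratedFDeriv ℝ (n + 1) (fun t : Fin (n + 1) → ℝ =>
              bottThurston ν μ fun i => (φ i).toFun (t i)) 0
              (fun i => Pi.single i (1 : ℝ)) = Ω a ∧
            ContDiff ℝ ∞ (fun t : Fin (n + 1) → ℝ =>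
              bottThurstonRev ν μ fun i => (φ i).toFun (t i)) ∧
            iteratedFDeriv ℝ (n + 1) (fun t : Fin (n + 1) → ℝ =>
              bottThurstonRev ν μ fun i => (φ i).toFun (t i)) 0
              (fun i => Pi.single i (1 : ℝ)) = Ω a) ∧
        -- every tangent vector comes from a curve of diffeomorphisms
        (ConnectedSpace M → ∀ a : TangentProb ν, ∃ φ : DiffCurve ν, IsTangent μ φ a) ∧
        -- it is a cocycle on the Lie algebra of vector fields
        (∃ D : Vect n M →ₗ[ℝ] TangentProb ν,
          (∀ u, (D u : FormField n M) = lieDerivative μ u) ∧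
          (∀ (φ : DiffCurve ν) (u : Vect n M), IsVelocity φ u → IsTangent μ φ (D u)) ∧
          ∀ u : Fin (n + 2) → Vect n M, lieDifferential (Ω.compLinearMap D) u = 0)) ∧
    -- the Gelfand–Fuchs cocycle on the circle, `θ = dx`
    (∃ θ : VolumeForm 1 Circle,
      (∀ x : ℝ, θ.toForm (Circle.exp x) (fun _ => circlePartial x) = 1) ∧
      (2 * Real.pi)⁻¹ • θ.toForm ∈ Prob θ ∧
      ∀ r : ℝ, 0 < r → ∀ (f g : ℝ → ℝ) (u v : Vect 1 Circle),
        (∀ x, u (Circle.exp x) = f x • circlePartial x) →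
        (∀ x, v (Circle.exp x) = g x • circlePartial x) →
        omegaForm θ (r • θ.toForm)
            ![lieDerivative (r • θ.toForm) u, lieDerivative (r • θ.toForm) v] =
          ∫ x in (0 : ℝ)..(2 * Real.pi), deriv f x * deriv (deriv g) x) := by
  refine ⟨fun n M _ _ _ _ _ ν μ hμ => ?_, circleVolume, circleForm_circlePartial,
    smul_circleForm_mem_Prob, fun r hr f g u v hu hv => omegaForm_circle hr hu hv⟩
  have h0 := ne_zero_of_mem_Prob hμ
  refine ⟨omegaAlternating ν hμ.1 h0, fun a => rfl, fun φ a ha => ?_,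
    fun _ a => exists_isTangent hμ a, lieDerivativeLinear ν h0 hμ.1, fun u => rfl,
    fun φ u h => isTangent_lieDerivative h0 hμ.1 h, lieDifferential_omega_eq_zero ν h0 hμ.1⟩
  -- The two conventions differ by reversing the list of factors, and being an initial list is
  -- stable under reversal.
  have h1 := mixed_derivative_listComp hμ φ isInitialList_take (fun i => (a i).2.1) ha
  have h2 := mixed_derivative_listComp hμ φ (fun i => (isInitialList_take i).reverse)
    (fun i => (a i).2.1) ha
  simp only [← partialProduct_eq_listComp] at h1
  simp only [← partialProductRev_eq_listComp] at h2
  exact ⟨h1.1, h1.2, h2.1, h2.2⟩
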